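/- Let $\mathbb{H}$ be the quaternions, $\mathbb{D}$ their open unit ball, $i\in\mathbb{H}$ an imaginary unit ($\mathrm{Re}\, i=0$, $|i|=1$), $\mathbb{C}_i=\mathbb{R}+i\mathbb{R}$, $\mathbb{D}_i=\mathbb{D}\cap\mathbb{C}_i$, and let $dm_i$ be the Lebesgue measure on $\mathbb{C}_i$. Let $\alpha>-1$, $dA_{\alpha,i}(z)=\frac{\alpha+1}{\pi}(1-|z|^2)^\alpha\,dm_i(z)$ and $d\mu_i(z)=\frac{1}{\pi(1-|z|^2)^2}\,dm_i(z)$ on $\mathbb{D}_i$. A real differentiable function $f:\mathbb{D}\to\mathbb{H}$ is left slice hyperholomorphic if $f(x_0+Ix_1)=a(x_0,x_1)+I\,b(x_0,x_1)$ for every imaginary unit $I$ and all real $x_0,x_1$ with $x_0+Ix_1\in\mathbb{D}$, where $a$ and $b$ are $\mathbb{H}$-valued, do not depend on $I$, are respectively even and odd in $x_1$, and satisfy $\partial_{x_0}a=\partial_{x_1}b$ and $\partial_{x_0}b=-\partial_{x_1}a$. Let $\mathcal{A}^2_{\alpha,i}(\mathbb{D})$ be the right quaternionic Hilbert space of all such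 $f$ with $\int_{\mathbb{D}_i}|f|^2\,dA_{\alpha,i}<\infty$, with the scalar product $\langle f,g\rangle=\int_{\mathbb{D}_i}\overline{f}\,g\,dA_{\alpha,i}$. Let $K_q$ be its reproducing kernel, i.e. $f(q)=\langle K_q,f\rangle$ for all $f$, and put $k_q=K_q/\sqrt{K_q(q)}$. Let $J$ be the unitary anti-selfadjoint operator that maps $f$ to the unique left slice hyperholomorphic function on $\mathbb{D}$ that coincides with $z\mapsto i f(z)$ on $\mathbb{D}_i$. For a bounded right linear operator $T$ on $\mathcal{A}^2_{\alpha,i}(\mathbb{D})$ with $TJ=JT$, the Berezin transform is $\widetilde T(q)=\langle k_q,Tk_q\rangle$, $q\in\mathbb{D}_i$. $T$ is positive if $\langle f,Tf\rangle\ge 0$ for all $f$. For $0<p<\infty$, $S_p(J)$ is the set of all compact right linear operators that commute with $J$ and whose sequence of singular values (the eigenvalues of $|T|=\sqrt{T^*T}$ in decreasing order, with multiplicity) is in $\ell^p$. Theorem. Let $T$ be a bounded positive operator on $\mathcal{A}^2_{\alpha,i}(\mathbb{D})$ that commutes with $J$. (i) If $1\le p<\infty$ and $T\in S_p(J)$,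 then $\widetilde T\in L^p(\mathbb{D}_i,d\mu_i)$. (ii) If $0<p\le 1$ and $\widetilde T\in L^p(\mathbb{D}_i,d\mu_i)$, then $T\in S_p(J)$. Moreover, if $1\le p<\infty$ and $T\in S_p(J)$ is not necessarily positive, then still $\widetilde T\in L^p(\mathbb{D}_i,d\mu_i)$. -/

import Mathlib

open scoped Quaternion ENNReal
open MeasureTheory MulOpposite

noncomputable section

namespace SliceBergman

/-! ### Slice hyperholomorphic functions -/

/-- The sphere of imaginary units of the quaternions. -/
abbrev ImUnit : Type := {q : ℍ // q.re = 0 ∧ ‖q‖ = 1}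

/-- The identification of the complex numbers with the slice spanned by `1` and `I`:
`x₀ + i x₁ ↦ x₀ + I x₁`. -/
def slicePt (I : ImUnit) (z : ℂ) : ℍ := (z.re : ℍ) + z.im • (I : ℍ)

/-- `f` is left slice hyperholomorphic on the (axially symmetric open) set `U`: it is real
differentiable and `f (x₀ + I x₁) = a x₀ x₁ + I b x₀ x₁`, where `a` is even and `b` is odd in `x₁`
and `a`, `b` satisfy the Cauchy-Riemann system
`∂a/∂x₀ = ∂b/∂x₁ = d`, `∂b/∂x₀ = - ∂a/∂x₁ = e`. -/
def IsLeftSliceHyperholomorphic (U : Set ℍ) (f : ℍ → ℍ) : Prop :=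
  DifferentiableOn ℝ f U ∧
  ∃ a b : ℝ → ℝ → ℍ, ∀ (I : ImUnit) (x₀ x₁ : ℝ), slicePt I ⟨x₀, x₁⟩ ∈ U →
    f (slicePt I ⟨x₀, x₁⟩) = a x₀ x₁ + I * b x₀ x₁ ∧
    a x₀ (-x₁) = a x₀ x₁ ∧ b x₀ (-x₁) = - b x₀ x₁ ∧
    ∃ d e : ℍ,
      HasDerivAt (fun t => a t x₁) d x₀ ∧ HasDerivAt (fun t => b x₀ t) d x₁ ∧
      HasDerivAt (fun t => b t x₁) e x₀ ∧ HasDerivAt (fun t => a x₀ t) (-e) x₁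

/-- The open unit ball of the quaternions. -/
abbrev unitBall : Set ℍ := Metric.ball 0 1

/-- The complex coordinate `x₀ + i |im x|` of a quaternion `x = x₀ + i_x |im x|`. -/
def sliceCoord (x : ℍ) : ℂ := ⟨x.re, ‖x.im‖⟩

/-- The imaginary unit `i_x = im x / |im x|` of a quaternion `x` (and `0` if `x` is real). -/
def unitOf (x : ℍ) : ℍ := ‖x.im‖⁻¹ • x.im

/-- The slice extension to the unit ball of a function `g` on the unit disk of the slice of `i`
(in the coordinate `z ↦ slicePt i z`), through the representation formula
`ext g (x) = (1 - i_x i)/2 * g (z) + (1 + i_x i)/2 * g (conj z)`, `z = x₀ + i |im x|`.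
For real `x` the factors `i_x` cancel. The extension is set to `0` outside of the unit ball. -/
def sliceExt (i : ImUnit) (g : ℂ → ℍ) (x : ℍ) : ℍ :=
  open Classical in
  if x ∈ unitBall then
    (2⁻¹ : ℝ) • ((1 - unitOf x * i) * g (sliceCoord x)) +
      (2⁻¹ : ℝ) • ((1 + unitOf x * i) * g (star (sliceCoord x)))
  else 0

/-! ### Measures on the disk -/

/-- The measure `(α+1)/π (1-|z|²)^α dm(z)` on the unit disk of a slice, in the coordinate of
`slicePt`. -/
def diskMeasure (α : ℝ) : Measure ℂ :=
  (volume.restrict (Metric.ball (0 : ℂ) 1)).withDensity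
    fun z => ENNReal.ofReal ((α + 1) / Real.pi * (1 - ‖z‖ ^ 2) ^ α)

/-- The Möbius invariant measure `dm(z) / (π (1-|z|²)²)` on the unit disk of a slice, in the
coordinate of `slicePt`. -/
def moebiusMeasure : Measure ℂ :=
  (volume.restrict (Metric.ball (0 : ℂ) 1)).withDensity
    fun z => ENNReal.ofReal (1 / (Real.pi * (1 - ‖z‖ ^ 2) ^ 2))

/-! ### Quaternionic inner product spaces and their operators -/

/-- A quaternionic scalar product on a right quaternionic vector space, which induces the norm.
(A quaternionic Hilbert space if the space is in addition complete.) -/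
class QInner (H : Type*) [NormedAddCommGroup H] [Module ℍᵐᵒᵖ H] where
  qinner : H → H → ℍ
  add_right : ∀ x y z, qinner x (y + z) = qinner x y + qinner x z
  smul_right : ∀ (x y : H) (a : ℍ), qinner x (op a • y) = qinner x y * a
  conj_symm : ∀ x y, star (qinner y x) = qinner x y
  inner_self : ∀ x, qinner x x = ((‖x‖ ^ 2 : ℝ) : ℍ)


section Operators

variable {H : Type*} [NormedAddCommGroup H] [Module ℍᵐᵒᵖ H] [QInner H]

/-- `T` is positive: `⟨x, T x⟩` is a nonnegative real for every `x`. -/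
def IsPositive (T : H →L[ℍᵐᵒᵖ] H) : Prop :=
  ∀ x, ∃ r : ℝ, 0 ≤ r ∧ QInner.qinner x (T x) = (r : ℍ)

/-- `S` is the adjoint of `T`. -/
def IsAdjoint (T S : H →L[ℍᵐᵒᵖ] H) : Prop :=
  ∀ x y, QInner.qinner (S x) y = QInner.qinner x (T y)

/-- `P` is `|T|`, the positive square root of `T* T`. -/
def IsAbs (T P : H →L[ℍᵐᵒᵖ] H) : Prop :=
  IsPositive P ∧ ∃ S, IsAdjoint T S ∧ P ∘L P = S ∘L T

/-- `s` is the sequence of singular values of `T`: the eigenvalues of `|T|`, with multiplicity, in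
decreasing order (continued by zeros if there are only finitely many nonzero ones). That is,
`|T| x = ∑ eₙ sₙ ⟨eₙ, x⟩` where the `eₙ` with `sₙ ≠ 0` are orthonormal. -/
def IsSingularValueSeq (T : H →L[ℍᵐᵒᵖ] H) (s : ℕ → ℝ) : Prop :=
  Antitone s ∧ (∀ n, 0 ≤ s n) ∧ ∃ P, IsAbs T P ∧ ∃ e : ℕ → H,
    (∀ m n, s m ≠ 0 → s n ≠ 0 → QInner.qinner (e m) (e n) = if m = n then 1 else 0) ∧
    ∀ x, HasSum (fun n => op ((s n : ℍ) * QInner.qinner (e n) x) • e n) (P x)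

/-- The `(J, p)`-Schatten class, for a unitary and anti-selfadjoint `J`: compact operators that commute with `J` and whose singular values
are in `ℓ^p`. -/
def Schatten (J : H →L[ℍᵐᵒᵖ] H) (p : ℝ≥0∞) : Set (H →L[ℍᵐᵒᵖ] H) :=
  {T | IsCompactOperator T ∧ T ∘L J = J ∘L T ∧ ∃ s : ℕ → ℝ, IsSingularValueSeq T s ∧ Memℓp s p}

end Operators

/-! ### The weighted slice Bergman space -/

theorem IsLeftSliceHyperholomorphic.zero (U : Set ℍ) :
    IsLeftSliceHyperholomorphic U (0 : ℍ → ℍ) := by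
  refine ⟨differentiableOn_const 0, fun _ _ => 0, fun _ _ => 0, fun I x₀ x₁ _ => ?_⟩
  refine ⟨by simp, by simp, by simp, 0, 0, ?_⟩
  rw [neg_zero]
  exact ⟨hasDerivAt_const x₀ (0 : ℍ), hasDerivAt_const x₁ (0 : ℍ), hasDerivAt_const x₀ (0 : ℍ),
    hasDerivAt_const x₁ (0 : ℍ)⟩

theorem IsLeftSliceHyperholomorphic.add {U : Set ℍ} {f g : ℍ → ℍ}
    (hf : IsLeftSliceHyperholomorphic U f) (hg : IsLeftSliceHyperholomorphic U g) :
    IsLeftSliceHyperholomorphic U (f + g) := by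
  obtain ⟨hfd, a, b, h⟩ := hf
  obtain ⟨hgd, a', b', h'⟩ := hg
  refine ⟨hfd.add hgd, fun s t => a s t + a' s t, fun s t => b s t + b' s t,
    fun I x₀ x₁ hx => ?_⟩
  obtain ⟨h1, h2, h3, d, e, h4, h5, h6, h7⟩ := h I x₀ x₁ hx
  obtain ⟨h1', h2', h3', d', e', h4', h5', h6', h7'⟩ := h' I x₀ x₁ hx
  refine ⟨?_, by simp only [h2, h2'], by simp only [h3, h3', neg_add], d + d', e + e', h4.add h4', h5.add h5',
    h6.add h6', ?_⟩
  · simp only [Pi.add_apply, h1, h1', mul_add]; abel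
  · rw [neg_add]; exact h7.add h7'

theorem IsLeftSliceHyperholomorphic.mul_right {U : Set ℍ} {f : ℍ → ℍ}
    (hf : IsLeftSliceHyperholomorphic U f) (c : ℍ) :
    IsLeftSliceHyperholomorphic U (fun x => f x * c) := by
  obtain ⟨hfd, a, b, h⟩ := hf
  refine ⟨hfd.mul_const c, fun s t => a s t * c, fun s t => b s t * c,
    fun I x₀ x₁ hx => ?_⟩
  obtain ⟨h1, h2, h3, d, e, h4, h5, h6, h7⟩ := h I x₀ x₁ hx
  refine ⟨?_, by simp only [h2], by simp only [h3, neg_mul], d * c, e * c, h4.mul_const c, h5.mul_const c,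
    h6.mul_const c, ?_⟩
  · simp only [h1, add_mul, mul_assoc]
  · rw [← neg_mul]; exact h7.mul_const c

/-- The left slice hyperholomorphic functions `f` on the unit ball with
`∫ |f|² dA_{α,i} < ∞` over the unit disk of the slice of `i`, as a right quaternionic vector
space. A function on the unit ball is represented by its extension by `0`. -/
def bergmanSubmodule (α : ℝ) (i : ImUnit) : Submodule ℍᵐᵒᵖ (ℍ → ℍ) where
  carrier := {f | (∀ x, x ∉ unitBall → f x = 0) ∧ IsLeftSliceHyperholomorphic unitBall f ∧
    MemLp (fun z => f (slicePt i z)) 2 (diskMeasure α)}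
  zero_mem' := ⟨fun _ _ => rfl, .zero _, MemLp.zero⟩
  add_mem' := by
    rintro f g ⟨h1, h2, h3⟩ ⟨h1', h2', h3'⟩
    exact ⟨fun x hx => by simp [h1 x hx, h1' x hx], h2.add h2', h3.add h3'⟩
  smul_mem' := by
    rintro c f ⟨h1, h2, h3⟩
    refine ⟨fun x hx => by simp [h1 x hx], h2.mul_right c.unop, ?_⟩
    exact ((ContinuousLinearMap.mul ℝ ℍ).flip c.unop).comp_memLp' h3

/-- The weighted slice Bergman space `A²_{α,i}` of the quaternionic unit ball. -/
def Bergman (α : ℝ) (i : ImUnit) : Type := bergmanSubmodule α i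

namespace Bergman

variable {α : ℝ} {i : ImUnit}

instance : AddCommGroup (Bergman α i) := inferInstanceAs (AddCommGroup (bergmanSubmodule α i))

instance : Module ℍᵐᵒᵖ (Bergman α i) := inferInstanceAs (Module ℍᵐᵒᵖ (bergmanSubmodule α i))

instance : Module ℝ (Bergman α i) := inferInstanceAs (Module ℝ (bergmanSubmodule α i))

instance : CoeFun (Bergman α i) (fun _ => ℍ → ℍ) := ⟨fun f => f.1⟩

@[ext] theorem ext {f g : Bergman α i} (h : ∀ x, f x = g x) : f = g := Subtype.ext (funext h)

theorem add_apply (f g : Bergman α i) (x : ℍ) : (f + g) x = f x + g x := rfl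

theorem smul_apply (c : ℍᵐᵒᵖ) (f : Bergman α i) (x : ℍ) : (c • f) x = f x * c.unop := rfl

theorem real_smul_apply (c : ℝ) (f : Bergman α i) (x : ℍ) : (c • f) x = c • f x := rfl

/-- The scalar product `∫ conj (f z) * g z dA_{α,i}(z)`. -/
def qinner (f g : Bergman α i) : ℍ :=
  ∫ z, star (f (slicePt i z)) * g (slicePt i z) ∂(diskMeasure α)

theorem integrable_qinner (f g : Bergman α i) :
    Integrable (fun z => star (f (slicePt i z)) * g (slicePt i z)) (diskMeasure α) := by
  have hf : MemLp (fun z => star (f (slicePt i z))) 2 (diskMeasure α) := by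
    refine f.2.2.2.of_le (continuous_star.comp_aestronglyMeasurable f.2.2.2.1) ?_
    exact Filter.Eventually.of_forall fun z => by simp
  exact memLp_one_iff_integrable.1 (g.2.2.2.mul' hf)

theorem qinner_add_right (f g h : Bergman α i) : qinner f (g + h) = qinner f g + qinner f h := by
  unfold qinner
  rw [← integral_add (integrable_qinner f g) (integrable_qinner f h)]
  simp only [add_apply, mul_add]

theorem qinner_smul_right (f g : Bergman α i) (a : ℍ) : qinner f (op a • g) = qinner f g * a := by
  have := ((ContinuousLinearMap.mul ℝ ℍ).flip a).integral_comp_comm (integrable_qinner f g)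
  simp only [ContinuousLinearMap.flip_apply, ContinuousLinearMap.mul_apply'] at this
  unfold qinner
  rw [← this]
  simp only [smul_apply, unop_op, mul_assoc]

theorem qinner_conj_symm (f g : Bergman α i) : star (qinner g f) = qinner f g := by
  let L : ℍ →L[ℝ] ℍ :=
    { toFun := star
      map_add' := star_add
      map_smul' := fun r x => Quaternion.star_smul r x
      cont := continuous_star }
  have h := L.integral_comp_comm (integrable_qinner g f)
  have hL : ∀ x, L x = star x := fun _ => rfl
  simp only [hL, star_mul, star_star] at h
  unfold qinner
  exact h.symm

theorem qinner_self (f : Bergman α i) :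
    qinner f f = ((∫ z, ‖f (slicePt i z)‖ ^ 2 ∂(diskMeasure α) : ℝ) : ℍ) := by
  unfold qinner
  have h : ∀ q : ℍ, star q * q = ((‖q‖ ^ 2 : ℝ) : ℍ) := fun q => by
    rw [Quaternion.star_mul_self, Quaternion.normSq_eq_norm_mul_self, sq]
  have h' : ∀ r : ℝ, (r : ℍ) = r • (1 : ℍ) := fun r => by ext <;> simp
  simp only [h, h']
  exact integral_smul_const _ _

theorem continuous_slicePt (I : ImUnit) : Continuous (slicePt I) := by
  unfold slicePt
  have : Continuous fun z : ℂ => ((z.re : ℝ) : ℍ) :=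
    Quaternion.continuous_coe.comp Complex.continuous_re
  fun_prop

theorem norm_slicePt (I : ImUnit) (z : ℂ) : ‖slicePt I z‖ = ‖z‖ := by
  have hI : (I : ℍ).re = 0 := I.2.1
  have h2 : Quaternion.normSq (I : ℍ) = 1 := by
    rw [Quaternion.normSq_eq_norm_mul_self, I.2.2, one_mul]
  rw [Quaternion.normSq_def', hI] at h2
  have h1 : Quaternion.normSq (slicePt I z) = ‖z‖ * ‖z‖ := by
    rw [Quaternion.normSq_def', Complex.norm_mul_self_eq_normSq, Complex.normSq_apply]
    simp only [slicePt, Quaternion.re_add, Quaternion.re_coe, Quaternion.re_smul, hI,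
      Quaternion.imI_add, Quaternion.imI_coe, Quaternion.imI_smul, Quaternion.imJ_add,
      Quaternion.imJ_coe, Quaternion.imJ_smul, Quaternion.imK_add,
      Quaternion.imK_coe, Quaternion.imK_smul, smul_eq_mul]
    linear_combination z.im ^ 2 * h2
  rw [Quaternion.normSq_eq_norm_mul_self] at h1
  exact (mul_self_inj_of_nonneg (norm_nonneg _) (norm_nonneg _)).1 h1

theorem slicePt_mem {I : ImUnit} {z : ℂ} : slicePt I z ∈ unitBall ↔ z ∈ Metric.ball (0 : ℂ) 1 := by
  simp [norm_slicePt]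

/-- Every quaternion lies on a slice. -/
theorem exists_slicePt (i : ImUnit) (x : ℍ) : ∃ I : ImUnit, x = slicePt I (sliceCoord x) ∧
    (x.im ≠ 0 → (I : ℍ) = unitOf x) := by
  by_cases h : x.im = 0
  · refine ⟨i, ?_, fun h' => absurd h h'⟩
    rw [slicePt, sliceCoord, h]
    simpa [h] using (Quaternion.re_add_im x).symm
  · have h' : ‖x.im‖ ≠ 0 := norm_ne_zero_iff.2 h
    refine ⟨⟨unitOf x, ?_, ?_⟩, ?_, fun _ => rfl⟩
    · simp [unitOf]
    · rw [unitOf, norm_smul, norm_inv, norm_norm, inv_mul_cancel₀ h']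
    · simp only [slicePt, sliceCoord, unitOf, smul_smul, mul_inv_cancel₀ h', one_smul]
      exact (Quaternion.re_add_im x).symm

theorem slice_conj {f : ℍ → ℍ} (hf : IsLeftSliceHyperholomorphic unitBall f) :
    ∃ a b : ℂ → ℍ, ∀ z ∈ Metric.ball (0 : ℂ) 1, b (star z) = - b z ∧ ∀ I : ImUnit,
      f (slicePt I z) = a z + I * b z ∧ f (slicePt I (star z)) = a z - I * b z := by
  obtain ⟨-, a, b, h⟩ := hf
  refine ⟨fun z => a z.re z.im, fun z => b z.re z.im, fun z hz => ?_⟩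
  have key : ∀ I : ImUnit, f (slicePt I z) = a z.re z.im + I * b z.re z.im ∧
      f (slicePt I (star z)) = a z.re z.im - I * b z.re z.im ∧
      b z.re (-z.im) = - b z.re z.im := fun I => by
    obtain ⟨h1, h2, h3, -⟩ := h I z.re z.im (slicePt_mem.2 hz)
    have hz' : star z ∈ Metric.ball (0 : ℂ) 1 := by simpa using hz
    obtain ⟨h4, -⟩ := h I (star z).re (star z).im (slicePt_mem.2 hz')
    have e : (star z).re = z.re := rfl
    have e' : (star z).im = -z.im := rfl
    refine ⟨h1, ?_, h3⟩
    calc f (slicePt I (star z)) = a (star z).re (star z).im + I * b (star z).re (star z).im := h4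
      _ = _ := by rw [e, e', h2, h3, mul_neg, sub_eq_add_neg]
  refine ⟨?_, fun I => ⟨(key I).1, (key I).2.1⟩⟩
  let q : ℍ := ⟨0, 1, 0, 0⟩
  have hq : ‖q‖ * ‖q‖ = 1 := by
    rw [← Quaternion.normSq_eq_norm_mul_self, Quaternion.normSq_def']; simp [q]
  exact (key ⟨q, rfl, by nlinarith [norm_nonneg q]⟩).2.2

theorem ImUnit.mul_self (I : ImUnit) : (I : ℍ) * I = -1 := by
  have h : star (I : ℍ) = -I := by
    have := I.2.1
    ext <;> simp [this]
  have h2 : (I : ℍ) * star (I : ℍ) = 1 := by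
    rw [Quaternion.self_mul_star, Quaternion.normSq_eq_norm_mul_self, I.2.2]; simp
  rw [h, mul_neg] at h2
  rw [← h2, neg_neg]

theorem eq_zero_of_slice (f : Bergman α i)
    (h : ∀ z ∈ Metric.ball (0 : ℂ) 1, f (slicePt i z) = 0) : f = 0 := by
  refine Bergman.ext fun x => ?_
  change f x = 0
  by_cases hx : x ∈ unitBall
  · obtain ⟨a, b, hab⟩ := slice_conj f.2.2.1
    obtain ⟨I, hI, -⟩ := exists_slicePt i x
    have hz : sliceCoord x ∈ Metric.ball (0 : ℂ) 1 := by rwa [hI, slicePt_mem] at hx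
    have hz' : star (sliceCoord x) ∈ Metric.ball (0 : ℂ) 1 := by simpa using hz
    obtain ⟨-, h1⟩ := hab _ hz
    have e1 := (h1 i).1.symm.trans (h _ hz)
    have e2 := (h1 i).2.symm.trans (h _ hz')
    have ea : a (sliceCoord x) = 0 := by
      have := congrArg₂ (· + ·) e1 e2
      simp only [add_zero, add_add_sub_cancel] at this
      rw [← two_smul ℝ] at this
      exact (smul_eq_zero.1 this).resolve_left two_ne_zero
    rw [ea, zero_add] at e1
    have hi : (i : ℍ) ≠ 0 := norm_ne_zero_iff.1 (by rw [i.2.2]; exact one_ne_zero)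
    have eb := (mul_eq_zero.1 e1).resolve_left hi
    have := (h1 I).1
    rw [← hI, ea, eb] at this
    simpa using this
  · exact f.2.1 x hx

theorem continuousOn_slice (f : Bergman α i) :
    ContinuousOn (fun z => f (slicePt i z)) (Metric.ball (0 : ℂ) 1) :=
  f.2.2.1.1.continuousOn.comp (continuous_slicePt i).continuousOn fun _ hz => slicePt_mem.2 hz

theorem eq_zero_of_integral (hα : -1 < α) (f : Bergman α i)
    (h : ∫ z, ‖f (slicePt i z)‖ ^ 2 ∂(diskMeasure α) = 0) : f = 0 := by
  have h1 : Integrable (fun z => ‖f (slicePt i z)‖ ^ 2) (diskMeasure α) :=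
    f.2.2.2.integrable_norm_pow two_ne_zero
  have h2 := (integral_eq_zero_iff_of_nonneg (fun z => by positivity) h1).1 h
  have hm : Measurable fun z : ℂ =>
      ENNReal.ofReal ((α + 1) / Real.pi * (1 - ‖z‖ ^ 2) ^ α) := by fun_prop
  have h3 := (ae_withDensity_iff hm).1 h2
  have h4 : ∀ᵐ z ∂(volume.restrict (Metric.ball (0 : ℂ) 1)), f (slicePt i z) = 0 := by
    filter_upwards [h3, ae_restrict_mem Metric.isOpen_ball.measurableSet] with z hz hz'
    have hz1 : ‖z‖ < 1 := by simpa using hz'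
    have : 0 < (α + 1) / Real.pi * (1 - ‖z‖ ^ 2) ^ α :=
      mul_pos (div_pos (by linarith) Real.pi_pos)
        (Real.rpow_pos_of_pos (by nlinarith [norm_nonneg z]) _)
    simpa using hz (by simpa using this)
  refine eq_zero_of_slice f ?_
  exact Measure.eqOn_open_of_ae_eq h4 Metric.isOpen_ball (continuousOn_slice f) continuousOn_const

section HilbertSpace

variable [hα : Fact (-1 < α)]

/-- The real inner product `Re ⟨f, g⟩`. -/
@[reducible]
def core : InnerProductSpace.Core ℝ (Bergman α i) where
  inner f g := (qinner f g).re
  conj_inner_symm f g := by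
    rw [← qinner_conj_symm f g]; simp
  re_inner_nonneg f := by
    rw [qinner_self]
    exact integral_nonneg fun z => by positivity
  add_left f g h := by
    rw [← qinner_conj_symm, qinner_add_right, ← qinner_conj_symm f, ← qinner_conj_symm g]; simp
  smul_left f g r := by
    have h : r • f = op (r : ℍ) • f := Bergman.ext fun x => by
      rw [real_smul_apply, smul_apply, unop_op, Quaternion.mul_coe_eq_smul]
    rw [h, ← qinner_conj_symm, qinner_smul_right, ← qinner_conj_symm f]
    simp
  definite f hf := by
    rw [qinner_self] at hf
    exact eq_zero_of_integral hα.out f hf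

/-- The norm `‖f‖ = ⟨f, f⟩^(1/2) = (∫ |f|² dA_{α,i})^(1/2)`. -/
instance : NormedAddCommGroup (Bergman α i) := core.toNormedAddCommGroup

theorem norm_sq (f : Bergman α i) : ‖f‖ ^ 2 = ∫ z, ‖f (slicePt i z)‖ ^ 2 ∂(diskMeasure α) := by
  have h : ‖f‖ = √((qinner f f).re) := rfl
  rw [h, qinner_self, Quaternion.re_coe, Real.sq_sqrt]
  exact integral_nonneg fun z => by positivity

instance : QInner (Bergman α i) where
  qinner := qinner
  add_right := qinner_add_right
  smul_right := qinner_smul_right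
  conj_symm := qinner_conj_symm
  inner_self f := by rw [qinner_self, norm_sq]

end HilbertSpace

/-! ### The left multiplication by `i` on a slice -/

theorem slicePt_im (I : ImUnit) (z : ℂ) : (slicePt I z).im = z.im • (I : ℍ) := by
  have := I.2.1
  ext <;> simp [slicePt, this]

theorem slicePt_re (I : ImUnit) (z : ℂ) : (slicePt I z).re = z.re := by
  simp [slicePt, I.2.1]

theorem star_slicePt (I : ImUnit) (z : ℂ) : star (slicePt I z) = slicePt I (star z) := by
  have := I.2.1
  ext <;> simp [slicePt, this]

theorem eq_zero_of_self_eq_neg {q : ℍ} (h : q = -q) : q = 0 := by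
  have h2 : (2 : ℝ) • q = 0 := by rw [two_smul]; nth_rewrite 1 [h]; exact neg_add_cancel q
  exact (smul_eq_zero.1 h2).resolve_left two_ne_zero

theorem sliceExt_left_mul (f : Bergman α i) {a b : ℂ → ℍ}
    (hab : ∀ z ∈ Metric.ball (0 : ℂ) 1, b (star z) = - b z ∧ ∀ I : ImUnit,
      f (slicePt I z) = a z + I * b z ∧ f (slicePt I (star z)) = a z - I * b z)
    (I : ImUnit) {z : ℂ} (hz : z ∈ Metric.ball (0 : ℂ) 1) :
    sliceExt i (fun w => i * f (slicePt i w)) (slicePt I z) = i * a z + I * (i * b z) := by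
  obtain ⟨hb, h⟩ := hab z hz
  have hii := ImUnit.mul_self i
  have key : ∀ u v : ℍ, (2⁻¹ : ℝ) • ((1 - u * i) * (i * (a z + i * v))) +
      (2⁻¹ : ℝ) • ((1 + u * i) * (i * (a z - i * v))) = i * a z + u * (i * v) := by
    intro u v
    have e1 : ∀ w : ℍ, (i : ℍ) * (i * w) = -w := fun w => by rw [← mul_assoc, hii, neg_one_mul]
    have e2 : (1 - u * i) * (i * (a z + i * v)) + (1 + u * i) * (i * (a z - i * v)) =
        (2 : ℝ) • (i * a z + u * (i * v)) := by
      simp only [sub_mul, add_mul, one_mul, mul_assoc, mul_add, mul_sub, e1, mul_neg, two_smul]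
      abel
    rw [← smul_add, e2, smul_smul, inv_mul_cancel₀ two_ne_zero, one_smul]
  have hn : ‖(slicePt I z).im‖ = |z.im| := by
    rw [slicePt_im, norm_smul, I.2.2, mul_one, Real.norm_eq_abs]
  rw [sliceExt, if_pos (slicePt_mem.2 hz)]
  rcases lt_trichotomy z.im 0 with h0 | h0 | h0
  · have hc : sliceCoord (slicePt I z) = star z := by
      apply Complex.ext
      · exact slicePt_re I z
      · change ‖(slicePt I z).im‖ = -z.im
        rw [hn, abs_of_neg h0]
    have hu : unitOf (slicePt I z) = -I := by
      rw [unitOf, hn, slicePt_im, smul_smul, abs_of_neg h0, inv_neg, neg_mul,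
        inv_mul_cancel₀ h0.ne, neg_one_smul]
    rw [hc, hu, star_star, (h i).1, (h i).2]
    have := key (-I) (-b z)
    simp only [mul_neg, ← sub_eq_add_neg, sub_neg_eq_add, neg_mul, neg_neg] at this
    simpa only [neg_mul, sub_neg_eq_add, ← sub_eq_add_neg] using this
  · have hz0 : star z = z := Complex.ext rfl (by simp [h0])
    have hb0 : b z = 0 := by
      rw [hz0] at hb
      exact eq_zero_of_self_eq_neg hb
    have hc : sliceCoord (slicePt I z) = z := by
      apply Complex.ext
      · exact slicePt_re I z
      · change ‖(slicePt I z).im‖ = z.im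
        rw [hn, h0, abs_zero]
    have hu : unitOf (slicePt I z) = 0 := by
      rw [unitOf, slicePt_im, h0, zero_smul, smul_zero]
    have := key 0 0
    rw [hc, hu, hz0, (h i).1, hb0]
    simpa only [mul_zero, add_zero, sub_zero, zero_mul] using this
  · have hc : sliceCoord (slicePt I z) = z := by
      apply Complex.ext
      · exact slicePt_re I z
      · change ‖(slicePt I z).im‖ = z.im
        rw [hn, abs_of_pos h0]
    have hu : unitOf (slicePt I z) = I := by
      rw [unitOf, hn, slicePt_im, smul_smul, abs_of_pos h0, inv_mul_cancel₀ h0.ne', one_smul]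
    rw [hc, hu, (h i).1, (h i).2]
    exact key I (b z)

/-- The imaginary part as a continuous linear map. -/
def imL : ℍ →L[ℝ] ℍ where
  toFun x := x.im
  map_add' x y := by ext <;> simp
  map_smul' r x := by ext <;> simp
  cont := Quaternion.continuous_im

/-- The real part as a continuous linear map. -/
def reL : ℍ →L[ℝ] ℝ where
  toFun x := x.re
  map_add' x y := by simp
  map_smul' r x := by simp
  cont := Quaternion.continuous_re

/-- Conjugation as a continuous linear map. -/
def starL : ℍ →L[ℝ] ℍ where
  toFun x := star x
  map_add' := star_add
  map_smul' r x := Quaternion.star_smul r x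
  cont := continuous_star

/-- The map `x₀ + i_x |im x| ↦ x₀ + i |im x|` onto the slice of `i`. -/
theorem slicePt_sliceCoord (i : ImUnit) (x : ℍ) :
    slicePt i (sliceCoord x) = reL x • (1 : ℍ) + ‖imL x‖ • (i : ℍ) := by
  have : ∀ r : ℝ, (r : ℍ) = r • (1 : ℍ) := fun r => by ext <;> simp
  rw [slicePt, this]; rfl

theorem differentiableOn_sliceExt (f : Bergman α i) :
    DifferentiableOn ℝ (sliceExt i (fun w => i * f (slicePt i w))) unitBall := by
  obtain ⟨a, b, hab⟩ := slice_conj f.2.2.1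
  have hfd : ∀ x ∈ unitBall, DifferentiableAt ℝ (f : ℍ → ℍ) x := fun x hx =>
    (f.2.2.1.1 x hx).differentiableAt (Metric.isOpen_ball.mem_nhds hx)
  have hstar : ∀ x : ℍ, x ∈ unitBall → starL x ∈ unitBall := fun x hx => by
    change star x ∈ unitBall
    simpa using hx
  have hfd' : ∀ x ∈ unitBall, DifferentiableAt ℝ (fun y => f (starL y)) x := fun x hx =>
    (hfd _ (hstar x hx)).comp x starL.differentiableAt
  let h : ℍ → ℍ := fun y => (2⁻¹ : ℝ) • (f y - f (starL y))
  have hh : ∀ x ∈ unitBall, DifferentiableAt ℝ h x := fun x hx =>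
    ((hfd x hx).sub (hfd' x hx)).const_smul (2⁻¹ : ℝ)
  let k : ℍ → ℍ := fun y => (2⁻¹ : ℝ) • (f y + f (starL y))
  have hk : ∀ x ∈ unitBall, DifferentiableAt ℝ k x := fun x hx =>
    ((hfd x hx).add (hfd' x hx)).const_smul (2⁻¹ : ℝ)
  let P : ℍ → ℍ := fun x => reL x • (1 : ℍ) + ‖imL x‖ • (i : ℍ)
  have hP : ∀ x ∈ unitBall, P x ∈ unitBall := fun x hx => by
    obtain ⟨I, hI, -⟩ := exists_slicePt i x
    rw [hI, slicePt_mem] at hx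
    have hPx : P x = slicePt i (sliceCoord x) := (slicePt_sliceCoord i x).symm
    rw [hPx]
    exact slicePt_mem.2 hx
  let G : ℍ → ℍ := fun x => (‖imL x‖⁻¹ • imL x) * h (P x)
  have hFG : ∀ x ∈ unitBall,
      sliceExt i (fun w => i * f (slicePt i w)) x = i * k x + G x := fun x hx => by
    obtain ⟨I, hI, hI'⟩ := exists_slicePt i x
    have hz : sliceCoord x ∈ Metric.ball (0 : ℂ) 1 := by rwa [hI, slicePt_mem] at hx
    obtain ⟨hb, h1⟩ := hab _ hz
    have e1 : sliceExt i (fun w => i * f (slicePt i w)) x =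
        i * a (sliceCoord x) + I * (i * b (sliceCoord x)) := by
      have := sliceExt_left_mul f hab I hz
      rwa [← hI] at this
    have e2 : k x = a (sliceCoord x) := by
      have hs : starL x = slicePt I (star (sliceCoord x)) := by
        rw [← star_slicePt, ← hI]; rfl
      have h3 := (h1 I).1
      rw [← hI] at h3
      change (2⁻¹ : ℝ) • (f x + f (starL x)) = _
      rw [hs, (h1 I).2, h3, add_add_sub_cancel, ← two_smul ℝ, smul_smul,
        inv_mul_cancel₀ two_ne_zero, one_smul]
    have e3 : h (P x) = i * b (sliceCoord x) := by
      have hPx : P x = slicePt i (sliceCoord x) := (slicePt_sliceCoord i x).symm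
      change (2⁻¹ : ℝ) • (f (P x) - f (star (P x))) = _
      rw [hPx, star_slicePt, (h1 i).1, (h1 i).2, add_sub_sub_cancel, ← two_smul ℝ, smul_smul,
        inv_mul_cancel₀ two_ne_zero, one_smul]
    have e4 : G x = I * (i * b (sliceCoord x)) := by
      change unitOf x * h (P x) = _
      rw [e3]
      by_cases h0 : x.im = 0
      · have hc : star (sliceCoord x) = sliceCoord x :=
          Complex.ext rfl (by simp [sliceCoord, h0])
        rw [hc] at hb
        rw [eq_zero_of_self_eq_neg hb]; simp
      · rw [hI' h0]
    rw [e1, e2, e4]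
  have hG : ∀ x ∈ unitBall, DifferentiableAt ℝ G x := fun x hx => by
    by_cases h0 : imL x = 0
    · have h0' : x.im = 0 := h0
      have hx' : ∀ y : ℍ, imL y = 0 → h y = 0 := fun y hy => by
        have hs : starL y = y := by
          have hy' : y.im = 0 := hy
          have := Quaternion.re_add_im y
          rw [hy', add_zero] at this
          change star y = y
          rw [← this, Quaternion.star_coe]
        change (2⁻¹ : ℝ) • (f y - f (starL y)) = 0
        rw [hs, sub_self, smul_zero]
      have hPx : P x = x := by
        have := Quaternion.re_add_im x
        rw [h0', add_zero] at this
        change reL x • (1 : ℍ) + ‖imL x‖ • (i : ℍ) = x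
        rw [h0, norm_zero, zero_smul, add_zero]
        conv_rhs => rw [← this]
        change x.re • (1 : ℍ) = _
        ext <;> simp
      obtain ⟨L, hL⟩ := hh x hx
      have hL1 : L 1 = 0 := by
        have hd : HasDerivAt (fun t : ℝ => h (x + t • (1 : ℍ))) (L 1) 0 := by
          have hc : HasDerivAt (fun t : ℝ => x + t • (1 : ℍ)) (1 : ℍ) 0 := by
            simpa using ((hasDerivAt_id (0 : ℝ)).smul_const (1 : ℍ)).const_add x
          have hL0 : HasFDerivAt h L ((fun t : ℝ => x + t • (1 : ℍ)) 0) := by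
            have : (fun t : ℝ => x + t • (1 : ℍ)) 0 = x := by simp
            rw [this]; exact hL
          exact HasFDerivAt.comp_hasDerivAt (l := h) (f := fun t : ℝ => x + t • (1 : ℍ)) (0 : ℝ)
            hL0 hc
        have hz : (fun t : ℝ => h (x + t • (1 : ℍ))) = fun _ => 0 := funext fun t => by
          apply hx'
          rw [map_add, h0, map_smul, zero_add]
          have : imL (1 : ℍ) = 0 := by
            change (1 : ℍ).im = 0
            ext <;> simp
          rw [this, smul_zero]
        rw [hz] at hd
        exact hd.unique (hasDerivAt_const _ _)
      refine ⟨((ContinuousLinearMap.mul ℝ ℍ).flip (L i)).comp imL, ?_⟩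
      have hPt : Filter.Tendsto P (nhds x) (nhds x) := by
        have : Continuous P := by
          change Continuous fun x => reL x • (1 : ℍ) + ‖imL x‖ • (i : ℍ)
          fun_prop
        simpa [hPx] using this.tendsto x
      have hPn : ∀ y, ‖P y - x‖ = ‖y - x‖ := fun y => by
        have e : P y - x = slicePt i ⟨reL (y - x), ‖imL (y - x)‖⟩ := by
          have e' := slicePt_sliceCoord i (y - x)
          change slicePt i (sliceCoord (y - x)) = _ at e'
          change _ = slicePt i (sliceCoord (y - x))
          rw [e', map_sub, map_sub, h0, sub_zero]
          conv_lhs => rw [← hPx]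
          change reL y • (1 : ℍ) + ‖imL y‖ • (i : ℍ) - (reL x • (1 : ℍ) + ‖imL x‖ • (i : ℍ)) = _
          rw [h0, norm_zero, zero_smul, add_zero, sub_smul]
          abel
        rw [e]
        obtain ⟨I, hI, -⟩ := exists_slicePt i (y - x)
        conv_rhs => rw [hI, norm_slicePt]
        rw [norm_slicePt]; rfl
      have hlo := hL.isLittleO.comp_tendsto hPt
      rw [hasFDerivAt_iff_isLittleO]
      have hlo2 : (fun y => h (P y) - h x - L (P y - x)) =o[nhds x] fun y => y - x :=
        hlo.trans_isBigO (Asymptotics.isBigO_of_le _ fun y => (hPn y).le)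
      refine Asymptotics.IsBigO.trans_isLittleO (Asymptotics.isBigO_of_le _ fun y => ?_) hlo2
      have hGx : G x = 0 := by
        change (‖imL x‖⁻¹ • imL x) * h (P x) = 0
        rw [h0, smul_zero, zero_mul]
      have hPy : P y - x = (reL (y - x)) • (1 : ℍ) + ‖imL y‖ • (i : ℍ) := by
        conv_lhs => rw [← hPx]
        change reL y • (1 : ℍ) + ‖imL y‖ • (i : ℍ) - (reL x • (1 : ℍ) + ‖imL x‖ • (i : ℍ)) = _
        rw [h0, norm_zero, zero_smul, add_zero, map_sub, sub_smul]
        abel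
      have e : G y - G x - (((ContinuousLinearMap.mul ℝ ℍ).flip (L i)).comp imL) (y - x) =
          (‖imL y‖⁻¹ • imL y) * (h (P y) - h x - L (P y - x)) := by
        rw [hGx, hx' x h0, hPy, map_add, map_smul, map_smul, hL1, smul_zero, zero_add, sub_zero,
          sub_zero, mul_sub]
        change G y - imL (y - x) * L i = G y - _
        rw [map_sub, h0, sub_zero, mul_smul_comm, smul_mul_assoc, smul_smul]
        by_cases hy : imL y = 0
        · simp [hy]
        · rw [mul_inv_cancel₀ (norm_ne_zero_iff.2 hy), one_smul]
      rw [e, norm_mul]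
      refine mul_le_of_le_one_left (norm_nonneg _) ?_
      rw [norm_smul, norm_inv, norm_norm]
      exact inv_mul_le_one
    · have hn : DifferentiableAt ℝ (fun y => ‖imL y‖) x :=
        (imL.differentiableAt (x := x)).norm ℝ h0
      have hPd : DifferentiableAt ℝ P x :=
        (reL.differentiableAt.smul_const _).add (hn.smul_const _)
      have h1 : DifferentiableAt ℝ (fun y => h (P y)) x :=
        (hh (P x) (hP x hx)).comp x hPd
      exact ((hn.inv (norm_ne_zero_iff.2 h0)).smul imL.differentiableAt).mul h1
  intro x hx
  refine DifferentiableWithinAt.congr (f := fun x => i * k x + G x) ?_ hFG (hFG x hx)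
  exact (((hk x hx).const_mul _).add (hG x hx)).differentiableWithinAt

theorem sliceExt_slicePt (f : Bergman α i) {z : ℂ} (hz : z ∈ Metric.ball (0 : ℂ) 1) :
    sliceExt i (fun w => i * f (slicePt i w)) (slicePt i z) = i * f (slicePt i z) := by
  obtain ⟨a, b, hab⟩ := slice_conj f.2.2.1
  rw [sliceExt_left_mul f hab i hz, ((hab z hz).2 i).1, mul_add]

theorem sliceExt_mem (f : Bergman α i) :
    sliceExt i (fun w => i * f (slicePt i w)) ∈ bergmanSubmodule α i := by
  refine ⟨fun x hx => if_neg hx, ⟨differentiableOn_sliceExt f, ?_⟩, ?_⟩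
  · obtain ⟨-, a, b, h⟩ := f.2.2.1
    have hab : ∀ z ∈ Metric.ball (0 : ℂ) 1, b z.re (-z.im) = - b z.re z.im ∧ ∀ I : ImUnit,
        f (slicePt I z) = a z.re z.im + I * b z.re z.im ∧
        f (slicePt I (star z)) = a z.re z.im - I * b z.re z.im := fun z hz => by
      have hz' : star z ∈ Metric.ball (0 : ℂ) 1 := by simpa using hz
      refine ⟨(h i z.re z.im (slicePt_mem.2 hz)).2.2.1, fun I => ?_⟩
      obtain ⟨h1, h2, h3, -⟩ := h I z.re z.im (slicePt_mem.2 hz)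
      obtain ⟨h4, -⟩ := h I z.re (-z.im) (slicePt_mem.2 hz')
      refine ⟨h1, ?_⟩
      rw [h2, h3, mul_neg, ← sub_eq_add_neg] at h4
      exact h4
    refine ⟨fun s t => i * a s t, fun s t => i * b s t, fun I x₀ x₁ hx => ?_⟩
    obtain ⟨h1, h2, h3, d, e, h4, h5, h6, h7⟩ := h I x₀ x₁ hx
    refine ⟨sliceExt_left_mul f (a := fun z => a z.re z.im) (b := fun z => b z.re z.im) hab I
      (slicePt_mem.1 hx), by simp only [h2], by simp only [h3, mul_neg], i * d, i * e,
      h4.const_mul _, h5.const_mul _, h6.const_mul _, ?_⟩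
    rw [← mul_neg]; exact h7.const_mul _
  · have h1 : MemLp (fun z => i * f (slicePt i z)) 2 (diskMeasure α) :=
      (ContinuousLinearMap.mul ℝ ℍ (i : ℍ)).comp_memLp' f.2.2.2
    refine h1.ae_eq ?_
    have hac : diskMeasure α ≪ volume.restrict (Metric.ball (0 : ℂ) 1) :=
      withDensity_absolutelyContinuous _ _
    refine hac.ae_le ?_
    filter_upwards [ae_restrict_mem Metric.isOpen_ball.measurableSet] with z hz
    exact (sliceExt_slicePt f hz).symm

theorem eq_of_slice {f g : Bergman α i}
    (h : ∀ z ∈ Metric.ball (0 : ℂ) 1, f (slicePt i z) = g (slicePt i z)) : f = g := by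
  rw [← sub_eq_zero]
  exact eq_zero_of_slice _ fun z hz => sub_eq_zero.2 (h z hz)

/-- The function `ext (i f_i)`: multiply the restriction of `f` to the slice of `i` by `i` from the
left, and extend. -/
def leftMul (f : Bergman α i) : Bergman α i :=
  ⟨sliceExt i (fun w => i * f (slicePt i w)), sliceExt_mem f⟩

theorem leftMul_slicePt (f : Bergman α i) {z : ℂ} (hz : z ∈ Metric.ball (0 : ℂ) 1) :
    leftMul f (slicePt i z) = i * f (slicePt i z) := sliceExt_slicePt f hz

theorem leftMul_add (f g : Bergman α i) : leftMul (f + g) = leftMul f + leftMul g :=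
  eq_of_slice fun z hz => by
    rw [add_apply, leftMul_slicePt _ hz, leftMul_slicePt _ hz, leftMul_slicePt _ hz, add_apply,
      mul_add]

theorem leftMul_smul (c : ℍᵐᵒᵖ) (f : Bergman α i) : leftMul (c • f) = c • leftMul f :=
  eq_of_slice fun z hz => by
    rw [smul_apply, leftMul_slicePt _ hz, leftMul_slicePt _ hz, smul_apply, mul_assoc]

theorem norm_leftMul [Fact (-1 < α)] (f : Bergman α i) : ‖leftMul f‖ = ‖f‖ := by
  refine (sq_eq_sq₀ (norm_nonneg _) (norm_nonneg _)).1 ?_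
  rw [norm_sq, norm_sq]
  refine integral_congr_ae ?_
  have hac : diskMeasure α ≪ volume.restrict (Metric.ball (0 : ℂ) 1) :=
    withDensity_absolutelyContinuous _ _
  refine hac.ae_le ?_
  filter_upwards [ae_restrict_mem Metric.isOpen_ball.measurableSet] with z hz
  rw [leftMul_slicePt _ hz, norm_mul, i.2.2, one_mul]

/-- The operator `J f = ext (i f_i)` on the Bergman space. -/
def J (α : ℝ) [Fact (-1 < α)] (i : ImUnit) : Bergman α i →L[ℍᵐᵒᵖ] Bergman α i where
  toFun := leftMul
  map_add' := leftMul_add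
  map_smul' := leftMul_smul
  cont := AddMonoidHomClass.continuous_of_bound (AddMonoidHom.mk' leftMul leftMul_add) 1
    fun f => by rw [one_mul]; exact (norm_leftMul f).le

/-- `J` is unitary and anti-selfadjoint. -/
theorem J_unitary_antiselfadjoint [Fact (-1 < α)] : IsAdjoint (J α i) (-J α i) ∧
    (J α i) ∘L (-J α i) = ContinuousLinearMap.id ℍᵐᵒᵖ (Bergman α i) := by
  have hstar : star (i : ℍ) = -i := by
    have := i.2.1
    ext <;> simp [this]
  have hac : diskMeasure α ≪ volume.restrict (Metric.ball (0 : ℂ) 1) :=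
    withDensity_absolutelyContinuous _ _
  constructor
  · intro f g
    refine integral_congr_ae (hac.ae_le ?_)
    filter_upwards [ae_restrict_mem Metric.isOpen_ball.measurableSet] with z hz
    change star (-(leftMul f (slicePt i z))) * g (slicePt i z) =
      star (f (slicePt i z)) * leftMul g (slicePt i z)
    rw [leftMul_slicePt _ hz, leftMul_slicePt _ hz, star_neg, star_mul, hstar]
    simp [mul_assoc]
  · refine ContinuousLinearMap.ext fun f => eq_of_slice fun z hz => ?_
    change leftMul (-leftMul f) (slicePt i z) = f (slicePt i z)
    rw [leftMul_slicePt _ hz]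
    change (i : ℍ) * -(leftMul f (slicePt i z)) = _
    rw [leftMul_slicePt _ hz, mul_neg, ← mul_assoc, ImUnit.mul_self]
    simp

/-! ### Berezin transform -/

section Berezin

variable [Fact (-1 < α)]

/-- The reproducing kernel `K_q` for `q` in the unit ball: the unique element of the Bergman space
that represents the evaluation at `q`, i.e. `f q = ⟨K_q, f⟩` for all `f`. It exists by the Riesz
representation theorem, because the evaluation at `q` is a bounded right linear functional. -/
def kernel (α : ℝ) [Fact (-1 < α)] (i : ImUnit) (q : ℍ) : Bergman α i :=
  Classical.epsilon fun K => ∀ f : Bergman α i, f q = QInner.qinner K f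

/-- The normalized reproducing kernel `k_q = K_q / √K_q(q)`. -/
def normalizedKernel (α : ℝ) [Fact (-1 < α)] (i : ImUnit) (q : ℍ) : Bergman α i :=
  (√(kernel α i q q).re)⁻¹ • kernel α i q

/-- The Berezin transform `T~ (q) = ⟨k_q, T k_q⟩` at the point `q` of the slice of `i` with
coordinate `z`. -/
def berezin (T : Bergman α i →L[ℍᵐᵒᵖ] Bergman α i) (z : ℂ) : ℍ :=
  QInner.qinner (normalizedKernel α i (slicePt i z)) (T (normalizedKernel α i (slicePt i z)))

end Berezin

end Bergman

end SliceBergman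

end

noncomputable section

namespace SliceBergman

/-! ### Quaternionic inner product spaces -/

section QuaternionicHilbert

open QInner Filter Topology

variable {H : Type*} [NormedAddCommGroup H] [Module ℍᵐᵒᵖ H] [QInner H]

/-! Everything rests on one identity. The kernel on the diagonal is `(1 - |z|²)^(-(α+2))`, so
`|⟨k_z, f⟩|² = (1 - |z|²)^(α+2) |f(z)|²`, and the factor `(1 - |z|²)^(-2)` in `dμ_i` leaves exactly
`|f|² dA_α / (α+1)`. Hence `∫ |⟨k_z, f⟩|² dμ_i = ‖f‖² / (α+1)` (`lintegral_berezinWeight`). On the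
other hand, `∑ |⟨k_z, e_n⟩|² ≤ 1` for every orthonormal family, by Bessel (`tsum_berezinWeight_le`).
The numbers `|⟨k_z, e_n⟩|²` are thus the weights of a measure of mass at most one in `n`, and each
has integral `1/(α+1)` in `z`. Jensen's inequality (`tsum_mul_le_rpow_tsum`) does the rest.

For `p ≥ 1`, write `T = ∑ f_n s_n ⟨e_n, ·⟩`. Then `|T~(z)| ≤ ∑ a_n(z) s_n`, where `a_n` is the mean
of the weights of `e_n` and `f_n`. Jensen gives `|T~|^p ≤ ∑ a_n s_n^p`, and integration bounds `∫
|T~|^p dμ_i` by `∑ s_n^p / (α+1)` (`memLp_berezin`).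

For `p ≤ 1` and `T` positive, `T~ = ∑ |⟨k_z, e_n⟩|² s_n` over an eigenbasis. Jensen with exponent
`1/p` gives `∑ |⟨k_z, e_n⟩|² s_n^p ≤ T~^p`, and integration bounds `∑ s_n^p / (α+1)`
(`IsPositive.mem_schatten`). The existence of the eigenbasis must be earned first. Since `T~` is
bounded, `T~ ∈ L^p` implies `T~ ∈ L^1`; with `‖T k_z‖² ≤ M T~(z)` and the identity above, `T` is
Hilbert-Schmidt (`IsPositive.exists_sum_norm_sq_le`). A Hilbert-Schmidt operator on a complete space
is compact, and the spectral theorem is proved directly over the quaternions by maximizing `‖T x‖`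
on orthogonal complements (`IsPositive.exists_eigenbasis`).

The kernel comes from Taylor expansion on the slice of `i`: monomials are orthogonal by rotation
invariance, and their squared norms are the moments of the weight, whose reciprocals are the
coefficients of `(1 - t)^(-(α+2))`. -/

theorem qinner_add_left (x y z : H) : qinner (x + y) z = qinner x z + qinner y z := by
  rw [← conj_symm, add_right, star_add, conj_symm, conj_symm]

theorem qinner_smul_left (x y : H) (a : ℍ) : qinner (op a • x) y = star a * qinner x y := by
  rw [← conj_symm, smul_right, star_mul, conj_symm]

/-- The scalar product as an additive map in its second argument. -/
def qinnerRight (x : H) : H →+ ℍ := AddMonoidHom.mk' (qinner x) (add_right x)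

/-- The scalar product as an additive map in its first argument. -/
def qinnerLeft (y : H) : H →+ ℍ :=
  AddMonoidHom.mk' (fun x => qinner x y) (fun x z => qinner_add_left x z y)

@[simp] theorem qinner_zero_right (x : H) : qinner x 0 = 0 := map_zero (qinnerRight x)

@[simp] theorem qinner_zero_left (x : H) : qinner 0 x = 0 := map_zero (qinnerLeft x)

theorem qinner_sub_right (x y z : H) : qinner x (y - z) = qinner x y - qinner x z :=
  map_sub (qinnerRight x) y z

theorem qinner_sub_left (x y z : H) : qinner (x - y) z = qinner x z - qinner y z :=
  map_sub (qinnerLeft z) x y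

theorem qinner_sum_right {ι : Type*} (x : H) (F : Finset ι) (u : ι → H) :
    qinner x (∑ n ∈ F, u n) = ∑ n ∈ F, qinner x (u n) := map_sum (qinnerRight x) u F

theorem qinner_sum_left {ι : Type*} (x : H) (F : Finset ι) (u : ι → H) :
    qinner (∑ n ∈ F, u n) x = ∑ n ∈ F, qinner (u n) x := map_sum (qinnerLeft x) u F

theorem star_mul_self_eq_norm_sq (a : ℍ) : star a * a = ((‖a‖ ^ 2 : ℝ) : ℍ) := by
  rw [Quaternion.star_mul_self, Quaternion.normSq_eq_norm_mul_self, sq]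

theorem abs_re_le_norm (a : ℍ) : |a.re| ≤ ‖a‖ := by
  have h : ‖a‖ * ‖a‖ = a.re ^ 2 + a.imI ^ 2 + a.imJ ^ 2 + a.imK ^ 2 := by
    rw [← Quaternion.normSq_eq_norm_mul_self, Quaternion.normSq_def']
  refine abs_le_of_sq_le_sq ?_ (norm_nonneg a)
  nlinarith [sq_nonneg a.imI, sq_nonneg a.imJ, sq_nonneg a.imK]

/-- The class `QInner` does not postulate that the scalar action is compatible with the norm. It
follows from `⟨xa, xa⟩ = ā ‖x‖² a`, where the real number `‖x‖²` is central. Continuity of the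
action in both variables rests on this. -/
theorem norm_op_smul (a : ℍ) (x : H) : ‖op a • x‖ = ‖x‖ * ‖a‖ := by
  have h := inner_self (op a • x)
  rw [smul_right, qinner_smul_left, inner_self, mul_assoc, Quaternion.coe_commutes, ← mul_assoc,
    star_mul_self_eq_norm_sq, ← Quaternion.coe_mul, Quaternion.coe_inj, ← mul_pow] at h
  rw [mul_comm]
  exact ((sq_eq_sq₀ (by positivity) (norm_nonneg _)).1 h).symm

theorem continuous_op_smul (x : H) : Continuous fun a : ℍ => op a • x :=
  AddMonoidHomClass.continuous_of_bound
    (AddMonoidHom.mk' (fun a : ℍ => op a • x) fun a b => by rw [op_add, add_smul]) ‖x‖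
    fun a => (norm_op_smul a x).le

theorem continuous_smul_op (a : ℍ) : Continuous fun x : H => op a • x :=
  AddMonoidHomClass.continuous_of_bound
    (AddMonoidHom.mk' (fun x : H => op a • x) fun x y => smul_add _ x y) ‖a‖
    fun x => by rw [mul_comm]; exact (norm_op_smul a x).le

theorem norm_sq_eq_re (x : H) : ‖x‖ ^ 2 = (qinner x x).re := by rw [inner_self, Quaternion.re_coe]

theorem re_qinner_comm (x y : H) : (qinner x y).re = (qinner y x).re := by
  rw [← conj_symm]; simp

theorem norm_qinner_comm (x y : H) : ‖qinner x y‖ = ‖qinner y x‖ := by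
  rw [← conj_symm, norm_star]

theorem norm_sub_sq (x y : H) : ‖x - y‖ ^ 2 = ‖x‖ ^ 2 - 2 * (qinner x y).re + ‖y‖ ^ 2 := by
  rw [norm_sq_eq_re, norm_sq_eq_re, norm_sq_eq_re, qinner_sub_right, qinner_sub_left,
    qinner_sub_left]
  simp only [Quaternion.re_sub, re_qinner_comm y x]
  ring

theorem norm_add_sq (x y : H) : ‖x + y‖ ^ 2 = ‖x‖ ^ 2 + 2 * (qinner x y).re + ‖y‖ ^ 2 := by
  rw [norm_sq_eq_re, norm_sq_eq_re, norm_sq_eq_re, add_right, qinner_add_left,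
    qinner_add_left]
  simp only [Quaternion.re_add, re_qinner_comm y x]
  ring

/-- A bounded operator is bounded on the unit ball. -/
theorem exists_bound (T : H →L[ℍᵐᵒᵖ] H) : ∃ M : ℝ, 0 ≤ M ∧ ∀ x, ‖T x‖ ≤ M * ‖x‖ := by
  obtain ⟨δ, hδ, h⟩ := Metric.continuousAt_iff.1 (T.continuous.continuousAt (x := 0)) 1 one_pos
  refine ⟨2 / δ, by positivity, fun x => ?_⟩
  -- A nonzero `x` is rescaled to norm `δ / 2`, where continuity at `0` bounds the image by `1`.
  rcases eq_or_ne x 0 with rfl | hx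
  · simp
  have hx' : 0 < ‖x‖ := norm_pos_iff.2 hx
  have h1 := @h (op ((δ / 2 / ‖x‖ : ℝ) : ℍ) • x) (by
    rw [dist_zero_right, norm_op_smul, Quaternion.norm_coe, Real.norm_of_nonneg (by positivity),
      mul_div_cancel₀ _ hx'.ne']
    linarith)
  rw [map_zero, dist_zero_right, map_smul, norm_op_smul, Quaternion.norm_coe,
    Real.norm_of_nonneg (by positivity)] at h1
  calc ‖T x‖ = 2 / δ * ‖x‖ * (‖T x‖ * (δ / 2 / ‖x‖)) := by field_simp
    _ ≤ 2 / δ * ‖x‖ * 1 := by gcongr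
    _ = _ := mul_one _

/-- A positive operator is symmetric. -/
theorem IsPositive.symm {T : H →L[ℍᵐᵒᵖ] H} (hT : IsPositive T) (x y : H) :
    qinner (T x) y = qinner x (T y) := by
  -- Polarization: the form is real at `x`, at `xa` and `ya`-type vectors and at `x + ya`, so the
  -- cross terms have a real sum.
  have key : ∀ a : ℍ, (qinner x (T y) * a + star a * qinner y (T x)).im = 0 := fun a => by
    obtain ⟨r, -, h⟩ := hT (x + op a • y)
    obtain ⟨r₁, -, h₁⟩ := hT x
    obtain ⟨r₂, -, h₂⟩ := hT (op a • y)
    rw [map_add, add_right, qinner_add_left, qinner_add_left, h₁, h₂, map_smul, smul_right,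
      qinner_smul_left] at h
    have e : qinner x (T y) * a + star a * qinner y (T x) = ((r - r₁ - r₂ : ℝ) : ℍ) := by
      push_cast
      rw [← h]
      abel
    rw [e, Quaternion.im_coe]
  have h1 := key 1
  -- The choice `a = 1` makes the imaginary parts of `⟨x, Ty⟩` and `⟨y, Tx⟩` opposite; for the unit
  -- `q`, the first imaginary component of the cross terms is the difference of their real parts.
  obtain ⟨q, hq⟩ : ∃ q : ℍ, q = ⟨0, 1, 0, 0⟩ := ⟨_, rfl⟩
  have q0 : q.re = 0 := by rw [hq]
  have q1 : q.imI = 1 := by rw [hq]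
  have q2 : q.imJ = 0 := by rw [hq]
  have q3 : q.imK = 0 := by rw [hq]
  have h2 := key q
  rw [← conj_symm]
  simp only [Quaternion.ext_iff, Quaternion.imI_im, Quaternion.imJ_im, Quaternion.imK_im,
    star_one, mul_one, one_mul, Quaternion.imI_add, Quaternion.imJ_add, Quaternion.imK_add,
    Quaternion.imI_mul, Quaternion.imI_star, Quaternion.re_star, Quaternion.imJ_star,
    Quaternion.imK_star, q0, q1, q2, q3] at h1 h2 ⊢
  obtain ⟨-, a1, a2, a3⟩ := h1
  obtain ⟨-, b1, -, -⟩ := h2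
  refine ⟨?_, ?_, ?_, ?_⟩ <;> simp at * <;> linarith

/-- The Cauchy-Schwarz inequality for the form of a positive operator. -/
theorem IsPositive.cauchySchwarz {T : H →L[ℍᵐᵒᵖ] H} (hT : IsPositive T) (x y : H) :
    ‖qinner x (T y)‖ ^ 2 ≤ (qinner x (T x)).re * (qinner y (T y)).re := by
  set a := qinner x (T y) with ha
  obtain ⟨r₁, hr₁, h₁⟩ := hT x
  obtain ⟨r₂, hr₂, h₂⟩ := hT y
  rw [h₁, h₂, Quaternion.re_coe, Quaternion.re_coe]
  have hyx : qinner y (T x) = star a := by rw [ha, ← hT.symm, conj_symm]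
  -- The form at `y - x a t` with `a = ⟨x, Ty⟩` and `t` real. The factor `a` makes both cross terms
  -- equal to the real number `‖a‖² t`, so the usual discriminant argument applies.
  have key : ∀ t : ℝ, 0 ≤ (‖a‖ ^ 2 * r₁) * (t * t) + (-(2 * ‖a‖ ^ 2)) * t + r₂ := fun t => by
    obtain ⟨r, hr, h⟩ := hT (y - op (a * (t : ℍ)) • x)
    rw [map_sub, map_smul, qinner_sub_left, qinner_sub_right, qinner_sub_right, smul_right,
      smul_right, qinner_smul_left, qinner_smul_left, h₁, h₂, hyx, ← ha] at h
    have e : star (a * (t : ℍ)) * ((r₁ : ℍ) * (a * (t : ℍ))) = ((‖a‖ ^ 2 * r₁ * (t * t) : ℝ) : ℍ) := by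
      rw [star_mul, Quaternion.star_coe]
      calc (t : ℍ) * star a * ((r₁ : ℍ) * (a * (t : ℍ)))
          = (t : ℍ) * (star a * ((r₁ : ℍ) * a)) * (t : ℍ) := by simp only [mul_assoc]
        _ = (t : ℍ) * ((star a * a) * (r₁ : ℍ)) * (t : ℍ) := by
            rw [Quaternion.coe_commutes r₁ a, mul_assoc (star a)]
        _ = _ := by
            rw [star_mul_self_eq_norm_sq]
            norm_cast
            congr 1
            ring
    have e2 : star a * (a * (t : ℍ)) = ((‖a‖ ^ 2 * t : ℝ) : ℍ) := by
      rw [← mul_assoc, star_mul_self_eq_norm_sq]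
      norm_cast
    have e3 : star (a * (t : ℍ)) * a = ((‖a‖ ^ 2 * t : ℝ) : ℍ) := by
      rw [star_mul, Quaternion.star_coe, mul_assoc, star_mul_self_eq_norm_sq, mul_comm (‖a‖ ^ 2)]
      norm_cast
    rw [mul_assoc (star (a * (t : ℍ))) (r₁ : ℍ), e, e2, e3] at h
    have h' : r₂ - ‖a‖ ^ 2 * t - (‖a‖ ^ 2 * t - ‖a‖ ^ 2 * r₁ * (t * t)) = r := by
      apply Quaternion.coe_injective
      push_cast at h ⊢
      exact h
    linarith
  have hd := discrim_le_zero key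
  rw [discrim] at hd
  -- The discriminant yields `‖a‖⁴ ≤ ‖a‖² r₁ r₂`; a factor `‖a‖²` has to be cancelled.
  rcases eq_or_ne a 0 with h0 | h0
  · rw [h0, norm_zero, zero_pow two_ne_zero]; positivity
  have hp : 0 < ‖a‖ ^ 2 := by positivity
  by_contra! hc
  nlinarith

/-! ### Cauchy-Schwarz for the scalar product, and the bound `T² ≤ M T` -/

theorem isPositive_id : IsPositive (ContinuousLinearMap.id ℍᵐᵒᵖ H) := fun x =>
  ⟨‖x‖ ^ 2, by positivity, inner_self x⟩

theorem norm_qinner_le (x y : H) : ‖qinner x y‖ ≤ ‖x‖ * ‖y‖ := by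
  have h := (isPositive_id (H := H)).cauchySchwarz x y
  simp only [ContinuousLinearMap.coe_id', id_eq, ← norm_sq_eq_re, ← mul_pow] at h
  exact (sq_le_sq₀ (norm_nonneg _) (by positivity)).1 h

theorem continuous_qinner (x : H) : Continuous (qinner x) :=
  AddMonoidHomClass.continuous_of_bound (qinnerRight x) ‖x‖ (norm_qinner_le x)

/-- Cauchy-Schwarz for the form of `T` at `Tx` and `x` gives `‖Tx‖⁴ ≤ ⟨Tx, TTx⟩ ⟨x, Tx⟩ ≤ M ‖Tx‖²
⟨x, Tx⟩`. This avoids a square root of `T`. -/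
theorem IsPositive.norm_sq_le {T : H →L[ℍᵐᵒᵖ] H} (hT : IsPositive T) {M : ℝ}
    (hM : ∀ x, ‖T x‖ ≤ M * ‖x‖) (x : H) : ‖T x‖ ^ 2 ≤ M * (qinner x (T x)).re := by
  have h := hT.cauchySchwarz (T x) x
  rw [inner_self, Quaternion.norm_coe, Real.norm_of_nonneg (by positivity)] at h
  have h2 : (qinner (T x) (T (T x))).re ≤ M * ‖T x‖ ^ 2 :=
    calc _ ≤ ‖qinner (T x) (T (T x))‖ := (le_abs_self _).trans (abs_re_le_norm _)
      _ ≤ ‖T x‖ * ‖T (T x)‖ := norm_qinner_le _ _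
      _ ≤ ‖T x‖ * (M * ‖T x‖) := by gcongr; exact hM _
      _ = _ := by ring
  obtain ⟨r, hr, e⟩ := hT x
  rw [e, Quaternion.re_coe] at h ⊢
  rcases eq_or_ne (T x) 0 with h0 | h0
  · rw [h0] at e
    rw [qinner_zero_right] at e
    have : r = 0 := Quaternion.coe_injective (e.symm.trans Quaternion.coe_zero.symm)
    simp [h0, this]
  have hp : 0 < ‖T x‖ ^ 2 := by positivity
  have := mul_le_mul_of_nonneg_right h2 hr
  nlinarith

/-! ### Orthogonal families -/

/-- A family of pairwise orthogonal vectors, each of which is zero or has norm one. -/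
def IsOrthoFamily {ι : Type*} (e : ι → H) : Prop :=
  (∀ m n, m ≠ n → qinner (e m) (e n) = 0) ∧ ∀ n, e n = 0 ∨ ‖e n‖ = 1

/-- The orthogonal projection to the span of finitely many members of an orthogonal family. -/
def orthoProj {ι : Type*} (e : ι → H) (F : Finset ι) (x : H) : H :=
  ∑ n ∈ F, op (qinner (e n) x) • e n

/-- Zero members let finite families be indexed by `ℕ`. They do no harm because `⟨e n, e n⟩`, which
is `0` or `1`, acts as the identity on `e n` in either case. -/
theorem IsOrthoFamily.op_self_smul {ι : Type*} {e : ι → H} (he : IsOrthoFamily e) (n : ι) :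
    op (qinner (e n) (e n)) • e n = e n := by
  rcases he.2 n with h | h
  · rw [h, smul_zero]
  · rw [inner_self, h]; simp

theorem IsOrthoFamily.qinner_self_mul {ι : Type*} {e : ι → H} (he : IsOrthoFamily e) (n : ι)
    (x : H) : qinner (e n) (e n) * qinner (e n) x = qinner (e n) x := by
  rcases he.2 n with h | h
  · rw [h]; simp
  · rw [inner_self, h]; simp

theorem IsOrthoFamily.qinner_sub_orthoProj {ι : Type*} {e : ι → H} (he : IsOrthoFamily e)
    {F : Finset ι} {n : ι} (hn : n ∈ F) (x : H) : qinner (e n) (x - orthoProj e F x) = 0 := by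
  rw [qinner_sub_right, orthoProj, qinner_sum_right, Finset.sum_eq_single n, smul_right,
    he.qinner_self_mul, sub_self]
  · intro m _ hm
    rw [smul_right, he.1 n m hm.symm, zero_mul]
  · exact fun h => absurd hn h

/-- Pythagoras: the remainder is orthogonal to every `e n` with `n ∈ F`, hence to the projection.
Dropping either term on the right gives Bessel's inequality or the contraction property of the
remainder. -/
theorem IsOrthoFamily.norm_sq_eq {ι : Type*} {e : ι → H} (he : IsOrthoFamily e)
    (F : Finset ι) (x : H) :
    ‖x‖ ^ 2 = ‖x - orthoProj e F x‖ ^ 2 + ∑ n ∈ F, ‖qinner (e n) x‖ ^ 2 := by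
  have h1 : qinner (orthoProj e F x) (x - orthoProj e F x) = 0 := by
    have e1 : ∀ y, qinner (orthoProj e F x) y =
        ∑ n ∈ F, qinner (op (qinner (e n) x) • e n) y := fun y =>
        qinner_sum_left y F _
    rw [e1]
    refine Finset.sum_eq_zero (M := ℍ) fun n hn => ?_
    rw [qinner_smul_left, he.qinner_sub_orthoProj hn, mul_zero]
  have h2 : ‖orthoProj e F x‖ ^ 2 = ∑ n ∈ F, ‖qinner (e n) x‖ ^ 2 := by
    have h3 : qinner (orthoProj e F x) (orthoProj e F x) = qinner (orthoProj e F x) x := by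
      rw [qinner_sub_right, sub_eq_zero] at h1
      exact h1.symm
    rw [norm_sq_eq_re, h3, orthoProj, qinner_sum_left]
    refine (map_sum Bergman.reL _ _).trans (Finset.sum_congr rfl fun n _ => ?_)
    rw [qinner_smul_left, star_mul_self_eq_norm_sq]
    exact Quaternion.re_coe _
  have h5 := norm_add_sq (orthoProj e F x) (x - orthoProj e F x)
  rw [h1, add_sub_cancel, h2] at h5
  simp only [Quaternion.re_zero, mul_zero, add_zero] at h5
  linarith

/-- Bessel's inequality. -/
theorem IsOrthoFamily.bessel {ι : Type*} {e : ι → H} (he : IsOrthoFamily e)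
    (F : Finset ι) (x : H) : ∑ n ∈ F, ‖qinner (e n) x‖ ^ 2 ≤ ‖x‖ ^ 2 := by
  rw [he.norm_sq_eq F x]
  exact le_add_of_nonneg_left (by positivity)

theorem IsOrthoFamily.norm_sub_orthoProj_le {ι : Type*} {e : ι → H} (he : IsOrthoFamily e)
    (F : Finset ι) (x : H) : ‖x - orthoProj e F x‖ ≤ ‖x‖ := by
  refine (sq_le_sq₀ (norm_nonneg _) (norm_nonneg _)).1 ?_
  rw [he.norm_sq_eq F x]
  exact le_add_of_nonneg_right (Finset.sum_nonneg fun _ _ => by positivity)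

theorem map_orthoProj {ι : Type*} (T : H →L[ℍᵐᵒᵖ] H) (e : ι → H) (F : Finset ι) (x : H) :
    T (orthoProj e F x) = ∑ n ∈ F, op (qinner (e n) x) • T (e n) := by
  rw [orthoProj, map_sum]
  simp only [map_smul]

end QuaternionicHilbert

/-! ### Compact positive operators -/

section CompactOperators

open QInner Filter Topology

variable {H : Type*} [NormedAddCommGroup H] [Module ℍᵐᵒᵖ H] [QInner H]

theorem norm_op_coe_smul {r : ℝ} (hr : 0 ≤ r) (x : H) : ‖op (r : ℍ) • x‖ = r * ‖x‖ := by
  rw [norm_op_smul, Quaternion.norm_coe, Real.norm_of_nonneg hr, mul_comm]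

theorem op_coe_smul_smul {H : Type*} [AddCommGroup H] [Module ℍᵐᵒᵖ H] (r t : ℝ) (x : H) :
    op (r : ℍ) • op (t : ℍ) • x = op ((r * t : ℝ) : ℍ) • x := by
  rw [smul_smul, ← op_mul, ← Quaternion.coe_mul, mul_comm]

/-- Among the finite orthonormal families on which `T` is at least `ε` there is a maximal one. -/
theorem exists_maximal_orthoFamily (T : H →L[ℍᵐᵒᵖ] H) {C : ℝ}
    (hC : ∀ e : ℕ → H, IsOrthoFamily e → ∀ F : Finset ℕ, ∑ n ∈ F, ‖T (e n)‖ ^ 2 ≤ C)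
    {ε : ℝ} (hε : 0 < ε) : ∃ e : ℕ → H, IsOrthoFamily e ∧ ∃ N : ℕ,
      ∀ x, (∀ n < N, qinner (e n) x = 0) → ‖T x‖ ≤ ε * ‖x‖ := by
  by_contra! hcon
  -- Without a maximal family, orthonormal families with `ε ≤ ‖T (e n)‖` can be prolonged forever,
  -- each normalized counterexample `y` entering at position `N`. A family with `N ε² > C` then
  -- contradicts `hC`.
  have key : ∀ N : ℕ, ∃ e : ℕ → H, IsOrthoFamily e ∧ (∀ n < N, ε ≤ ‖T (e n)‖) ∧
      ∀ n, N ≤ n → e n = 0 := fun N => by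
    induction N with
    | zero => exact ⟨fun _ => 0, ⟨fun _ _ _ => qinner_zero_left _, fun _ => .inl rfl⟩, by simp,
        fun _ _ => rfl⟩
    | succ N ih =>
      obtain ⟨e, he, h1, h2⟩ := ih
      obtain ⟨x, hx, hTx⟩ := hcon e he N
      have hx0 : 0 < ‖x‖ := by
        refine norm_pos_iff.2 fun h => ?_
        simp [h] at hTx
      let y : H := op ((‖x‖⁻¹ : ℝ) : ℍ) • x
      have hy : ‖y‖ = 1 := by
        rw [norm_op_coe_smul (by positivity), inv_mul_cancel₀ hx0.ne']
      have hTy : ε ≤ ‖T y‖ := by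
        rw [map_smul, norm_op_coe_smul (by positivity), inv_mul_eq_div, le_div_iff₀ hx0]
        exact hTx.le
      have hey : ∀ n, n ≠ N → qinner (e n) y = 0 := fun n hn => by
        rcases lt_or_ge n N with h | h
        · rw [smul_right, hx n h, zero_mul]
        · rw [h2 n h, qinner_zero_left]
      refine ⟨Function.update e N y, ⟨fun m n hmn => ?_, fun n => ?_⟩, fun n hn => ?_,
        fun n hn => ?_⟩
      · by_cases hm : m = N
        · subst hm
          rw [Function.update_self, Function.update_of_ne hmn.symm, ← conj_symm, hey n hmn.symm,
            star_zero]
        · by_cases hn : n = N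
          · subst hn
            rw [Function.update_self, Function.update_of_ne hmn, hey m hmn]
          · rw [Function.update_of_ne hm, Function.update_of_ne hn, he.1 m n hmn]
      · by_cases hn : n = N
        · subst hn; rw [Function.update_self]; exact .inr hy
        · rw [Function.update_of_ne hn]; exact he.2 n
      · by_cases hn' : n = N
        · subst hn'; rw [Function.update_self]; exact hTy
        · rw [Function.update_of_ne hn']; exact h1 n (by omega)
      · rw [Function.update_of_ne (by omega)]; exact h2 n (by omega)
  obtain ⟨N, hN⟩ := exists_nat_gt (C / ε ^ 2)
  obtain ⟨e, he, h1, -⟩ := key N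
  have h3 : ∑ n ∈ Finset.range N, ε ^ 2 ≤ ∑ n ∈ Finset.range N, ‖T (e n)‖ ^ 2 :=
    Finset.sum_le_sum fun n hn => by gcongr; exact h1 n (Finset.mem_range.1 hn)
  rw [Finset.sum_const, Finset.card_range, nsmul_eq_mul] at h3
  rw [div_lt_iff₀ (by positivity)] at hN
  exact absurd (h3.trans (hC e he _)) (not_le.2 hN)

/-- A Hilbert-Schmidt operator is compact. -/
theorem isCompact_closure_image_ball [CompleteSpace H] (T : H →L[ℍᵐᵒᵖ] H) {C : ℝ}
    (hC : ∀ e : ℕ → H, IsOrthoFamily e → ∀ F : Finset ℕ, ∑ n ∈ F, ‖T (e n)‖ ^ 2 ≤ C) :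
    IsCompact (closure (T '' Metric.closedBall 0 1)) := by
  refine isCompact_iff_totallyBounded_isComplete.2
    ⟨TotallyBounded.closure ?_, isClosed_closure.isComplete⟩
  refine Metric.totallyBounded_iff.2 fun ε hε => ?_
  obtain ⟨e, he, N, h⟩ := exists_maximal_orthoFamily T hC (half_pos (half_pos hε))
  -- The image of the span of the first `N` vectors, parametrized by coefficients in the compact
  -- unit polydisk. The remainder moves `T x` by at most `ε / 4`, so an `ε / 2`-net of `g` is an
  -- `ε`-net of the image of the ball.
  let g : (Fin N → ℍ) → H := fun a => ∑ n : Fin N, op (a n) • T (e n)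
  have hg : Continuous g := continuous_finsetSum _ fun n _ =>
    (continuous_op_smul (T (e n))).comp (continuous_apply n)
  have hK := ((isCompact_closedBall (0 : Fin N → ℍ) 1).image hg).totallyBounded
  obtain ⟨t, ht, hcov⟩ := Metric.totallyBounded_iff.1 hK (ε / 2) (half_pos hε)
  refine ⟨t, ht, ?_⟩
  rintro _ ⟨x, hx, rfl⟩
  rw [mem_closedBall_zero_iff] at hx
  have h1 : ‖T (x - orthoProj e (Finset.range N) x)‖ ≤ ε / 2 / 2 := by
    refine (h _ fun n hn => he.qinner_sub_orthoProj (Finset.mem_range.2 hn) x).trans ?_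
    have := (he.norm_sub_orthoProj_le (Finset.range N) x).trans hx
    exact mul_le_of_le_one_right (by positivity) this
  have h2 : T (orthoProj e (Finset.range N) x) = g fun n => qinner (e n) x := by
    rw [map_orthoProj, Finset.sum_range]
  have h3 : (fun n : Fin N => qinner (e n) x) ∈ Metric.closedBall (0 : Fin N → ℍ) 1 := by
    rw [mem_closedBall_zero_iff, pi_norm_le_iff_of_nonneg zero_le_one]
    intro n
    refine (norm_qinner_le _ _).trans ?_
    rcases he.2 n with h | h <;> rw [h] <;> simp [hx]
  obtain ⟨y, hy, hy2⟩ := Set.mem_iUnion₂.1 (hcov (Set.mem_image_of_mem g h3))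
  refine Set.mem_iUnion₂.2 ⟨y, hy, ?_⟩
  rw [← h2, Metric.mem_ball] at hy2
  rw [map_sub, ← dist_eq_norm] at h1
  rw [Metric.mem_ball]
  have := dist_triangle (T x) (T (orthoProj e (Finset.range N) x)) y
  linarith

/-- A positive compact operator attains its norm on the orthogonal complement of a set of
eigenvectors, at an eigenvector. -/
theorem IsPositive.exists_eigenvector {T : H →L[ℍᵐᵒᵖ] H} (hT : IsPositive T)
    (hK : IsCompact (closure (T '' Metric.closedBall 0 1))) (A : Set H)
    (hA : ∀ a ∈ A, ∃ r : ℝ, T a = op (r : ℍ) • a) :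
    ∃ (x : H) (s : ℝ), 0 ≤ s ∧ (∀ a ∈ A, qinner a x = 0) ∧ (x = 0 ∨ ‖x‖ = 1) ∧
      (s ≠ 0 → ‖x‖ = 1) ∧ T x = op (s : ℍ) • x ∧
      ∀ y, (∀ a ∈ A, qinner a y = 0) → ‖T y‖ ≤ s * ‖y‖ := by
  obtain ⟨M, hM0, hM⟩ := exists_bound T
  -- The orthogonal complement of `A` is invariant, because `A` consists of eigenvectors and `T` is
  -- symmetric.
  have hinv : ∀ y, (∀ a ∈ A, qinner a y = 0) → ∀ a ∈ A, qinner a (T y) = 0 := fun y hy a ha => by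
    obtain ⟨r, hr⟩ := hA a ha
    rw [← hT.symm, hr, qinner_smul_left, hy a ha, mul_zero]
  let S : Set ℝ := {t | ∃ y, (∀ a ∈ A, qinner a y = 0) ∧ ‖y‖ ≤ 1 ∧ ‖T y‖ = t}
  have hS0 : (0 : ℝ) ∈ S := ⟨0, fun _ _ => qinner_zero_right _, by simp, by simp⟩
  have hSb : BddAbove S := ⟨M, by
    rintro _ ⟨y, -, hy, rfl⟩
    exact (hM y).trans (mul_le_of_le_one_right hM0 hy)⟩
  set s := sSup S with hs
  have hs0 : 0 ≤ s := le_csSup hSb hS0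
  have hmax : ∀ y, (∀ a ∈ A, qinner a y = 0) → ‖T y‖ ≤ s * ‖y‖ := fun y hy => by
    rcases eq_or_ne y 0 with rfl | hy0
    · simp
    have hy1 : 0 < ‖y‖ := norm_pos_iff.2 hy0
    have : ‖T (op ((‖y‖⁻¹ : ℝ) : ℍ) • y)‖ ≤ s :=
      le_csSup hSb ⟨_, fun a ha => by rw [smul_right, hy a ha, zero_mul], by
        rw [norm_op_coe_smul (by positivity), inv_mul_cancel₀ hy1.ne'], rfl⟩
    rwa [map_smul, norm_op_coe_smul (by positivity), inv_mul_eq_div, div_le_iff₀ hy1] at this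
  -- Here `s` is the norm of `T` on the complement. If it vanishes, there may be no unit vector
  -- left, and `x = 0` serves.
  rcases eq_or_ne s 0 with h0 | h0
  · refine ⟨0, s, hs0, fun _ _ => qinner_zero_right _, .inl rfl, fun h => absurd h0 h, by simp,
      hmax⟩
  have hspos : 0 < s := lt_of_le_of_ne hs0 h0.symm
  obtain ⟨u, -, hu, hu2⟩ := exists_seq_tendsto_sSup ⟨0, hS0⟩ hSb
  choose v hvA hv1 hv2 using hu2
  obtain ⟨y, -, φ, hφ, hy⟩ := hK.tendsto_subseq (x := fun n => T (v n)) fun n =>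
    subset_closure ⟨v n, by simpa using hv1 n, rfl⟩
  have hlim : Tendsto (fun n => ‖T (v n)‖) atTop (𝓝 s) := by simpa only [hv2] using hu
  -- A maximizing sequence is asymptotically an eigenvector of `T²`: `‖T²v - s²v‖² = ‖T²v‖² -
  -- 2s²‖Tv‖² + s⁴‖v‖² ≤ s²(s² - ‖Tv‖²)`, by `‖T²v‖ ≤ s ‖Tv‖` and `‖v‖ ≤ 1`.
  have hdiff : Tendsto (fun n => T (T (v n)) - op ((s ^ 2 : ℝ) : ℍ) • v n) atTop (𝓝 0) := by
    refine squeeze_zero_norm (a := fun n => √(s ^ 2 * (s ^ 2 - ‖T (v n)‖ ^ 2))) (fun n => ?_) ?_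
    · refine Real.le_sqrt_of_sq_le ?_
      have e1 : (qinner (T (T (v n))) (v n)).re = ‖T (v n)‖ ^ 2 := by
        rw [hT.symm, ← norm_sq_eq_re]
      have e2 : ‖T (T (v n))‖ ^ 2 ≤ s ^ 2 * ‖T (v n)‖ ^ 2 := by
        rw [← mul_pow]
        gcongr
        exact hmax _ (hinv _ (hvA n))
      have e3 : ‖v n‖ ^ 2 ≤ 1 := pow_le_one₀ (norm_nonneg _) (hv1 n)
      rw [norm_sub_sq, smul_right, Quaternion.mul_coe_eq_smul, Quaternion.re_smul, e1,
        norm_op_coe_smul (by positivity), mul_pow, smul_eq_mul]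
      have : 0 ≤ (s ^ 2) ^ 2 := by positivity
      nlinarith
    · have : Tendsto (fun n => √(s ^ 2 * (s ^ 2 - ‖T (v n)‖ ^ 2))) atTop
          (𝓝 (√(s ^ 2 * (s ^ 2 - s ^ 2)))) :=
        (Real.continuous_sqrt.tendsto _).comp
          (((hlim.pow 2).const_sub (s ^ 2)).const_mul (s ^ 2))
      simpa using this
  have hTy : Tendsto (fun n => T (T (v (φ n)))) atTop (𝓝 (T y)) :=
    (T.continuous.tendsto y).comp hy
  have hsv : Tendsto (fun n => op ((s ^ 2 : ℝ) : ℍ) • v (φ n)) atTop (𝓝 (T y)) := by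
    have := hTy.sub (hdiff.comp hφ.tendsto_atTop)
    simpa [Function.comp_def] using this
  -- Compactness makes `T v` converge to `y` along a subsequence, so `s² v` converges to `T y`, and
  -- `v` itself converges to `s⁻² T y`.
  obtain ⟨x, hx⟩ : ∃ x : H, x = op (((s ^ 2)⁻¹ : ℝ) : ℍ) • T y := ⟨_, rfl⟩
  have hvx : Tendsto (fun n => v (φ n)) atTop (𝓝 (op (((s ^ 2)⁻¹ : ℝ) : ℍ) • T y)) := by
    have := ((continuous_smul_op (H := H) (((s ^ 2)⁻¹ : ℝ) : ℍ)).tendsto (T y)).comp hsv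
    refine this.congr fun n => ?_
    rw [Function.comp_apply, op_coe_smul_smul, inv_mul_cancel₀ (by positivity)]
    simp
  rw [← hx] at hvx
  have hxy : T x = y :=
    tendsto_nhds_unique ((T.continuous.tendsto x).comp hvx) hy
  have hTTx : T (T x) = op ((s ^ 2 : ℝ) : ℍ) • x := by
    rw [hxy, hx, op_coe_smul_smul, mul_inv_cancel₀ (by positivity)]
    simp
  have hxA : ∀ a ∈ A, qinner a x = 0 := fun a ha =>
    tendsto_nhds_unique (((continuous_qinner a).tendsto x).comp hvx)
      (by simp [Function.comp_def, hvA _ a ha])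
  have hTx : ‖T x‖ = s := by
    rw [hxy]
    exact tendsto_nhds_unique hy.norm (hlim.comp hφ.tendsto_atTop)
  have heig : T x = op (s : ℍ) • x := by
    -- Since `T² x = s² x`, the vector `w = Tx - sx` satisfies `Tw = -sw`; positivity of `T` and `s
    -- > 0` force `w = 0`.
    set w := T x - op (s : ℍ) • x with hw
    have h1 : T w = op ((-s : ℝ) : ℍ) • w := by
      rw [hw, map_sub, map_smul, hTTx, smul_sub, op_coe_smul_smul, Quaternion.coe_neg, op_neg,
        neg_smul, neg_mul, Quaternion.coe_neg, op_neg, neg_smul, sq]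
      abel
    obtain ⟨r, hr, h2⟩ := hT w
    rw [h1, smul_right, inner_self, ← Quaternion.coe_mul] at h2
    have h3 := Quaternion.coe_injective h2
    have h4 : ‖w‖ ^ 2 = 0 := by nlinarith [sq_nonneg ‖w‖]
    rw [← sub_eq_zero]
    simpa using h4
  have hx1 : ‖x‖ = 1 := by
    rw [heig, norm_op_coe_smul hs0] at hTx
    field_simp at hTx
    exact hTx
  exact ⟨x, s, hs0, hxA, .inr hx1, fun _ => hx1, heig, hmax⟩

/-- The spectral theorem for a positive Hilbert-Schmidt operator. -/
theorem IsPositive.exists_eigenbasis {T : H →L[ℍᵐᵒᵖ] H} (hT : IsPositive T) {C : ℝ}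
    (hC : ∀ e : ℕ → H, IsOrthoFamily e → ∀ F : Finset ℕ, ∑ n ∈ F, ‖T (e n)‖ ^ 2 ≤ C)
    (hK : IsCompact (closure (T '' Metric.closedBall 0 1))) :
    ∃ (e : ℕ → H) (s : ℕ → ℝ), IsOrthoFamily e ∧ Antitone s ∧ (∀ n, 0 ≤ s n) ∧
      (∀ n, s n ≠ 0 → ‖e n‖ = 1) ∧
      ∀ x, HasSum (fun n => op ((s n : ℍ) * qinner (e n) x) • e n) (T x) := by
  choose! nx ns hns0 hnA hn1 hns1 hnT hnmax using hT.exists_eigenvector hK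
  -- `A n` collects the first `n` chosen eigenvectors; the next one is a maximizer on the complement
  -- of `A n`.
  let A : ℕ → Set H := fun n => Nat.rec ∅ (fun _ B => insert (nx B) B) n
  have hAs : ∀ n, A (n + 1) = insert (nx (A n)) (A n) := fun n => rfl
  have hAe : ∀ n, ∀ a ∈ A n, ∃ r : ℝ, T a = op (r : ℍ) • a := fun n => by
    induction n with
    | zero => intro a ha; exact absurd ha (Set.notMem_empty a)
    | succ n ih =>
      intro a ha
      rcases ha with rfl | ha
      · exact ⟨_, hnT _ ih⟩
      · exact ih a ha
  have hmono : ∀ m n, m < n → nx (A m) ∈ A n := fun m n hmn => by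
    induction n with
    | zero => omega
    | succ n ih =>
      rcases Nat.lt_succ_iff_lt_or_eq.1 hmn with h | rfl
      · exact Set.mem_insert_of_mem _ (ih h)
      · exact Set.mem_insert _ _
  have hAform : ∀ n, ∀ a ∈ A n, ∃ m < n, a = nx (A m) := fun n => by
    induction n with
    | zero => intro a ha; exact absurd ha (Set.notMem_empty a)
    | succ n ih =>
      intro a ha
      rcases ha with rfl | ha
      · exact ⟨n, by omega, rfl⟩
      · obtain ⟨m, hm, e⟩ := ih a ha
        exact ⟨m, by omega, e⟩
  let e : ℕ → H := fun n => nx (A n)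
  let s : ℕ → ℝ := fun n => ns (A n)
  have hTe : ∀ n, T (e n) = op (s n : ℍ) • e n := fun n => hnT _ (hAe n)
  have hs0 : ∀ n, 0 ≤ s n := fun n => hns0 _ (hAe n)
  have hs1 : ∀ n, s n ≠ 0 → ‖e n‖ = 1 := fun n => hns1 _ (hAe n)
  have hlt : ∀ m n, m < n → qinner (e m) (e n) = 0 := fun m n hmn =>
    hnA _ (hAe n) _ (hmono m n hmn)
  have he : IsOrthoFamily e := ⟨fun m n hmn => by
    rcases lt_or_gt_of_ne hmn with h | h
    · exact hlt m n h
    · rw [← conj_symm, hlt n m h, star_zero], fun n => hn1 _ (hAe n)⟩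
  have hmax : ∀ N x, (∀ n < N, qinner (e n) x = 0) → ‖T x‖ ≤ s N * ‖x‖ := fun N x hx =>
    hnmax _ (hAe N) x fun a ha => by
      obtain ⟨m, hm, rfl⟩ := hAform N a ha
      exact hx m hm
  have hnormTe : ∀ n, ‖T (e n)‖ = s n := fun n => by
    rw [hTe, norm_op_coe_smul (hs0 n)]
    rcases eq_or_ne (s n) 0 with h | h
    · rw [h, zero_mul]
    · rw [hs1 n h, mul_one]
  have hanti : Antitone s := antitone_nat_of_succ_le fun n => by
    rw [← hnormTe (n + 1)]
    refine (hmax n _ fun m hm => hlt m (n + 1) (by omega)).trans ?_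
    rcases he.2 (n + 1) with h | h <;> rw [h] <;> simp [hs0]
  have hlim : Tendsto s atTop (𝓝 0) := by
    have h1 : Summable fun n => s n ^ 2 :=
      summable_of_sum_le (fun n => sq_nonneg _) fun F => by
        simpa only [hnormTe] using hC e he F
    have h2 := (Real.continuous_sqrt.tendsto 0).comp h1.tendsto_atTop_zero
    rw [Real.sqrt_zero] at h2
    exact h2.congr fun n => Real.sqrt_sq (hs0 n)
  refine ⟨e, s, he, hanti, hs0, hs1, fun x => ?_⟩
  have hsum : ∀ F : Finset ℕ, ∑ n ∈ F, op ((s n : ℍ) * qinner (e n) x) • e n =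
      T (orthoProj e F x) := fun F => by
    rw [map_orthoProj]
    refine Finset.sum_congr rfl fun n _ => ?_
    rw [hTe, smul_smul, ← op_mul]
  rw [HasSum, tendsto_iff_norm_sub_tendsto_zero]
  simp only [hsum, SummationFilter.unconditional_filter]
  refine Metric.tendsto_atTop.2 fun ε hε => ?_
  have h3 : Tendsto (fun n => s n * ‖x‖) atTop (𝓝 0) := by simpa using hlim.mul_const ‖x‖
  -- For `F` containing `range N`, the remainder of `x` is orthogonal to the first `N` eigenvectors,
  -- so its image has norm at most `s N * ‖x‖`. This controls unordered sums directly.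
  obtain ⟨N, hN⟩ := (h3.eventually (gt_mem_nhds hε)).exists
  refine ⟨Finset.range N, fun F hF => ?_⟩
  rw [dist_zero_right, norm_norm, ← map_sub, ← neg_sub, map_neg, norm_neg]
  refine lt_of_le_of_lt (hmax N _ fun n hn =>
    he.qinner_sub_orthoProj (hF (Finset.mem_range.2 hn)) x) (lt_of_le_of_lt ?_ hN)
  exact mul_le_mul_of_nonneg_left (he.norm_sub_orthoProj_le F x) (hs0 N)

/-- The singular value decomposition. -/
theorem IsSingularValueSeq.exists_decomposition {T : H →L[ℍᵐᵒᵖ] H} {s : ℕ → ℝ}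
    (hs : IsSingularValueSeq T s) : ∃ e f : ℕ → H, IsOrthoFamily e ∧ IsOrthoFamily f ∧
      ∀ x, HasSum (fun n => op ((s n : ℍ) * qinner (e n) x) • f n) (T x) := by
  classical
  obtain ⟨-, hs0, P, ⟨hP, S, hTS, hPS⟩, e₀, he₀, hsum₀⟩ := hs
  -- The definition of singular values leaves `e₀ n` arbitrary where `s n = 0`; replacing these
  -- vectors by zero produces an orthogonal family without changing the sum.
  let e : ℕ → H := fun n => if s n = 0 then 0 else e₀ n
  have hen : ∀ n, s n ≠ 0 → e n = e₀ n := fun n hn => if_neg hn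
  have hez : ∀ n, s n = 0 → e n = 0 := fun n hn => if_pos hn
  have he : IsOrthoFamily e := by
    refine ⟨fun m n hmn => ?_, fun n => ?_⟩
    · by_cases hm : s m = 0
      · rw [hez m hm, qinner_zero_left]
      · by_cases hn : s n = 0
        · rw [hez n hn, qinner_zero_right]
        · rw [hen m hm, hen n hn, he₀ m n hm hn, if_neg hmn]
    · by_cases hn : s n = 0
      · exact .inl (hez n hn)
      · right
        have h := he₀ n n hn hn
        rw [if_pos rfl, inner_self, ← Quaternion.coe_one] at h
        rw [hen n hn]
        have := Quaternion.coe_injective h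
        exact (sq_eq_sq₀ (norm_nonneg _) zero_le_one).1 (by rw [this, one_pow])
  have hsum : ∀ x, HasSum (fun n => op ((s n : ℍ) * qinner (e n) x) • e n) (P x) := fun x => by
    convert hsum₀ x using 2 with n
    by_cases hn : s n = 0
    · simp [hn]
    · rw [hen n hn]
  -- From `P² = T*T`: the map `P x ↦ T x` is isometric. It carries the eigenvectors of `P` to the `f
  -- n` below and the convergent expansion of `P x` to that of `T x`.
  have hTP : ∀ x y, qinner (T x) (T y) = qinner (P x) (P y) := fun x y => by
    have h1 : S (T x) = P (P x) := (DFunLike.congr_fun hPS x).symm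
    rw [← hTS, h1, hP.symm]
  have hnorm : ∀ x, ‖T x‖ = ‖P x‖ := fun x =>
    (sq_eq_sq₀ (norm_nonneg _) (norm_nonneg _)).1 (by
      rw [norm_sq_eq_re, norm_sq_eq_re, hTP])
  have hPe : ∀ n, P (e n) = op (s n : ℍ) • e n := fun n => by
    refine (hsum (e n)).unique ?_
    have h1 := hasSum_single (f := fun m => op ((s m : ℍ) * qinner (e m) (e n)) • e m) n
      fun m hm => by rw [he.1 m n hm, mul_zero, op_zero, zero_smul]
    have h2 : op ((s n : ℍ) * qinner (e n) (e n)) • e n = op (s n : ℍ) • e n := by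
      rw [Quaternion.coe_commutes, op_mul, mul_smul, he.op_self_smul]
    rwa [h2] at h1
  -- Where `s n = 0`, the convention `0⁻¹ = 0` makes `f n = 0`, consistent with `e n = 0`.
  obtain ⟨f, hf⟩ : ∃ f : ℕ → H, ∀ n, f n = op (((s n)⁻¹ : ℝ) : ℍ) • T (e n) := ⟨_, fun _ => rfl⟩
  have hTe : ∀ n, op (s n : ℍ) • f n = T (e n) := fun n => by
    by_cases hn : s n = 0
    · simp [hf, hez n hn]
    · rw [hf]
      rw [op_coe_smul_smul, mul_inv_cancel₀ hn]; simp
  refine ⟨e, f, he, ⟨fun m n hmn => ?_, fun n => ?_⟩, fun x => ?_⟩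
  · rw [hf, hf]
    rw [smul_right, qinner_smul_left, hTP, hPe, hPe, smul_right, qinner_smul_left, he.1 m n hmn]
    simp
  · by_cases hn : s n = 0
    · left; simp [hf, hez n hn]
    · rw [hf]
      rw [norm_op_coe_smul (inv_nonneg.2 (hs0 n)), hnorm, hPe, norm_op_coe_smul (hs0 n)]
      rcases he.2 n with h | h
      · left; rw [h]; simp
      · right; rw [h, mul_one, inv_mul_cancel₀ hn]
  · have h1 : ∀ F : Finset ℕ, ∑ n ∈ F, op ((s n : ℍ) * qinner (e n) x) • f n =
        T (orthoProj e F x) := fun F => by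
      rw [map_orthoProj]
      refine Finset.sum_congr rfl fun n _ => ?_
      rw [← hTe, op_mul, mul_smul]
    have h2 : ∀ F : Finset ℕ, ∑ n ∈ F, op ((s n : ℍ) * qinner (e n) x) • e n =
        P (orthoProj e F x) := fun F => by
      rw [map_orthoProj]
      refine Finset.sum_congr rfl fun n _ => ?_
      rw [hPe, smul_smul, ← op_mul]
    have h3 := hsum x
    rw [HasSum, tendsto_iff_norm_sub_tendsto_zero] at h3 ⊢
    simp only [h2] at h3
    simp only [h1]
    refine h3.congr fun F => ?_
    rw [← map_sub, ← map_sub, hnorm]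

end CompactOperators

/-! ### The weighted measure on the disk -/

section DiskMeasure

open Filter Topology

theorem diskMeasure_absolutelyContinuous (α : ℝ) :
    diskMeasure α ≪ volume.restrict (Metric.ball (0 : ℂ) 1) :=
  withDensity_absolutelyContinuous _ _

theorem ae_diskMeasure_mem (α : ℝ) : ∀ᵐ z ∂(diskMeasure α), z ∈ Metric.ball (0 : ℂ) 1 :=
  (diskMeasure_absolutelyContinuous α).ae_le (ae_restrict_mem Metric.isOpen_ball.measurableSet)

theorem continuous_one_sub_sq_rpow {β : ℝ} (hβ : 0 ≤ β) :
    Continuous fun y : ℝ => (1 - y ^ 2) ^ β :=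
  (continuous_const.sub (continuous_pow 2)).rpow_const fun _ => .inr hβ

theorem hasDerivAt_one_sub_sq_rpow (β : ℝ) {y : ℝ} (hy : y ∈ Set.Ioo (0 : ℝ) 1) :
    HasDerivAt (fun y : ℝ => (1 - y ^ 2) ^ (β + 1)) (-(2 * (β + 1) * y * (1 - y ^ 2) ^ β)) y := by
  have h0 : (1 - y ^ 2) ≠ 0 := by nlinarith [hy.1, hy.2]
  have h1 : HasDerivAt (fun y : ℝ => 1 - y ^ 2) (-(2 * y)) y := by
    simpa using (hasDerivAt_pow 2 y).const_sub 1
  have := h1.rpow_const (p := β + 1) (.inl h0)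
  rw [add_sub_cancel_right] at this
  convert this using 1
  ring

/-- For `α < 0` the weight is singular at `1`, but it is the nonnegative derivative of `-(1 -
y²)^(α+1)`, which is continuous up to the endpoint. -/
theorem intervalIntegrable_weight {α : ℝ} (hα : -1 < α) :
    IntervalIntegrable (fun y : ℝ => 2 * (α + 1) * y * (1 - y ^ 2) ^ α) volume 0 1 := by
  refine intervalIntegral.intervalIntegrable_deriv_of_nonneg
    (g := fun y : ℝ => -(1 - y ^ 2) ^ (α + 1))
    (continuous_one_sub_sq_rpow (by linarith)).neg.continuousOn (fun y hy => ?_) fun y hy => ?_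
  · rw [min_eq_left zero_le_one, max_eq_right zero_le_one] at hy
    exact (hasDerivAt_one_sub_sq_rpow α hy).fun_neg.congr_deriv (neg_neg _)
  · rw [min_eq_left zero_le_one, max_eq_right zero_le_one] at hy
    have h1 : 0 ≤ (1 - y ^ 2) ^ α := Real.rpow_nonneg (by nlinarith [hy.1, hy.2]) _
    have h2 : 0 ≤ 2 * (α + 1) := by linarith
    have h3 := hy.1.le
    positivity

theorem isFiniteMeasure_diskMeasure {α : ℝ} (hα : -1 < α) : IsFiniteMeasure (diskMeasure α) := by
  refine isFiniteMeasure_withDensity_ofReal (Integrable.hasFiniteIntegral ?_)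
  have h := (integrableOn_fun_norm_addHaar (E := ℂ) volume
    (f := fun y : ℝ => (α + 1) / Real.pi * (1 - y ^ 2) ^ α) (r := 1)).2 ?_
  · exact h
  rw [← integrableOn_Ioc_iff_integrableOn_Ioo,
    ← intervalIntegrable_iff_integrableOn_Ioc_of_le zero_le_one, Complex.finrank_real_complex]
  refine ((intervalIntegrable_weight hα).const_mul (2 * Real.pi)⁻¹).congr fun y _ => ?_
  simp only [smul_eq_mul, Nat.add_one_sub_one, pow_one]
  field_simp

theorem measurePreserving_mul_left (α : ℝ) {c : ℂ} (hc : ‖c‖ = 1) :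
    MeasurePreserving (fun z => c * z) (diskMeasure α) (diskMeasure α) := by
  let R : ℂ ≃ₗᵢ[ℝ] ℂ := rotation ⟨c, by simpa [Submonoid.unitSphere] using hc⟩
  have hR : ∀ z, R z = c * z := fun z => rfl
  have hRn : ∀ z, ‖c * z‖ = ‖z‖ := fun z => by rw [norm_mul, hc, one_mul]
  have h1 : MeasurePreserving R volume volume := R.measurePreserving
  have hm : Measurable fun z : ℂ =>
      ENNReal.ofReal ((α + 1) / Real.pi * (1 - ‖z‖ ^ 2) ^ α) := by fun_prop
  refine ⟨by fun_prop, Measure.ext fun s hs => ?_⟩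
  rw [Measure.map_apply (by fun_prop) hs, diskMeasure, withDensity_apply _ hs,
    withDensity_apply _ (hs.preimage (by fun_prop)), Measure.restrict_restrict hs,
    Measure.restrict_restrict (hs.preimage (by fun_prop)),
    ← h1.setLIntegral_comp_preimage (hs.inter Metric.isOpen_ball.measurableSet) hm]
  have : R ⁻¹' (s ∩ Metric.ball 0 1) = (fun z => c * z) ⁻¹' s ∩ Metric.ball 0 1 := by
    ext z; simp [hR]
  rw [this]
  simp only [hR, hRn]

/-- Polar coordinates: the dimension `2` and the area `π` of the disk turn the constant `(α+1)/π`
into `2(α+1)`. -/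
theorem integral_diskMeasure_fun_norm {α : ℝ} (hα : -1 < α) (f : ℝ → ℝ) :
    ∫ z, f ‖z‖ ∂(diskMeasure α) = ∫ y in (0 : ℝ)..1, 2 * (α + 1) * y * (1 - y ^ 2) ^ α * f y := by
  have hm : Measurable fun z : ℂ =>
      ENNReal.ofReal ((α + 1) / Real.pi * (1 - ‖z‖ ^ 2) ^ α) := by fun_prop
  rw [diskMeasure, integral_withDensity_eq_integral_toReal_smul hm
    (Eventually.of_forall fun _ => ENNReal.ofReal_lt_top)]
  have e1 : ∫ z in Metric.ball (0 : ℂ) 1,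
      (ENNReal.ofReal ((α + 1) / Real.pi * (1 - ‖z‖ ^ 2) ^ α)).toReal • f ‖z‖ =
      ∫ z : ℂ, (Set.Iio 1).indicator
        (fun y : ℝ => (α + 1) / Real.pi * (1 - y ^ 2) ^ α * f y) ‖z‖ := by
    rw [← integral_indicator Metric.isOpen_ball.measurableSet]
    refine integral_congr_ae (Eventually.of_forall fun z => ?_)
    by_cases hz : ‖z‖ < 1
    · have h0 : 0 ≤ (α + 1) / Real.pi * (1 - ‖z‖ ^ 2) ^ α :=
        mul_nonneg (div_nonneg (by linarith) Real.pi_pos.le)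
          (Real.rpow_nonneg (by nlinarith [norm_nonneg z]) _)
      simp [Set.indicator, hz, ENNReal.toReal_ofReal h0]
    · simp [Set.indicator, hz]
  rw [e1, integral_fun_norm_addHaar, Complex.finrank_real_complex, Measure.real,
    Complex.volume_ball]
  have e2 : ∫ y in Set.Ioi (0 : ℝ), y ^ (2 - 1) • (Set.Iio 1).indicator
        (fun y : ℝ => (α + 1) / Real.pi * (1 - y ^ 2) ^ α * f y) y =
      ∫ y in (0 : ℝ)..1, y * ((α + 1) / Real.pi * (1 - y ^ 2) ^ α * f y) := by
    rw [intervalIntegral.integral_of_le zero_le_one, integral_Ioc_eq_integral_Ioo,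
      ← integral_indicator measurableSet_Ioi, ← integral_indicator measurableSet_Ioo]
    refine integral_congr_ae (Eventually.of_forall fun y => ?_)
    by_cases h1 : 0 < y <;> by_cases h2 : y < 1 <;> simp [Set.indicator, h1, h2]
  rw [e2, ← Nat.cast_smul_eq_nsmul ℝ, ← intervalIntegral.integral_smul,
    ← intervalIntegral.integral_smul]
  refine intervalIntegral.integral_congr fun y _ => ?_
  simp
  field_simp

/-- The moment `∫ |z|^(2n) dA_α`. -/
def moment (α : ℝ) (n : ℕ) : ℝ := ∫ z, ‖z‖ ^ (2 * n) ∂(diskMeasure α)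

theorem moment_eq {α : ℝ} (hα : -1 < α) (n : ℕ) :
    moment α n = ∫ y in (0 : ℝ)..1, 2 * (α + 1) * y * (1 - y ^ 2) ^ α * y ^ (2 * n) :=
  integral_diskMeasure_fun_norm hα fun y => y ^ (2 * n)

theorem intervalIntegrable_weight_mul {α : ℝ} (hα : -1 < α) (n : ℕ) :
    IntervalIntegrable (fun y : ℝ => 2 * (α + 1) * y * (1 - y ^ 2) ^ α * y ^ (2 * n))
      volume 0 1 :=
  (intervalIntegrable_weight hα).mul_continuousOn (by fun_prop)

theorem moment_zero {α : ℝ} (hα : -1 < α) : moment α 0 = 1 := by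
  have h := intervalIntegral.integral_eq_sub_of_hasDerivAt_of_le zero_le_one
    (continuous_one_sub_sq_rpow (β := α + 1) (by linarith)).neg.continuousOn
    (fun y hy => (hasDerivAt_one_sub_sq_rpow α hy).fun_neg)
    (by simpa using intervalIntegrable_weight hα)
  rw [moment_eq hα]
  simp only [neg_neg] at h
  simp only [mul_zero, pow_zero, mul_one]
  rw [h]
  simp [Real.zero_rpow (show α + 1 ≠ 0 by linarith)]

/-- The function `y^(2n+2) (1 - y²)^(α+1)` vanishes at `0` and `1`; its derivative is a combination
of the integrands of the two moments. -/
theorem moment_succ {α : ℝ} (hα : -1 < α) (n : ℕ) :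
    (n + α + 2) * moment α (n + 1) = (n + 1) * moment α n := by
  have hcont : ContinuousOn (fun y : ℝ => y ^ (2 * n + 2) * (1 - y ^ 2) ^ (α + 1))
      (Set.Icc 0 1) :=
    ((continuous_pow _).mul (continuous_one_sub_sq_rpow (by linarith))).continuousOn
  have hi := ((intervalIntegrable_weight_mul hα n).const_mul ((n + 1) / (α + 1))).sub
    ((intervalIntegrable_weight_mul hα (n + 1)).const_mul ((n + α + 2) / (α + 1)))
  have h := intervalIntegral.integral_eq_sub_of_hasDerivAt_of_le zero_le_one hcont
    (fun y hy => ?_) hi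
  · rw [intervalIntegral.integral_sub, intervalIntegral.integral_const_mul,
      intervalIntegral.integral_const_mul, ← moment_eq hα, ← moment_eq hα] at h
    · have h1 : (0 : ℝ) < α + 1 := by linarith
      simp [Real.zero_rpow h1.ne'] at h
      field_simp at h
      linarith
    · exact (intervalIntegrable_weight_mul hα n).const_mul _
    · exact (intervalIntegrable_weight_mul hα (n + 1)).const_mul _
  · have h1 : (0 : ℝ) < α + 1 := by linarith
    have h2 : 0 < 1 - y ^ 2 := by nlinarith [hy.1, hy.2]
    refine ((hasDerivAt_pow (2 * n + 2) y).fun_mul (hasDerivAt_one_sub_sq_rpow α hy)).congr_deriv ?_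
    rw [Real.rpow_add_one h2.ne']
    push_cast
    simp only [mul_add, mul_one, pow_add]
    field_simp
    ring

theorem moment_pos {α : ℝ} (hα : -1 < α) (n : ℕ) : 0 < moment α n := by
  induction n with
  | zero => rw [moment_zero hα]; exact one_pos
  | succ n ih =>
    have h := moment_succ hα n
    have h1 : 0 < (n + α + 2 : ℝ) := by
      have : (0 : ℝ) ≤ n := n.cast_nonneg
      linarith
    have h2 : 0 < (n + 1 : ℝ) * moment α n := by positivity
    rw [← h] at h2
    exact (pos_iff_pos_of_mul_pos h2).1 h1

/-- The recursion `moment_succ` identifies `1 / moment α n` with the binomial coefficient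
`multichoose (α+2) n`, so this is the binomial series. -/
theorem hasSum_pow_div_moment {α : ℝ} (hα : -1 < α) {t : ℝ} (ht0 : 0 ≤ t) (ht : t < 1) :
    HasSum (fun n => t ^ n / moment α n) ((1 - t) ^ (-(α + 2))) := by
  have hmulti : ∀ n : ℕ, moment α n * Ring.multichoose (α + 2) n = 1 := fun n => by
    induction n with
    | zero => rw [moment_zero hα, Ring.multichoose_zero_right, one_mul]
    | succ n ih =>
      have h1 := Ring.factorial_nsmul_multichoose_eq_ascPochhammer (α + 2) n
      have h2 := Ring.factorial_nsmul_multichoose_eq_ascPochhammer (α + 2) (n + 1)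
      rw [Polynomial.ascPochhammer_smeval_eq_eval] at h1 h2
      rw [ascPochhammer_succ_eval, ← h1] at h2
      simp only [nsmul_eq_mul, Nat.factorial_succ, Nat.cast_mul, Nat.cast_add, Nat.cast_one] at h2
      have h3 : (n.factorial : ℝ) ≠ 0 := by positivity
      have h4 : (n + 1 : ℝ) * Ring.multichoose (α + 2) (n + 1) =
          Ring.multichoose (α + 2) n * (α + 2 + n) := by
        apply mul_left_cancel₀ h3
        linear_combination h2
      have h5 := moment_succ hα n
      have h6 : (n + 1 : ℝ) ≠ 0 := by positivity
      apply mul_left_cancel₀ h6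
      linear_combination moment α (n + 1) * h4 + Ring.multichoose (α + 2) n * h5 + (n + 1) * ih
  have h := (Real.one_div_one_sub_rpow_hasFPowerSeriesOnBall_zero (α + 2)).hasSum (y := t) (by
    rw [← ENNReal.ofReal_one, Metric.eball_ofReal, mem_ball_zero_iff, Real.norm_of_nonneg ht0]
    exact ht)
  rw [zero_add, one_div, ← Real.rpow_neg (by linarith)] at h
  have e : (fun n => t ^ n / moment α n) = fun n : ℕ => (FormalMultilinearSeries.ofScalars ℝ
      (fun n : ℕ => Ring.choose (α + 2 + n - 1) n) n) fun _ => t := funext fun n => by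
    have h7 := (moment_pos hα n).ne'
    rw [FormalMultilinearSeries.ofScalars_apply_eq, ← Ring.multichoose_eq, smul_eq_mul,
      div_eq_iff h7]
    linear_combination (-t ^ n) * hmulti n
  rw [e]
  exact h

end DiskMeasure

/-! ### Power series -/

section PowerSeries

open Filter Topology Bergman

variable (i : ImUnit)

/-- The identification of the complex numbers with a slice, as a homomorphism of algebras. -/
def sliceHom : ℂ →ₐ[ℝ] ℍ := Complex.liftAux (i : ℍ) (ImUnit.mul_self i)

theorem sliceHom_apply (z : ℂ) : sliceHom i z = slicePt i z := by
  rw [sliceHom, Complex.liftAux_apply]; rfl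

theorem slicePt_mul (z w : ℂ) : slicePt i (z * w) = slicePt i z * slicePt i w := by
  simp only [← sliceHom_apply, map_mul]

theorem slicePt_pow (z : ℂ) (n : ℕ) : slicePt i (z ^ n) = slicePt i z ^ n := by
  simp only [← sliceHom_apply, map_pow]

theorem slicePt_ofReal (r : ℝ) : slicePt i (r : ℂ) = (r : ℍ) := by
  simp [slicePt]

theorem slicePt_one : slicePt i 1 = 1 := by
  simpa using slicePt_ofReal i 1

theorem slicePt_I : slicePt i Complex.I = i := by
  simp [slicePt]

/-- The complex structure on the quaternions given by the left multiplication by `i`. -/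
@[reducible] def sliceNormedSpace : NormedSpace ℂ ℍ :=
  { Module.compHom ℍ (sliceHom i).toRingHom with
    norm_smul_le := fun z q => by
      change ‖sliceHom i z * q‖ ≤ _
      rw [norm_mul, sliceHom_apply, norm_slicePt] }

theorem slice_smul_def (z : ℂ) (q : ℍ) :
    letI := sliceNormedSpace i
    z • q = slicePt i z * q := by
  change sliceHom i z * q = _
  rw [sliceHom_apply]

theorem isScalarTower_slice :
    letI := sliceNormedSpace i
    IsScalarTower ℝ ℂ ℍ := by
  let := sliceNormedSpace i
  refine ⟨fun r z q => ?_⟩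
  rw [slice_smul_def, slice_smul_def, Complex.real_smul, slicePt_mul, slicePt_ofReal, mul_assoc,
    Quaternion.coe_mul_eq_smul]

/-- The map `z ↦ x₀ + i x₁` as a continuous linear map. -/
def slicePtL : ℂ →L[ℝ] ℍ := LinearMap.toContinuousLinearMap (sliceHom i).toLinearMap

theorem slicePtL_apply (z : ℂ) : slicePtL i z = slicePt i z := sliceHom_apply i z

theorem hasDerivAt_mk_left (x₀ x₁ : ℝ) : HasDerivAt (fun t : ℝ => (⟨t, x₁⟩ : ℂ)) 1 x₀ := by
  have h := (Complex.ofRealCLM.hasDerivAt (x := x₀)).add_const (x₁ * Complex.I)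
  have e : (fun t : ℝ => (⟨t, x₁⟩ : ℂ)) = fun t : ℝ => Complex.ofRealCLM t + x₁ * Complex.I :=
    funext fun t => by apply Complex.ext <;> simp
  rw [e]
  exact h.congr_deriv (by simp)

theorem hasDerivAt_mk_right (x₀ x₁ : ℝ) : HasDerivAt (fun t : ℝ => (⟨x₀, t⟩ : ℂ)) Complex.I x₁ := by
  have h := ((Complex.ofRealCLM.hasDerivAt (x := x₁)).mul_const Complex.I).const_add (x₀ : ℂ)
  have e : (fun t : ℝ => (⟨x₀, t⟩ : ℂ)) = fun t : ℝ => (x₀ : ℂ) + Complex.ofRealCLM t * Complex.I :=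
    funext fun t => by apply Complex.ext <;> simp
  rw [e]
  exact h.congr_deriv (by simp)

/-- A slice hyperholomorphic function is holomorphic on each slice. -/
theorem IsLeftSliceHyperholomorphic.differentiableOn {f : ℍ → ℍ}
    (hf : IsLeftSliceHyperholomorphic unitBall f) :
    letI := sliceNormedSpace i
    DifferentiableOn ℂ (fun z => f (slicePt i z)) (Metric.ball 0 1) := by
  let := sliceNormedSpace i
  have := isScalarTower_slice i
  intro z hz
  obtain ⟨hfd, a, b, hab⟩ := hf
  have hzU : slicePt i z ∈ unitBall := slicePt_mem.2 hz
  obtain ⟨-, -, -, d, e, h4, h5, h6, h7⟩ := hab i z.re z.im hzU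
  have hd : HasFDerivAt (fun z => f (slicePt i z))
      ((fderiv ℝ f (slicePt i z)).comp (slicePtL i)) z := by
    have h1 : HasFDerivAt f (fderiv ℝ f (slicePt i z)) (slicePtL i z) := by
      rw [slicePtL_apply]
      exact ((hfd _ hzU).differentiableAt (Metric.isOpen_ball.mem_nhds hzU)).hasFDerivAt
    have h2 := h1.comp z (slicePtL i).hasFDerivAt
    have e : f ∘ ⇑(slicePtL i) = fun z => f (slicePt i z) :=
      funext fun z => congrArg f (slicePtL_apply i z)
    rwa [e] at h2
  set L := (fderiv ℝ f (slicePt i z)).comp (slicePtL i) with hL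
  have hz0 : (⟨z.re, z.im⟩ : ℂ) = z := rfl
  have hL1 : L 1 = d + i * e := by
    have h1 : HasDerivAt (fun t : ℝ => f (slicePt i ⟨t, z.im⟩)) (L 1) z.re :=
      HasFDerivAt.comp_hasDerivAt (l := fun z => f (slicePt i z)) z.re hd
        (hasDerivAt_mk_left z.re z.im)
    have h2 : HasDerivAt (fun t : ℝ => a t z.im + i * b t z.im) (d + i * e) z.re :=
      h4.add (h6.const_mul _)
    refine h1.unique (h2.congr_of_eventuallyEq ?_)
    have hc : ContinuousAt (fun t : ℝ => (⟨t, z.im⟩ : ℂ)) z.re :=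
      (hasDerivAt_mk_left z.re z.im).continuousAt
    filter_upwards [hc.eventually_mem (Metric.isOpen_ball.mem_nhds hz)] with t ht
    exact (hab i t z.im (slicePt_mem.2 ht)).1
  have hLI : L Complex.I = -e + i * d := by
    have h1 : HasDerivAt (fun t : ℝ => f (slicePt i ⟨z.re, t⟩)) (L Complex.I) z.im :=
      HasFDerivAt.comp_hasDerivAt (l := fun z => f (slicePt i z)) z.im hd
        (hasDerivAt_mk_right z.re z.im)
    have h2 : HasDerivAt (fun t : ℝ => a z.re t + i * b z.re t) (-e + i * d) z.im :=
      h7.add (h5.const_mul _)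
    refine h1.unique (h2.congr_of_eventuallyEq ?_)
    have hc : ContinuousAt (fun t : ℝ => (⟨z.re, t⟩ : ℂ)) z.im :=
      (hasDerivAt_mk_right z.re z.im).continuousAt
    filter_upwards [hc.eventually_mem (Metric.isOpen_ball.mem_nhds hz)] with t ht
    exact (hab i z.re t (slicePt_mem.2 ht)).1
  -- The Cauchy-Riemann system for `a` and `b` says that the real differential commutes with
  -- multiplication by `i` from the left, hence is complex linear.
  have hLI' : L Complex.I = i * L 1 := by
    rw [hL1, hLI, mul_add, ← mul_assoc, ImUnit.mul_self]
    simp [add_comm]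
  refine (hasFDerivAt_of_restrictScalars ℝ (f' := ContinuousLinearMap.toSpanSingleton ℂ (L 1))
    hd ?_).differentiableAt.differentiableWithinAt
  refine ContinuousLinearMap.ext fun w => ?_
  have hw : w = w.re • (1 : ℂ) + w.im • Complex.I := by
    apply Complex.ext <;> simp
  have h3 : L w = slicePt i w * L 1 := by
    conv_lhs => rw [hw, map_add, map_smul, map_smul, hLI']
    rw [slicePt, add_mul, Quaternion.coe_mul_eq_smul, smul_mul_assoc]
  rw [h3]
  change w • L 1 = _
  rw [slice_smul_def]

/-- The Taylor expansion of a slice hyperholomorphic function. -/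
theorem IsLeftSliceHyperholomorphic.exists_coeff {f : ℍ → ℍ}
    (hf : IsLeftSliceHyperholomorphic unitBall f) :
    ∃ c : ℕ → ℍ, ∀ z ∈ Metric.ball (0 : ℂ) 1,
      HasSum (fun n => slicePt i z ^ n * c n) (f (slicePt i z)) := by
  let := sliceNormedSpace i
  refine ⟨fun n => slicePt i ((n.factorial : ℂ)⁻¹) *
    iteratedDeriv n (fun z => f (slicePt i z)) 0, fun z hz => ?_⟩
  have h := Complex.hasSum_taylorSeries_on_ball (hf.differentiableOn i) hz
  have e : ∀ n : ℕ, ((n.factorial : ℂ)⁻¹) • (z - 0) ^ n •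
      iteratedDeriv n (fun z => f (slicePt i z)) 0 = slicePt i z ^ n *
        (slicePt i ((n.factorial : ℂ)⁻¹) * iteratedDeriv n (fun z => f (slicePt i z)) 0) :=
    fun n => by
      rw [smul_smul, slice_smul_def, sub_zero, mul_comm, slicePt_mul, slicePt_pow, mul_assoc]
  simp only [e] at h
  exact h

/-- The coefficients of a power series that converges on the unit ball. -/
def IsCoeff (c : ℕ → ℍ) : Prop := ∀ r : ℝ, 0 ≤ r → r < 1 → Summable fun n => ‖c n‖ * r ^ n

theorem isCoeff_of_hasSum {f : ℍ → ℍ} {c : ℕ → ℍ} (h : ∀ z ∈ Metric.ball (0 : ℂ) 1,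
    HasSum (fun n => slicePt i z ^ n * c n) (f (slicePt i z))) : IsCoeff c := fun r hr0 hr => by
  have hz : (r : ℂ) ∈ Metric.ball (0 : ℂ) 1 := by
    rw [mem_ball_zero_iff, Complex.norm_real, Real.norm_of_nonneg hr0]
    exact hr
  refine (summable_norm_iff.2 (h r hz).summable).congr fun n => ?_
  rw [norm_mul, norm_pow, norm_slicePt, Complex.norm_real, Real.norm_of_nonneg hr0, mul_comm]

variable {i}

/-! ### Sums of power series with coefficients on the right -/

theorem IsCoeff.summable {c : ℕ → ℍ} (hc : IsCoeff c) {x : ℍ} (hx : x ∈ unitBall) :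
    Summable fun n => x ^ n * c n := by
  refine Summable.of_norm ?_
  refine (hc ‖x‖ (norm_nonneg x) (by simpa using hx)).congr fun n => ?_
  rw [norm_mul, norm_pow, mul_comm]

/-- The sum of a power series on the unit ball, extended by zero. -/
def powerSum (c : ℕ → ℍ) (x : ℍ) : ℍ :=
  open Classical in if x ∈ unitBall then ∑' n, x ^ n * c n else 0

theorem IsCoeff.hasSum {c : ℕ → ℍ} (hc : IsCoeff c) {x : ℍ} (hx : x ∈ unitBall) :
    HasSum (fun n => x ^ n * c n) (powerSum c x) := by
  rw [powerSum, if_pos hx]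
  exact (hc.summable hx).hasSum

theorem powerSum_of_notMem (c : ℕ → ℍ) {x : ℍ} (hx : x ∉ unitBall) : powerSum c x = 0 := if_neg hx

theorem one_le_radius {𝕜 E F : Type*} [NontriviallyNormedField 𝕜] [NormedAddCommGroup E]
    [NormedSpace 𝕜 E] [NormedAddCommGroup F] [NormedSpace 𝕜 F]
    (p : FormalMultilinearSeries 𝕜 E F) {c : ℕ → ℍ} (hc : IsCoeff c)
    (hp : ∀ n, ‖p n‖ ≤ ‖c n‖) : 1 ≤ p.radius := by
  refine le_of_forall_lt fun r hr => ?_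
  lift r to NNReal using (hr.trans ENNReal.one_lt_top).ne
  obtain ⟨t, hrt, ht⟩ := exists_between hr
  lift t to NNReal using (ht.trans ENNReal.one_lt_top).ne
  refine hrt.trans_le (p.le_radius_of_summable ?_)
  refine Summable.of_nonneg_of_le (fun n => by positivity)
    (fun n => mul_le_mul_of_nonneg_right (hp n) (by positivity)) (hc t t.2 ?_)
  exact_mod_cast ht

/-- Real differentiability is needed on the whole ball, not only on slices. Each `x^n c` is the
diagonal of the real multilinear map `(x₁, …, x_n) ↦ x₁ ⋯ x_n c`, so the sum is real analytic. -/
theorem IsCoeff.differentiableOn {c : ℕ → ℍ} (hc : IsCoeff c) :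
    DifferentiableOn ℝ (powerSum c) unitBall := by
  let p : FormalMultilinearSeries ℝ ℍ ℍ := fun n =>
    ((ContinuousLinearMap.mul ℝ ℍ).flip (c n)).compContinuousMultilinearMap
      (ContinuousMultilinearMap.mkPiAlgebraFin ℝ n ℍ)
  have hpv : ∀ n x, p n (fun _ => x) = x ^ n * c n := fun n x => by simp [p]
  have hpn : ∀ n, ‖p n‖ ≤ ‖c n‖ := fun n => by
    refine ContinuousMultilinearMap.opNorm_le_bound (norm_nonneg _) fun m => ?_
    simp only [p, ContinuousLinearMap.compContinuousMultilinearMap_coe, Function.comp_apply,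
      ContinuousLinearMap.flip_apply, ContinuousLinearMap.mul_apply', norm_mul,
      ContinuousMultilinearMap.mkPiAlgebraFin_apply]
    rw [mul_comm]
    gcongr
    rw [← List.prod_ofFn]
    have := (List.ofFn m).prod_hom (normHom : ℍ →*₀ ℝ)
    rw [List.map_ofFn] at this
    exact this.ge
  have hr := one_le_radius p hc hpn
  have h := (p.hasFPowerSeriesOnBall (zero_lt_one.trans_le hr)).mono one_pos hr
  have h1 : DifferentiableOn ℝ p.sum unitBall := by
    have := h.differentiableOn
    rwa [← ENNReal.ofReal_one, Metric.eball_ofReal] at this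
  refine h1.congr fun x hx => ?_
  rw [powerSum, if_pos hx, FormalMultilinearSeries.sum]
  simp only [hpv]

theorem IsCoeff.differentiableOn_slice {c : ℕ → ℍ} (hc : IsCoeff c) :
    letI := sliceNormedSpace i
    DifferentiableOn ℂ (fun z => powerSum c (slicePt i z)) (Metric.ball 0 1) := by
  let := sliceNormedSpace i
  let p : FormalMultilinearSeries ℂ ℂ ℍ := fun n => ContinuousMultilinearMap.mkPiRing ℂ (Fin n) (c n)
  have hpv : ∀ n z, p n (fun _ => z) = slicePt i z ^ n * c n := fun n z => by
    simp [p, slice_smul_def, slicePt_pow]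
  have hr := one_le_radius p hc fun n => by simp [p]
  have h := (p.hasFPowerSeriesOnBall (zero_lt_one.trans_le hr)).mono one_pos hr
  have h1 : DifferentiableOn ℂ p.sum (Metric.ball 0 1) := by
    have := h.differentiableOn
    rwa [← ENNReal.ofReal_one, Metric.eball_ofReal] at this
  refine h1.congr fun x hx => ?_
  rw [powerSum, if_pos (slicePt_mem.2 hx), FormalMultilinearSeries.sum]
  simp only [hpv]

theorem slicePt_star_eq (z : ℂ) : slicePt i (star z) = (z.re : ℍ) - z.im • (i : ℍ) := by
  simp [slicePt, sub_eq_add_neg]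

/-- The representation formula for the identity function. Applied to `z ^ n`, it gives the formula
for every monomial, and then for every power series with right coefficients. -/
theorem slicePt_eq_add (i I : ImUnit) (z : ℂ) : slicePt I z =
    (2⁻¹ : ℝ) • (slicePt i z + slicePt i (star z)) +
      I * (-i * ((2⁻¹ : ℝ) • (slicePt i z - slicePt i (star z)))) := by
  have h1 : (2⁻¹ : ℝ) • (slicePt i z + slicePt i (star z)) = (z.re : ℍ) := by
    rw [slicePt_star_eq, slicePt, add_add_sub_cancel, ← two_smul ℝ, smul_smul,
      inv_mul_cancel₀ two_ne_zero, one_smul]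
  have h2 : (2⁻¹ : ℝ) • (slicePt i z - slicePt i (star z)) = z.im • (i : ℍ) := by
    rw [slicePt_star_eq, slicePt, add_sub_sub_cancel, ← two_smul ℝ, smul_smul,
      inv_mul_cancel₀ two_ne_zero, one_smul]
  rw [h1, h2, mul_smul_comm, neg_mul, ImUnit.mul_self, neg_neg, mul_smul_comm, mul_one, slicePt]

/-- A power series with coefficients on the right is slice hyperholomorphic. -/
theorem IsCoeff.isLeftSliceHyperholomorphic (i : ImUnit) {c : ℕ → ℍ} (hc : IsCoeff c) :
    IsLeftSliceHyperholomorphic unitBall (powerSum c) := by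
  let S : ℂ → ℍ := fun z => powerSum c (slicePt i z)
  -- On the slice of `i` the real differential is `w ↦ w D`, so the partial derivatives are `D` and
  -- `i D`.
  have hS : ∀ z ∈ Metric.ball (0 : ℂ) 1, ∃ D : ℍ,
      HasFDerivAt S ((ContinuousLinearMap.mul ℝ ℍ).flip D ∘L slicePtL i) z := fun z hz => by
    let := sliceNormedSpace i
    have := isScalarTower_slice i
    have h1 := ((hc.differentiableOn_slice (i := i) z hz).differentiableAt
      (Metric.isOpen_ball.mem_nhds hz)).hasFDerivAt
    refine ⟨fderiv ℂ S z 1, (h1.restrictScalars ℝ).congr_fderiv ?_⟩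
    refine ContinuousLinearMap.ext fun w => ?_
    change fderiv ℂ S z w = slicePtL i w * fderiv ℂ S z 1
    rw [slicePtL_apply, ← slice_smul_def, ← map_smul, smul_eq_mul, mul_one]
  have hderiv : ∀ z ∈ Metric.ball (0 : ℂ) 1, ∃ D : ℍ,
      HasDerivAt (fun t : ℝ => S ⟨t, z.im⟩) D z.re ∧
      HasDerivAt (fun t : ℝ => S ⟨z.re, t⟩) (i * D) z.im := fun z hz => by
    obtain ⟨D, hD⟩ := hS z hz
    refine ⟨D, ?_, ?_⟩
    · refine (HasFDerivAt.comp_hasDerivAt (l := S) z.re hD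
        (hasDerivAt_mk_left z.re z.im)).congr_deriv ?_
      simp [slicePtL_apply, slicePt_one]
    · refine (HasFDerivAt.comp_hasDerivAt (l := S) z.im hD
        (hasDerivAt_mk_right z.re z.im)).congr_deriv ?_
      simp [slicePtL_apply, slicePt_I]
  -- The representation formula dictates `a = (S(z) + S(z̄))/2` and `b = -i (S(z) - S(z̄))/2`.
  refine ⟨hc.differentiableOn, fun x y => (2⁻¹ : ℝ) • (S ⟨x, y⟩ + S ⟨x, -y⟩),
    fun x y => -i * ((2⁻¹ : ℝ) • (S ⟨x, y⟩ - S ⟨x, -y⟩)), fun I x₀ x₁ hx => ?_⟩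
  have hz : (⟨x₀, x₁⟩ : ℂ) ∈ Metric.ball (0 : ℂ) 1 := slicePt_mem.1 hx
  have hz' : star (⟨x₀, x₁⟩ : ℂ) ∈ Metric.ball (0 : ℂ) 1 := by simpa using hz
  obtain ⟨D₁, h1, h2⟩ := hderiv _ hz
  obtain ⟨D₂, h3, h4⟩ := hderiv _ hz'
  change HasDerivAt (fun t : ℝ => S ⟨t, x₁⟩) D₁ x₀ at h1
  change HasDerivAt (fun t : ℝ => S ⟨x₀, t⟩) (i * D₁) x₁ at h2
  change HasDerivAt (fun t : ℝ => S ⟨t, -x₁⟩) D₂ x₀ at h3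
  change HasDerivAt (fun t : ℝ => S ⟨x₀, t⟩) (i * D₂) (-x₁) at h4
  have h5 : HasDerivAt (fun t : ℝ => S ⟨x₀, -t⟩) (-(i * D₂)) x₁ := by
    refine (HasDerivAt.scomp (g₁ := fun t : ℝ => S ⟨x₀, t⟩) x₁ h4
      (hasDerivAt_neg x₁)).congr_deriv (by simp)
  have hii : ∀ q : ℍ, (i : ℍ) * (i * q) = -q := fun q => by
    rw [← mul_assoc, ImUnit.mul_self, neg_one_mul]
  refine ⟨?_, ?_, ?_, (2⁻¹ : ℝ) • (D₁ + D₂), -i * ((2⁻¹ : ℝ) • (D₁ - D₂)), ?_, ?_, ?_, ?_⟩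
  · have hs := hc.hasSum (slicePt_mem (I := i).2 hz)
    have hs' := hc.hasSum (slicePt_mem (I := i).2 hz')
    refine (hc.hasSum hx).unique ?_
    have h6 := ((hs.add hs').const_smul (2⁻¹ : ℝ)).add
      ((((hs.sub hs').const_smul (2⁻¹ : ℝ)).mul_left (-(i : ℍ))).mul_left (I : ℍ))
    have e : (fun n => slicePt I ⟨x₀, x₁⟩ ^ n * c n) = fun n =>
        (2⁻¹ : ℝ) • (slicePt i ⟨x₀, x₁⟩ ^ n * c n + slicePt i (star ⟨x₀, x₁⟩) ^ n * c n) +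
        I * (-i * ((2⁻¹ : ℝ) •
          (slicePt i ⟨x₀, x₁⟩ ^ n * c n - slicePt i (star ⟨x₀, x₁⟩) ^ n * c n))) :=
      funext fun n => by
        rw [← slicePt_pow, ← slicePt_pow, ← slicePt_pow, ← star_pow, slicePt_eq_add i I, ← add_mul,
          ← sub_mul]
        simp only [add_mul, mul_assoc, smul_mul_assoc]
    rw [e]
    exact h6
  · simp only [neg_neg]
    rw [add_comm]
  · simp only [neg_neg]
    rw [← mul_neg, ← smul_neg, neg_sub]
  · exact (h1.fun_add h3).fun_const_smul (2⁻¹ : ℝ)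
  · refine (((h2.fun_sub h5).fun_const_smul (2⁻¹ : ℝ)).const_mul (-(i : ℍ))).congr_deriv ?_
    rw [sub_neg_eq_add, ← mul_add, mul_smul_comm, neg_mul, hii, neg_neg]
  · exact ((h1.fun_sub h3).fun_const_smul (2⁻¹ : ℝ)).const_mul _
  · refine ((h2.fun_add h5).fun_const_smul (2⁻¹ : ℝ)).congr_deriv ?_
    rw [neg_mul, neg_neg, mul_smul_comm, mul_sub, sub_eq_add_neg]

end PowerSeries

/-! ### The reproducing kernel -/

section Kernel

open Filter Topology QInner
open Bergman hiding qinner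

variable {α : ℝ} [hα : Fact (-1 < α)] {i : ImUnit}

instance : IsFiniteMeasure (diskMeasure α) := isFiniteMeasure_diskMeasure hα.out

theorem IsLeftSliceHyperholomorphic.aestronglyMeasurable_restrict {f : ℍ → ℍ}
    (hf : IsLeftSliceHyperholomorphic unitBall f) (i : ImUnit) :
    AEStronglyMeasurable (fun z => f (slicePt i z)) (volume.restrict (Metric.ball (0 : ℂ) 1)) := by
  have h : ContinuousOn (fun z => f (slicePt i z)) (Metric.ball (0 : ℂ) 1) :=
    hf.1.continuousOn.comp (continuous_slicePt i).continuousOn fun z hz => slicePt_mem.2 hz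
  exact h.aestronglyMeasurable Metric.isOpen_ball.measurableSet

omit hα in
theorem IsLeftSliceHyperholomorphic.aestronglyMeasurable {f : ℍ → ℍ}
    (hf : IsLeftSliceHyperholomorphic unitBall f) :
    AEStronglyMeasurable (fun z => f (slicePt i z)) (diskMeasure α) :=
  (hf.aestronglyMeasurable_restrict i).mono_ac (diskMeasure_absolutelyContinuous α)

/-- Fubini together with rotation invariance. Joint integrability follows because `(θ, z) ↦ (θ,
e^{iθ} z)` preserves the product measure. -/
theorem integral_eq_integral_circle {g : ℂ → ℍ} (hg : Integrable g (diskMeasure α)) :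
    (2 * Real.pi) • ∫ z, g z ∂(diskMeasure α) =
      ∫ z, (∫ θ in (0 : ℝ)..2 * Real.pi, g (Complex.exp (θ * Complex.I) * z))
        ∂(diskMeasure α) := by
  have hpi : (0 : ℝ) ≤ 2 * Real.pi := by positivity
  let ν : Measure ℝ := volume.restrict (Set.Ioc 0 (2 * Real.pi))
  have hrot : ∀ θ : ℝ, MeasurePreserving (fun z => Complex.exp (θ * Complex.I) * z)
      (diskMeasure α) (diskMeasure α) := fun θ =>
    measurePreserving_mul_left α (Complex.norm_exp_ofReal_mul_I θ)
  have hΦ := (MeasurePreserving.id ν).skew_product (μc := diskMeasure α) (μd := diskMeasure α)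
    (g := fun (θ : ℝ) z => Complex.exp (θ * Complex.I) * z)
    (by unfold Function.uncurry; fun_prop) (Eventually.of_forall fun θ => (hrot θ).map_eq)
  have hint : Integrable (Function.uncurry fun (θ : ℝ) z => g (Complex.exp (θ * Complex.I) * z))
      (ν.prod (diskMeasure α)) := hΦ.integrable_comp_of_integrable (hg.comp_snd ν)
  have h1 : ∀ θ : ℝ, ∫ z, g (Complex.exp (θ * Complex.I) * z) ∂(diskMeasure α) =
      ∫ z, g z ∂(diskMeasure α) := fun θ => by
    have h := integral_map (μ := diskMeasure α) (f := g) (hrot θ).measurable.aemeasurable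
      (by rw [(hrot θ).map_eq]; exact hg.1)
    rw [(hrot θ).map_eq] at h
    exact h.symm
  have h2 := integral_integral_swap hint
  simp only [h1] at h2
  simp only [intervalIntegral.integral_of_le hpi]
  rw [← h2, integral_const]
  congr 1
  simp [ν, Measure.real, Real.pi_pos.le]

omit hα in
theorem integral_circle {f : ℍ → ℍ} {c : ℕ → ℍ}
    (hc : ∀ z ∈ Metric.ball (0 : ℂ) 1, HasSum (fun n => slicePt i z ^ n * c n) (f (slicePt i z)))
    (m : ℕ) {z : ℂ} (hz : z ∈ Metric.ball (0 : ℂ) 1) :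
    ∫ θ in (0 : ℝ)..2 * Real.pi, star (slicePt i (Complex.exp (θ * Complex.I) * z) ^ m) *
      f (slicePt i (Complex.exp (θ * Complex.I) * z)) =
      (2 * Real.pi * ‖z‖ ^ (2 * m)) • c m := by
  have hn : ∀ θ : ℝ, ‖Complex.exp (θ * Complex.I) * z‖ = ‖z‖ := fun θ => by
    rw [norm_mul, Complex.norm_exp_ofReal_mul_I, one_mul]
  have hmem : ∀ θ : ℝ, Complex.exp (θ * Complex.I) * z ∈ Metric.ball (0 : ℂ) 1 := fun θ => by
    rw [mem_ball_zero_iff, hn]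
    simpa using hz
  have hcoef := isCoeff_of_hasSum i hc
  have hterm : ∀ (n : ℕ) (θ : ℝ), star (slicePt i (Complex.exp (θ * Complex.I) * z) ^ m) *
      (slicePt i (Complex.exp (θ * Complex.I) * z) ^ n * c n) =
      ((ContinuousLinearMap.mul ℝ ℍ).flip (c n) ∘L slicePtL i)
        (Complex.exp (((n : ℂ) - m) * Complex.I * θ) * (star z ^ m * z ^ n)) := fun n θ => by
    have e : Complex.exp (((n : ℂ) - m) * Complex.I * θ) * (star z ^ m * z ^ n) =
        star (Complex.exp (θ * Complex.I) * z) ^ m * (Complex.exp (θ * Complex.I) * z) ^ n := by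
      have e1 : star (Complex.exp (θ * Complex.I)) = Complex.exp (-(θ * Complex.I)) := by
        rw [← starRingEnd_apply, ← Complex.exp_conj]
        simp
      rw [star_mul', e1, mul_pow, mul_pow, ← Complex.exp_nat_mul, ← Complex.exp_nat_mul,
        mul_mul_mul_comm, ← Complex.exp_add]
      congr 2
      ring
    obtain ⟨w, hw⟩ : ∃ w, w = Complex.exp (θ * Complex.I) * z := ⟨_, rfl⟩
    rw [e, ← hw, ContinuousLinearMap.comp_apply, slicePtL_apply, slicePt_mul, slicePt_pow,
      slicePt_pow, star_pow, star_slicePt]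
    simp [mul_assoc]
  have hsum := intervalIntegral.hasSum_integral_of_dominated_convergence (a := 0)
    (b := 2 * Real.pi) (μ := volume)
    (F := fun (n : ℕ) (θ : ℝ) => star (slicePt i (Complex.exp (θ * Complex.I) * z) ^ m) *
      (slicePt i (Complex.exp (θ * Complex.I) * z) ^ n * c n))
    (f := fun θ : ℝ => star (slicePt i (Complex.exp (θ * Complex.I) * z) ^ m) *
      f (slicePt i (Complex.exp (θ * Complex.I) * z)))
    (fun n _ => ‖z‖ ^ m * (‖c n‖ * ‖z‖ ^ n))
    (fun n => by
      refine Continuous.aestronglyMeasurable ?_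
      have := continuous_slicePt i
      fun_prop)
    (fun n => Eventually.of_forall fun θ _ => by
      rw [norm_mul, norm_mul, norm_star, norm_pow, norm_pow, norm_slicePt, hn, mul_comm ‖c n‖])
    (Eventually.of_forall fun θ _ =>
      (hcoef ‖z‖ (norm_nonneg z) (by simpa using hz)).mul_left _)
    intervalIntegrable_const
    (Eventually.of_forall fun θ _ => (hc _ (hmem θ)).mul_left _)
  have hint : ∀ n : ℕ, (∫ θ in (0 : ℝ)..2 * Real.pi,
      star (slicePt i (Complex.exp (θ * Complex.I) * z) ^ m) *
      (slicePt i (Complex.exp (θ * Complex.I) * z) ^ n * c n)) =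
      if n = m then (2 * Real.pi * ‖z‖ ^ (2 * m)) • c m else 0 := fun n => by
    simp only [hterm]
    rw [ContinuousLinearMap.intervalIntegral_comp_comm _
      (Continuous.intervalIntegrable (by fun_prop) _ _), intervalIntegral.integral_mul_const]
    split_ifs with h
    · subst h
      have e : star z ^ n * z ^ n = ((‖z‖ ^ (2 * n) : ℝ) : ℂ) := by
        rw [← mul_pow, ← starRingEnd_apply, Complex.conj_mul', pow_mul]
        push_cast; rfl
      rw [e]
      simp only [sub_self, zero_mul, Complex.exp_zero, intervalIntegral.integral_const, sub_zero]
      rw [ContinuousLinearMap.comp_apply, slicePtL_apply, smul_mul_assoc, one_mul,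
        Complex.real_smul, ← Complex.ofReal_mul, slicePt_ofReal]
      simp [← Quaternion.coe_mul_eq_smul]
    · have hnm : ((n : ℂ) - m) * Complex.I ≠ 0 :=
        mul_ne_zero (sub_ne_zero.2 (by exact_mod_cast h)) Complex.I_ne_zero
      have e : Complex.exp (((n : ℂ) - m) * Complex.I * ((2 * Real.pi : ℝ) : ℂ)) = 1 := by
        rw [Complex.exp_eq_one_iff]
        exact ⟨(n : ℤ) - m, by push_cast; ring⟩
      rw [integral_exp_mul_complex hnm, e]
      simp
  simp only [hint] at hsum
  exact hsum.unique (hasSum_ite_eq m _)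

theorem integral_star_pow_mul (f : Bergman α i) {c : ℕ → ℍ}
    (hc : ∀ z ∈ Metric.ball (0 : ℂ) 1, HasSum (fun n => slicePt i z ^ n * c n) (f (slicePt i z)))
    (m : ℕ) : Integrable (fun z => star (slicePt i z ^ m) * f (slicePt i z)) (diskMeasure α) ∧
    ∫ z, star (slicePt i z ^ m) * f (slicePt i z) ∂(diskMeasure α) = moment α m • c m := by
  have hf : Integrable (fun z => f (slicePt i z)) (diskMeasure α) :=
    f.2.2.2.integrable one_le_two
  have hg : Integrable (fun z => star (slicePt i z ^ m) * f (slicePt i z)) (diskMeasure α) := by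
    refine hf.mono (AEStronglyMeasurable.mul ?_ hf.1) ?_
    · exact (continuous_star.comp ((continuous_slicePt i).pow m)).aestronglyMeasurable
    · filter_upwards [ae_diskMeasure_mem α] with z hz
      rw [norm_mul, norm_star, norm_pow, norm_slicePt]
      refine mul_le_of_le_one_left (norm_nonneg _) (pow_le_one₀ (norm_nonneg _) ?_)
      exact (mem_ball_zero_iff.1 hz).le
  refine ⟨hg, ?_⟩
  have h := integral_eq_integral_circle hg
  have h2 : ∫ z, (∫ θ in (0 : ℝ)..2 * Real.pi,
      star (slicePt i (Complex.exp (θ * Complex.I) * z) ^ m) *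
        f (slicePt i (Complex.exp (θ * Complex.I) * z))) ∂(diskMeasure α) =
      ∫ z, (2 * Real.pi * ‖z‖ ^ (2 * m)) • c m ∂(diskMeasure α) := by
    refine integral_congr_ae ?_
    filter_upwards [ae_diskMeasure_mem α] with z hz
    exact integral_circle hc m hz
  rw [h2, integral_smul_const, integral_const_mul, mul_smul (2 * Real.pi)] at h
  exact smul_right_injective ℍ (show 2 * Real.pi ≠ 0 by positivity) h

/-- The Taylor coefficients of the reproducing kernel. -/
def kernelCoeff (α : ℝ) (i : ImUnit) (w : ℂ) (n : ℕ) : ℍ :=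
  (moment α n)⁻¹ • slicePt i (star w) ^ n

theorem norm_kernelCoeff (w : ℂ) (n : ℕ) : ‖kernelCoeff α i w n‖ = ‖w‖ ^ n / moment α n := by
  rw [kernelCoeff, norm_smul, norm_pow, norm_slicePt, norm_star,
    Real.norm_of_nonneg (inv_nonneg.2 (moment_pos hα.out n).le), inv_mul_eq_div]

theorem summable_norm_kernelCoeff {w : ℂ} (hw : w ∈ Metric.ball (0 : ℂ) 1) :
    Summable fun n => ‖kernelCoeff α i w n‖ := by
  simp only [norm_kernelCoeff]
  exact (hasSum_pow_div_moment hα.out (norm_nonneg w) (mem_ball_zero_iff.1 hw)).summable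

theorem isCoeff_kernelCoeff {w : ℂ} (hw : w ∈ Metric.ball (0 : ℂ) 1) :
    IsCoeff (kernelCoeff α i w) := fun r hr0 hr =>
  Summable.of_nonneg_of_le (fun n => by positivity)
    (fun n => mul_le_of_le_one_right (norm_nonneg _) (pow_le_one₀ hr0 hr.le))
    (summable_norm_kernelCoeff (α := α) (i := i) hw)

/-- The power series of the reproducing kernel. -/
def kernelSeries (α : ℝ) [hα : Fact (-1 < α)] (i : ImUnit) {w : ℂ}
    (hw : w ∈ Metric.ball (0 : ℂ) 1) : Bergman α i :=
  ⟨powerSum (kernelCoeff α i w), fun _ hx => powerSum_of_notMem _ hx,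
    (isCoeff_kernelCoeff hw).isLeftSliceHyperholomorphic i, by
      refine MemLp.of_bound ((isCoeff_kernelCoeff hw).isLeftSliceHyperholomorphic
        i).aestronglyMeasurable (∑' n, ‖kernelCoeff α i w n‖) ?_
      filter_upwards [ae_diskMeasure_mem α] with z hz
      rw [← ((isCoeff_kernelCoeff hw).hasSum (slicePt_mem.2 hz)).tsum_eq]
      refine tsum_of_norm_bounded (summable_norm_kernelCoeff (α := α) (i := i) hw).hasSum
        fun n => ?_
      rw [norm_mul, norm_pow, norm_slicePt]
      exact mul_le_of_le_one_left (norm_nonneg _)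
        (pow_le_one₀ (norm_nonneg _) (mem_ball_zero_iff.1 hz).le)⟩

theorem kernelSeries_hasSum {w : ℂ} (hw : w ∈ Metric.ball (0 : ℂ) 1) {x : ℍ}
    (hx : x ∈ unitBall) :
    HasSum (fun n => x ^ n * kernelCoeff α i w n) (kernelSeries α i hw x) :=
  (isCoeff_kernelCoeff hw).hasSum hx

/-- The reproducing property. -/
theorem qinner_kernelSeries {w : ℂ} (hw : w ∈ Metric.ball (0 : ℂ) 1) (f : Bergman α i) :
    qinner (kernelSeries α i hw) f = f (slicePt i w) := by
  obtain ⟨c, hc⟩ := f.2.2.1.exists_coeff i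
  have hf : Integrable (fun z => f (slicePt i z)) (diskMeasure α) :=
    f.2.2.2.integrable one_le_two
  have hint := fun m => (integral_star_pow_mul f hc m).1
  have hval := fun m => (integral_star_pow_mul f hc m).2
  have hterm : ∀ (n : ℕ) (z : ℂ), star (slicePt i z ^ n * kernelCoeff α i w n) * f (slicePt i z) =
      star (kernelCoeff α i w n) * (star (slicePt i z ^ n) * f (slicePt i z)) := fun n z => by
    rw [star_mul, mul_assoc]
  -- Termwise integration is justified by `|z| ≤ 1` and the summability of the kernel coefficients:
  -- the `n`-th integral is at most `‖kernelCoeff‖ ∫ |f|`.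
  have h := hasSum_integral_of_summable_integral_norm (μ := diskMeasure α)
    (F := fun (n : ℕ) z => star (slicePt i z ^ n * kernelCoeff α i w n) * f (slicePt i z))
    (fun n => by simp only [hterm]; exact (hint n).const_mul _) (by
      refine Summable.of_nonneg_of_le (fun n => integral_nonneg fun z => norm_nonneg _)
        (fun n => ?_) ((summable_norm_kernelCoeff (α := α) (i := i) hw).mul_right
          (∫ z, ‖f (slicePt i z)‖ ∂(diskMeasure α)))
      rw [← integral_const_mul]
      refine integral_mono_ae (by simp only [hterm]; exact ((hint n).const_mul _).norm)
        (hf.norm.const_mul _) ?_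
      filter_upwards [ae_diskMeasure_mem α] with z hz
      rw [norm_mul, norm_star, norm_mul, norm_pow, norm_slicePt]
      refine mul_le_mul_of_nonneg_right (mul_le_of_le_one_left (norm_nonneg _)
        (pow_le_one₀ (norm_nonneg _) (mem_ball_zero_iff.1 hz).le)) (norm_nonneg _))
  -- The moment from orthogonality cancels the one in `kernelCoeff`, leaving the `n`-th Taylor term
  -- of `f` at `w`.
  have e1 : ∀ n : ℕ, ∫ z, star (slicePt i z ^ n * kernelCoeff α i w n) * f (slicePt i z)
      ∂(diskMeasure α) = slicePt i w ^ n * c n := fun n => by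
    simp only [hterm]
    have hs : star (kernelCoeff α i w n) = (moment α n)⁻¹ • slicePt i w ^ n := by
      rw [kernelCoeff, Quaternion.star_smul, star_pow, star_slicePt, star_star]
    have := ((ContinuousLinearMap.mul ℝ ℍ) (star (kernelCoeff α i w n))).integral_comp_comm (hint n)
    simp only [ContinuousLinearMap.mul_apply'] at this
    rw [this, hval, hs, smul_mul_smul_comm, inv_mul_cancel₀ (moment_pos hα.out n).ne', one_smul]
  have e2 : ∫ z, (∑' n, star (slicePt i z ^ n * kernelCoeff α i w n) * f (slicePt i z))
      ∂(diskMeasure α) = qinner (kernelSeries α i hw) f := by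
    refine integral_congr_ae ?_
    filter_upwards [ae_diskMeasure_mem α] with z hz
    have h1 := kernelSeries_hasSum (α := α) (i := i) hw (slicePt_mem (I := i).2 hz)
    have h2 := (starL.hasSum h1).mul_right (f (slicePt i z))
    exact h2.tsum_eq
  simp only [e1] at h
  rw [e2] at h
  exact h.unique (hc w hw)

/-- The kernel is defined by choice; the explicit series witnesses that the choice is meaningful. -/
theorem kernel_spec {w : ℂ} (hw : w ∈ Metric.ball (0 : ℂ) 1) (f : Bergman α i) :
    f (slicePt i w) = qinner (kernel α i (slicePt i w)) f :=
  Classical.epsilon_spec (p := fun K : Bergman α i => ∀ f : Bergman α i,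
    f (slicePt i w) = qinner K f) ⟨kernelSeries α i hw, fun f => (qinner_kernelSeries hw f).symm⟩ f

theorem kernel_eq {w : ℂ} (hw : w ∈ Metric.ball (0 : ℂ) 1) :
    kernel α i (slicePt i w) = kernelSeries α i hw := by
  have h : ∀ f, qinner (kernel α i (slicePt i w) - kernelSeries α i hw) f = 0 := fun f => by
    rw [qinner_sub_left, ← kernel_spec hw, qinner_kernelSeries, sub_self]
  have h2 := norm_sq_eq_re (kernel α i (slicePt i w) - kernelSeries α i hw)
  rw [h, Quaternion.re_zero] at h2
  rw [← sub_eq_zero]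
  simpa using h2

/-- The values of the reproducing kernel on the diagonal. -/
theorem kernel_self {w : ℂ} (hw : w ∈ Metric.ball (0 : ℂ) 1) :
    kernel α i (slicePt i w) (slicePt i w) = (((1 - ‖w‖ ^ 2) ^ (-(α + 2)) : ℝ) : ℍ) := by
  rw [kernel_eq hw]
  have h1 := kernelSeries_hasSum (α := α) (i := i) hw (slicePt_mem (I := i).2 hw)
  have hw1 := mem_ball_zero_iff.1 hw
  have h2 := hasSum_pow_div_moment hα.out (t := ‖w‖ ^ 2) (by positivity)
    (by nlinarith [norm_nonneg w])
  have h3 := (sliceHom i).toLinearMap.toContinuousLinearMap.hasSum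
    (Complex.ofRealCLM.hasSum h2)
  refine h1.unique ?_
  have e : ∀ r : ℝ, (sliceHom i).toLinearMap.toContinuousLinearMap (Complex.ofRealCLM r) =
      (r : ℍ) := fun r => (sliceHom_apply i _).trans (slicePt_ofReal i r)
  rw [e] at h3
  -- On the diagonal `w w̄ = |w|²`, so the terms are those of the real series at `t = |w|²`.
  have e2 : (fun n => slicePt i w ^ n * kernelCoeff α i w n) = fun n =>
      (sliceHom i).toLinearMap.toContinuousLinearMap
        (Complex.ofRealCLM ((‖w‖ ^ 2) ^ n / moment α n)) := funext fun n => by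
    have e3 : w * star w = ((‖w‖ ^ 2 : ℝ) : ℂ) := by
      rw [← starRingEnd_apply, Complex.mul_conj']
      push_cast; rfl
    rw [e, kernelCoeff, mul_smul_comm, ← slicePt_pow, ← slicePt_pow, ← slicePt_mul, ← mul_pow, e3,
      ← Complex.ofReal_pow, slicePt_ofReal, Quaternion.smul_coe, inv_mul_eq_div]
  rw [e2]
  exact h3

end Kernel

/-! ### Completeness of the Bergman space -/

section Completeness

open Filter Topology QInner
open Bergman hiding qinner

variable {α : ℝ} [hα : Fact (-1 < α)] {i : ImUnit}

theorem diskMeasure_real_univ : (diskMeasure α).real Set.univ = 1 := by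
  have h := moment_zero hα.out
  simpa [moment] using h

theorem eLpNorm_slice (f : Bergman α i) :
    eLpNorm (fun z => f (slicePt i z)) 2 (diskMeasure α) = ENNReal.ofReal ‖f‖ := by
  rw [f.2.2.2.eLpNorm_eq_integral_rpow_norm two_ne_zero ENNReal.ofNat_ne_top]
  congr 1
  have h := norm_sq f
  simp only [ENNReal.toReal_ofNat, Real.rpow_ofNat]
  rw [← h, ← one_div, ← Real.sqrt_eq_rpow, Real.sqrt_sq (norm_nonneg f)]

/-- The measure has mass one. With `t = ∫ |f|`, integrating `2t|f| ≤ t² + |f|²` gives `t² ≤ ‖f‖²`.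
-/
theorem integral_norm_le (f : Bergman α i) :
    ∫ z, ‖f (slicePt i z)‖ ∂(diskMeasure α) ≤ ‖f‖ := by
  set t := ∫ z, ‖f (slicePt i z)‖ ∂(diskMeasure α) with ht
  have h0 : 0 ≤ t := integral_nonneg fun z => norm_nonneg _
  have h1 : Integrable (fun z => ‖f (slicePt i z)‖) (diskMeasure α) :=
    (f.2.2.2.integrable one_le_two).norm
  have h2 : Integrable (fun z => ‖f (slicePt i z)‖ ^ 2) (diskMeasure α) :=
    f.2.2.2.integrable_norm_pow two_ne_zero
  have h3 : ∫ z, (2 * t) * ‖f (slicePt i z)‖ ∂(diskMeasure α) ≤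
      ∫ z, (t ^ 2 + ‖f (slicePt i z)‖ ^ 2) ∂(diskMeasure α) :=
    integral_mono (h1.const_mul _) ((integrable_const _).add h2) fun z => by
      nlinarith [sq_nonneg (t - ‖f (slicePt i z)‖)]
  rw [integral_const_mul, integral_add (integrable_const _) h2, integral_const,
    diskMeasure_real_univ, ← norm_sq, ← ht, one_smul] at h3
  exact (sq_le_sq₀ h0 (norm_nonneg f)).1 (by nlinarith)

/-- The coefficient times the moment is the pairing of `f` with `z^m`, and `|z^m| ≤ 1`. -/
theorem norm_coeff_le (f : Bergman α i) {c : ℕ → ℍ}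
    (hc : ∀ z ∈ Metric.ball (0 : ℂ) 1, HasSum (fun n => slicePt i z ^ n * c n) (f (slicePt i z)))
    (m : ℕ) : ‖c m‖ ≤ ‖f‖ / moment α m := by
  have hm := moment_pos hα.out m
  obtain ⟨h1, h2⟩ := integral_star_pow_mul f hc m
  have h3 : ‖moment α m • c m‖ ≤ ‖f‖ := by
    rw [← h2]
    refine (norm_integral_le_integral_norm _).trans (le_trans ?_ (integral_norm_le f))
    refine integral_mono_ae h1.norm (f.2.2.2.integrable one_le_two).norm ?_
    filter_upwards [ae_diskMeasure_mem α] with z hz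
    rw [norm_mul, norm_star, norm_pow, norm_slicePt]
    exact mul_le_of_le_one_left (norm_nonneg _)
      (pow_le_one₀ (norm_nonneg _) (mem_ball_zero_iff.1 hz).le)
  rw [norm_smul, Real.norm_of_nonneg hm.le] at h3
  rw [le_div_iff₀ hm, mul_comm]
  exact h3

theorem isCoeff_of_le {c : ℕ → ℍ} {M : ℝ} (hc : ∀ n, ‖c n‖ ≤ M / moment α n) : IsCoeff c :=
  fun r hr0 hr => by
    refine Summable.of_nonneg_of_le (fun n => by positivity) (fun n => ?_)
      ((hasSum_pow_div_moment hα.out hr0 hr).summable.mul_left M)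
    calc ‖c n‖ * r ^ n ≤ M / moment α n * r ^ n := by gcongr; exact hc n
      _ = _ := by ring

/-- Coefficients depend continuously on the function, so those of a Cauchy sequence converge; the
limits are the coefficients of the limit function. Completeness is what turns total boundedness into
compactness. -/
instance : CompleteSpace (Bergman α i) := by
  refine Metric.complete_of_cauchySeq_tendsto fun u hu => ?_
  choose c hc using fun k => (u k).2.2.1.exists_coeff i
  have hsub : ∀ k l m, ‖c k m - c l m‖ ≤ ‖u k - u l‖ / moment α m := fun k l m =>
    norm_coeff_le (u k - u l) (c := fun m => c k m - c l m) (fun z hz => by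
      have h := (hc k z hz).sub (hc l z hz)
      simp only [← mul_sub] at h
      exact h) m
  have hcau : ∀ m, CauchySeq fun k => c k m := fun m => by
    refine Metric.cauchySeq_iff.2 fun ε hε => ?_
    have hm := moment_pos hα.out m
    obtain ⟨N, hN⟩ := Metric.cauchySeq_iff.1 hu (ε * moment α m) (by positivity)
    refine ⟨N, fun k hk l hl => ?_⟩
    have h := hN k hk l hl
    rw [dist_eq_norm] at h ⊢
    exact (hsub k l m).trans_lt ((div_lt_iff₀ hm).2 h)
  choose d hd using fun m => cauchySeq_tendsto_of_complete (hcau m)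
  obtain ⟨M, hM⟩ : ∃ M, ∀ k, ‖u k‖ ≤ M := by
    obtain ⟨M, hM⟩ := (Metric.isBounded_iff_subset_closedBall 0).1 hu.isBounded_range
    exact ⟨M, fun k => by simpa using hM (Set.mem_range_self k)⟩
  have hcM : ∀ k m, ‖c k m‖ ≤ M / moment α m := fun k m =>
    (norm_coeff_le (u k) (hc k) m).trans
      (div_le_div_of_nonneg_right (hM k) (moment_pos hα.out m).le)
  have hdM : ∀ m, ‖d m‖ ≤ M / moment α m := fun m =>
    le_of_tendsto (hd m).norm (Eventually.of_forall fun k => hcM k m)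
  have hdc : IsCoeff d := isCoeff_of_le hdM
  have hslice := hdc.isLeftSliceHyperholomorphic i
  -- Pointwise convergence by dominated convergence of the series, with the uniform coefficient
  -- bound `M / moment α n`.
  have hpt : ∀ z ∈ Metric.ball (0 : ℂ) 1,
      Tendsto (fun k => u k (slicePt i z)) atTop (𝓝 (powerSum d (slicePt i z))) := fun z hz => by
    have hz1 := mem_ball_zero_iff.1 hz
    have h := tendsto_tsum_of_dominated_convergence (𝓕 := atTop)
      (f := fun k n => slicePt i z ^ n * c k n) (g := fun n => slicePt i z ^ n * d n)
      (bound := fun n => M * (‖z‖ ^ n / moment α n))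
      ((hasSum_pow_div_moment hα.out (norm_nonneg z) hz1).summable.mul_left M)
      (fun n => (hd n).const_mul _) (Eventually.of_forall fun k n => by
        rw [norm_mul, norm_pow, norm_slicePt]
        calc ‖z‖ ^ n * ‖c k n‖ ≤ ‖z‖ ^ n * (M / moment α n) := by gcongr; exact hcM k n
          _ = _ := by ring)
    rw [(hdc.hasSum (slicePt_mem.2 hz)).tsum_eq] at h
    exact h.congr fun k => (hc k z hz).tsum_eq
  -- Fatou's lemma upgrades pointwise convergence to convergence in norm; it also yields square
  -- integrability of the limit.
  have hfatou : ∀ ε : ℝ, 0 < ε → ∃ N, ∀ k ≥ N,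
      eLpNorm (fun z => powerSum d (slicePt i z) - u k (slicePt i z)) 2 (diskMeasure α) ≤
        ENNReal.ofReal ε := fun ε hε => by
    obtain ⟨N, hN⟩ := Metric.cauchySeq_iff.1 hu ε hε
    refine ⟨N, fun k hk => ?_⟩
    refine (Lp.eLpNorm_lim_le_liminf_eLpNorm
      (f := fun l z => u l (slicePt i z) - u k (slicePt i z))
      (fun l => (u l - u k).2.2.2.1) _ ?_).trans ?_
    · filter_upwards [ae_diskMeasure_mem α] with z hz
      exact (hpt z hz).sub_const _
    · refine liminf_le_of_frequently_le' (Eventually.frequently ?_)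
      filter_upwards [eventually_ge_atTop N] with l hl
      refine (eLpNorm_slice (u l - u k)).le.trans (ENNReal.ofReal_le_ofReal ?_)
      rw [← dist_eq_norm]
      exact (hN l hl k hk).le
  have hmem : MemLp (fun z => powerSum d (slicePt i z)) 2 (diskMeasure α) := by
    obtain ⟨N, hN⟩ := hfatou 1 one_pos
    have h1 : MemLp (fun z => powerSum d (slicePt i z) - u N (slicePt i z)) 2 (diskMeasure α) :=
      ⟨hslice.aestronglyMeasurable.sub (u N).2.2.2.1,
        (hN N le_rfl).trans_lt ENNReal.ofReal_lt_top⟩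
    have h2 := h1.add (u N).2.2.2
    refine h2.ae_eq (Eventually.of_forall fun z => ?_)
    simp
  let F : Bergman α i := ⟨powerSum d, fun _ hx => powerSum_of_notMem _ hx, hslice, hmem⟩
  refine ⟨F, Metric.tendsto_atTop.2 fun ε hε => ?_⟩
  obtain ⟨N, hN⟩ := hfatou (ε / 2) (half_pos hε)
  refine ⟨N, fun k hk => ?_⟩
  have h := (eLpNorm_slice (F - u k)).ge.trans (hN k hk)
  rw [ENNReal.ofReal_le_ofReal_iff (half_pos hε).le] at h
  rw [dist_comm, dist_eq_norm]
  linarith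

end Completeness

/-! ### The Berezin transform -/

section BerezinTransform

open Filter Topology QInner
open Bergman hiding qinner

variable {α : ℝ} [hα : Fact (-1 < α)] {i : ImUnit}

theorem moebiusMeasure_absolutelyContinuous :
    moebiusMeasure ≪ volume.restrict (Metric.ball (0 : ℂ) 1) :=
  withDensity_absolutelyContinuous _ _

theorem ae_moebiusMeasure_mem : ∀ᵐ z ∂moebiusMeasure, z ∈ Metric.ball (0 : ℂ) 1 :=
  moebiusMeasure_absolutelyContinuous.ae_le (ae_restrict_mem Metric.isOpen_ball.measurableSet)

theorem qinner_normalizedKernel {z : ℂ} (hz : z ∈ Metric.ball (0 : ℂ) 1) (f : Bergman α i) :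
    qinner (normalizedKernel α i (slicePt i z)) f =
      √((1 - ‖z‖ ^ 2) ^ (α + 2)) • f (slicePt i z) := by
  have h0 : 0 ≤ 1 - ‖z‖ ^ 2 := by nlinarith [mem_ball_zero_iff.1 hz, norm_nonneg z]
  have h : ∀ (r : ℝ) (g : Bergman α i), r • g = op (r : ℍ) • g := fun r g => Bergman.ext fun x => by
    rw [real_smul_apply, smul_apply, unop_op, Quaternion.mul_coe_eq_smul]
  rw [normalizedKernel, h, qinner_smul_left, ← kernel_spec hz, kernel_self hz, Quaternion.star_coe,
    Quaternion.coe_mul_eq_smul, Quaternion.re_coe, Real.rpow_neg h0, Real.sqrt_inv, inv_inv]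

theorem norm_normalizedKernel {z : ℂ} (hz : z ∈ Metric.ball (0 : ℂ) 1) :
    ‖normalizedKernel α i (slicePt i z)‖ = 1 := by
  have h0 : 0 < 1 - ‖z‖ ^ 2 := by nlinarith [mem_ball_zero_iff.1 hz, norm_nonneg z]
  have h1 : 0 < (1 - ‖z‖ ^ 2) ^ (α + 2) := Real.rpow_pos_of_pos h0 _
  refine (sq_eq_sq₀ (norm_nonneg _) zero_le_one).1 ?_
  rw [norm_sq_eq_re, qinner_normalizedKernel hz, normalizedKernel, real_smul_apply, kernel_self hz,
    Quaternion.re_smul, Quaternion.re_smul, Quaternion.re_coe, Real.rpow_neg h0.le,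
    Real.sqrt_inv, inv_inv, smul_eq_mul, smul_eq_mul, ← mul_assoc, Real.mul_self_sqrt h1.le,
    mul_inv_cancel₀ h1.ne', one_pow]

theorem aestronglyMeasurable_qinner_normalizedKernel (f : Bergman α i) :
    AEStronglyMeasurable (fun z => qinner (normalizedKernel α i (slicePt i z)) f)
      moebiusMeasure := by
  have h1 : AEStronglyMeasurable (fun z => f (slicePt i z)) moebiusMeasure :=
    (f.2.2.1.aestronglyMeasurable_restrict i).mono_ac moebiusMeasure_absolutelyContinuous
  have h2 : Measurable fun z : ℂ => √((1 - ‖z‖ ^ 2) ^ (α + 2)) := by fun_prop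
  refine (h2.aestronglyMeasurable.smul h1).congr ?_
  filter_upwards [ae_moebiusMeasure_mem] with z hz
  exact (qinner_normalizedKernel hz f).symm

/-- `|⟨k_z, f⟩|²`, the Berezin transform of `f ⟨f, ·⟩`. -/
def berezinWeight (f : Bergman α i) (z : ℂ) : ℝ≥0∞ :=
  ENNReal.ofReal (‖qinner (normalizedKernel α i (slicePt i z)) f‖ ^ 2)

theorem aemeasurable_berezinWeight (f : Bergman α i) :
    AEMeasurable (berezinWeight f) moebiusMeasure :=
  ((aestronglyMeasurable_qinner_normalizedKernel f).norm.aemeasurable.pow_const 2).ennreal_ofReal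

/-- The invariant density times `(1 - |z|²)^(α+2)` is the density of `dA_α` divided by `α + 1`. -/
theorem lintegral_berezinWeight (f : Bergman α i) :
    ∫⁻ z, berezinWeight f z ∂moebiusMeasure = ENNReal.ofReal (‖f‖ ^ 2 / (α + 1)) := by
  have hα1 : 0 < α + 1 := by linarith [hα.out]
  have hf := f.2.2.1.aestronglyMeasurable_restrict i
  have hm1 : Measurable fun z : ℂ => ENNReal.ofReal (1 / (Real.pi * (1 - ‖z‖ ^ 2) ^ 2)) := by
    fun_prop
  have hm2 : Measurable fun z : ℂ =>
      ENNReal.ofReal ((α + 1) / Real.pi * (1 - ‖z‖ ^ 2) ^ α) := by fun_prop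
  have hm3 : Measurable fun z : ℂ => (1 - ‖z‖ ^ 2) ^ (α + 2) := by fun_prop
  have hint : Integrable (fun z => ‖f (slicePt i z)‖ ^ 2) (diskMeasure α) :=
    f.2.2.2.integrable_norm_pow two_ne_zero
  have e1 : ∫⁻ z, berezinWeight f z ∂moebiusMeasure =
      ∫⁻ z, ENNReal.ofReal (‖f (slicePt i z)‖ ^ 2 * (1 - ‖z‖ ^ 2) ^ (α + 2)) ∂moebiusMeasure := by
    refine lintegral_congr_ae ?_
    filter_upwards [ae_moebiusMeasure_mem] with z hz
    have h0 : 0 ≤ 1 - ‖z‖ ^ 2 := by nlinarith [mem_ball_zero_iff.1 hz, norm_nonneg z]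
    rw [berezinWeight, qinner_normalizedKernel hz, norm_smul, mul_pow, Real.norm_eq_abs, sq_abs,
      Real.sq_sqrt (Real.rpow_nonneg h0 _), mul_comm]
  have hm4 : AEMeasurable (fun z => ENNReal.ofReal (‖f (slicePt i z)‖ ^ 2))
      (volume.restrict (Metric.ball (0 : ℂ) 1)) :=
    (hf.norm.aemeasurable.pow_const 2).ennreal_ofReal
  have hm5 : AEMeasurable
      (fun z => ENNReal.ofReal (‖f (slicePt i z)‖ ^ 2 * (1 - ‖z‖ ^ 2) ^ (α + 2)))
      (volume.restrict (Metric.ball (0 : ℂ) 1)) :=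
    ((hf.norm.aemeasurable.pow_const 2).mul hm3.aemeasurable).ennreal_ofReal
  rw [e1, norm_sq, div_eq_mul_inv, mul_comm, ENNReal.ofReal_mul (inv_nonneg.2 hα1.le),
    ofReal_integral_eq_lintegral_ofReal hint (Eventually.of_forall fun z => by positivity),
    diskMeasure, lintegral_withDensity_eq_lintegral_mul₀ hm2.aemeasurable hm4,
    moebiusMeasure, lintegral_withDensity_eq_lintegral_mul₀ hm1.aemeasurable hm5,
    ← lintegral_const_mul'' _ (hm2.aemeasurable.mul hm4)]
  refine lintegral_congr_ae ?_
  filter_upwards [ae_restrict_mem Metric.isOpen_ball.measurableSet] with z hz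
  have h0 : 0 < 1 - ‖z‖ ^ 2 := by nlinarith [mem_ball_zero_iff.1 hz, norm_nonneg z]
  have h2 : 0 ≤ (1 - ‖z‖ ^ 2) ^ α := Real.rpow_nonneg h0.le _
  have hpi := Real.pi_pos
  simp only [Pi.mul_apply]
  rw [← ENNReal.ofReal_mul (by positivity), ← ENNReal.ofReal_mul (by positivity),
    ← ENNReal.ofReal_mul (by positivity)]
  congr 1
  rw [Real.rpow_add h0, Real.rpow_two]
  field_simp

/-- Bessel's inequality for the unit vector `k_z`. -/
theorem tsum_berezinWeight_le {e : ℕ → Bergman α i} (he : IsOrthoFamily e) {z : ℂ}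
    (hz : z ∈ Metric.ball (0 : ℂ) 1) : ∑' n, berezinWeight (e n) z ≤ 1 := by
  rw [ENNReal.tsum_eq_iSup_sum]
  refine iSup_le fun F => ?_
  have h := he.bessel F (normalizedKernel α i (slicePt i z))
  simp only [norm_qinner_comm (e _)] at h
  rw [norm_normalizedKernel hz, one_pow] at h
  simp only [berezinWeight]
  rw [← ENNReal.ofReal_sum_of_nonneg fun n _ => by positivity, ← ENNReal.ofReal_one]
  exact ENNReal.ofReal_le_ofReal h

/-- Jensen's inequality for a measure of mass at most one on the natural numbers. -/
theorem tsum_mul_le_rpow_tsum {w f : ℕ → ℝ≥0∞} {p : ℝ} (hp : 1 ≤ p) (hw : ∑' n, w n ≤ 1) :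
    ∑' n, w n * f n ≤ (∑' n, w n * f n ^ p) ^ p⁻¹ := by
  rw [ENNReal.tsum_eq_iSup_sum]
  refine iSup_le fun F => ?_
  have hp' : p⁻¹ ≤ 1 := inv_le_one_of_one_le₀ hp
  -- Weighted Hölder; the factor `(∑ w)^(1 - 1/p)` is at most `1`.
  calc ∑ n ∈ F, w n * f n
      ≤ (∑ n ∈ F, w n) ^ (1 - p⁻¹) * (∑ n ∈ F, w n * f n ^ p) ^ p⁻¹ :=
        ENNReal.inner_le_weight_mul_Lp_of_nonneg F hp w f
    _ ≤ 1 * (∑' n, w n * f n ^ p) ^ p⁻¹ := by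
        gcongr
        · exact ENNReal.rpow_le_one ((ENNReal.sum_le_tsum F).trans hw) (by linarith)
        · exact ENNReal.sum_le_tsum F
    _ = _ := one_mul _

theorem hasSum_berezin {T : Bergman α i →L[ℍᵐᵒᵖ] Bergman α i} {s : ℕ → ℝ}
    {e f : ℕ → Bergman α i}
    (hT : ∀ x, HasSum (fun n => op ((s n : ℍ) * qinner (e n) x) • f n) (T x)) (z : ℂ) :
    HasSum (fun n => qinner (normalizedKernel α i (slicePt i z)) (f n) *
      ((s n : ℍ) * star (qinner (normalizedKernel α i (slicePt i z)) (e n)))) (berezin T z) := by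
  have h := (hT (normalizedKernel α i (slicePt i z))).map
    (qinnerRight (normalizedKernel α i (slicePt i z))) (continuous_qinner _)
  convert h using 2 with n
  · change _ = qinner _ (op _ • f n)
    rw [smul_right, conj_symm]
  · rfl

/-- The Berezin transform of an operator in the Schatten class is in `L^p`. -/
theorem memLp_berezin {T : Bergman α i →L[ℍᵐᵒᵖ] Bergman α i} {p : ℝ≥0∞} (hp1 : 1 ≤ p)
    (hp : p ≠ ∞) (hT : T ∈ Schatten (J α i) p) : MemLp (berezin T) p moebiusMeasure := by
  obtain ⟨-, -, s, hs, hsp⟩ := hT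
  have hs0 : ∀ n, 0 ≤ s n := hs.2.1
  obtain ⟨e, f, he, hf, hsum⟩ := hs.exists_decomposition
  have hp0 : p ≠ 0 := (zero_lt_one.trans_le hp1).ne'
  have hpr1 : 1 ≤ p.toReal := by
    rw [← ENNReal.toReal_one]
    exact (ENNReal.toReal_le_toReal ENNReal.one_ne_top hp).2 hp1
  have hpr : 0 < p.toReal := zero_lt_one.trans_le hpr1
  have hα1 : 0 < α + 1 := by linarith [hα.out]
  have hmeas : AEStronglyMeasurable (berezin T) moebiusMeasure := by
    refine aestronglyMeasurable_of_tendsto_ae atTop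
      (f := fun N z => ∑ n ∈ Finset.range N,
        qinner (normalizedKernel α i (slicePt i z)) (f n) *
        ((s n : ℍ) * star (qinner (normalizedKernel α i (slicePt i z)) (e n)))) (fun N => ?_)
      (Eventually.of_forall fun z => (hasSum_berezin hsum z).tendsto_sum_nat)
    refine Finset.aestronglyMeasurable_fun_sum _ fun n _ => ?_
    exact (aestronglyMeasurable_qinner_normalizedKernel (f n)).mul
      (aestronglyMeasurable_const.mul
        (continuous_star.comp_aestronglyMeasurable
          (aestronglyMeasurable_qinner_normalizedKernel (e n))))
  refine ⟨hmeas, ?_⟩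
  rw [eLpNorm_lt_top_iff_lintegral_rpow_enorm_lt_top hp0 hp]
  -- By `|x||y| ≤ (|x|² + |y|²)/2`, the two orthogonal families can be replaced by one set of
  -- weights, still of total mass at most one and of integral at most `1/(α+1)` each.
  let a : ℕ → ℂ → ℝ≥0∞ := fun n z => (berezinWeight (e n) z + berezinWeight (f n) z) / 2
  have ha : ∀ n, AEMeasurable (a n) moebiusMeasure := fun n =>
    ((aemeasurable_berezinWeight (e n)).add (aemeasurable_berezinWeight (f n))).div_const 2
  have hasum : ∀ z ∈ Metric.ball (0 : ℂ) 1, ∑' n, a n z ≤ 1 := fun z hz => by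
    simp only [a, div_eq_mul_inv]
    rw [ENNReal.tsum_mul_right, ENNReal.tsum_add, ← div_eq_mul_inv]
    refine ENNReal.div_le_of_le_mul ?_
    calc _ ≤ (1 : ℝ≥0∞) + 1 :=
          add_le_add (tsum_berezinWeight_le he hz) (tsum_berezinWeight_le hf hz)
      _ = 1 * 2 := by norm_num
  have haint : ∀ n, ∫⁻ z, a n z ∂moebiusMeasure ≤ ENNReal.ofReal (1 / (α + 1)) := fun n => by
    have h1 : ∀ {g : ℕ → Bergman α i}, IsOrthoFamily g →
        ∫⁻ z, berezinWeight (g n) z ∂moebiusMeasure ≤ ENNReal.ofReal (1 / (α + 1)) :=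
      fun {g} hg => by
        rw [lintegral_berezinWeight]
        refine ENNReal.ofReal_le_ofReal (div_le_div_of_nonneg_right ?_ hα1.le)
        rcases hg.2 n with h | h <;> rw [h] <;> simp
    have h2 : AEMeasurable (fun z => berezinWeight (e n) z + berezinWeight (f n) z)
        moebiusMeasure := (aemeasurable_berezinWeight (e n)).add (aemeasurable_berezinWeight (f n))
    have h3 : ∫⁻ z, a n z ∂moebiusMeasure =
        (∫⁻ z, (berezinWeight (e n) z + berezinWeight (f n) z) ∂moebiusMeasure) * 2⁻¹ :=
      lintegral_mul_const'' _ h2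
    rw [h3, lintegral_add_left' (aemeasurable_berezinWeight (e n)), ← div_eq_mul_inv]
    refine ENNReal.div_le_of_le_mul ((add_le_add (h1 he) (h1 hf)).trans ?_)
    rw [mul_two]
  have hbound : ∀ z ∈ Metric.ball (0 : ℂ) 1, ‖berezin T z‖ₑ ^ p.toReal ≤
      ∑' n, a n z * ENNReal.ofReal (s n) ^ p.toReal := fun z hz => by
    have h1 : ‖berezin T z‖ₑ ≤ ∑' n, a n z * ENNReal.ofReal (s n) := by
      rw [← (hasSum_berezin hsum z).tsum_eq]
      refine (enorm_tsum_le_tsum_enorm).trans (ENNReal.tsum_le_tsum fun n => ?_)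
      set x := qinner (normalizedKernel α i (slicePt i z)) (f n) with hx
      set y := qinner (normalizedKernel α i (slicePt i z)) (e n) with hy
      have e1 : a n z = ENNReal.ofReal ((‖y‖ ^ 2 + ‖x‖ ^ 2) / 2) := by
        simp only [a, berezinWeight]
        rw [← hx, ← hy, ← ENNReal.ofReal_add (by positivity) (by positivity),
          ENNReal.ofReal_div_of_pos two_pos, ENNReal.ofReal_ofNat]
      rw [e1, ← ENNReal.ofReal_mul (by positivity), ← ofReal_norm]
      refine ENNReal.ofReal_le_ofReal ?_
      rw [norm_mul, norm_mul, norm_star, Quaternion.norm_coe, Real.norm_of_nonneg (hs0 n)]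
      nlinarith [mul_nonneg (hs0 n) (sq_nonneg (‖x‖ - ‖y‖))]
    calc ‖berezin T z‖ₑ ^ p.toReal
        ≤ ((∑' n, a n z * ENNReal.ofReal (s n) ^ p.toReal) ^ p.toReal⁻¹) ^ p.toReal := by
          gcongr
          exact h1.trans (tsum_mul_le_rpow_tsum hpr1 (hasum z hz))
      _ = _ := ENNReal.rpow_inv_rpow hpr.ne' _
  have hsfin : ∑' n, ENNReal.ofReal (s n) ^ p.toReal ≠ ∞ := by
    have h1 := (memℓp_gen_iff hpr).1 hsp
    have h2 : ∀ n, ENNReal.ofReal (s n) ^ p.toReal = ENNReal.ofReal (‖s n‖ ^ p.toReal) :=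
      fun n => by
        rw [Real.norm_of_nonneg (hs0 n), ENNReal.ofReal_rpow_of_nonneg (hs0 n) hpr.le]
    simp only [h2]
    exact h1.tsum_ofReal_ne_top
  calc ∫⁻ z, ‖berezin T z‖ₑ ^ p.toReal ∂moebiusMeasure
      ≤ ∫⁻ z, ∑' n, a n z * ENNReal.ofReal (s n) ^ p.toReal ∂moebiusMeasure := by
        refine lintegral_mono_ae ?_
        filter_upwards [ae_moebiusMeasure_mem] with z hz
        exact hbound z hz
    _ = ∑' n, ∫⁻ z, a n z * ENNReal.ofReal (s n) ^ p.toReal ∂moebiusMeasure :=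
        lintegral_tsum fun n => (ha n).mul_const _
    _ ≤ ∑' n, ENNReal.ofReal (1 / (α + 1)) * ENNReal.ofReal (s n) ^ p.toReal := by
        refine ENNReal.tsum_le_tsum fun n => ?_
        rw [lintegral_mul_const'' _ (ha n)]
        gcongr
        exact haint n
    _ = ENNReal.ofReal (1 / (α + 1)) * ∑' n, ENNReal.ofReal (s n) ^ p.toReal :=
        ENNReal.tsum_mul_left
    _ < ∞ := ENNReal.mul_lt_top ENNReal.ofReal_lt_top hsfin.lt_top

/-- A positive operator whose Berezin transform is integrable is a Hilbert-Schmidt operator. -/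
theorem IsPositive.exists_sum_norm_sq_le {T : Bergman α i →L[ℍᵐᵒᵖ] Bergman α i}
    (hT : IsPositive T) (hint : ∫⁻ z, ‖berezin T z‖ₑ ∂moebiusMeasure ≠ ∞) :
    ∃ C : ℝ, ∀ e : ℕ → Bergman α i, IsOrthoFamily e → ∀ F : Finset ℕ,
      ∑ n ∈ F, ‖T (e n)‖ ^ 2 ≤ C := by
  have hα1 : 0 < α + 1 := by linarith [hα.out]
  obtain ⟨M, hM0, hM⟩ := exists_bound T
  set B := ∫⁻ z, ‖berezin T z‖ₑ ∂moebiusMeasure with hB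
  refine ⟨M * B.toReal * (α + 1), fun e he F => ?_⟩
  -- By symmetry `|⟨k_z, T e_n⟩| = |⟨e_n, T k_z⟩|`; Bessel bounds the sum of squares by `‖T k_z‖²`,
  -- which is at most `M T~(z)`.
  have h1 : ∀ z ∈ Metric.ball (0 : ℂ) 1, ∑ n ∈ F, berezinWeight (T (e n)) z ≤
      ENNReal.ofReal M * ‖berezin T z‖ₑ := fun z hz => by
    simp only [berezinWeight]
    rw [← ENNReal.ofReal_sum_of_nonneg fun n _ => by positivity, ← ofReal_norm,
      ← ENNReal.ofReal_mul hM0]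
    refine ENNReal.ofReal_le_ofReal ?_
    have h2 := he.bessel F (T (normalizedKernel α i (slicePt i z)))
    have h3 := hT.norm_sq_le hM (normalizedKernel α i (slicePt i z))
    have h4 : (berezin T z).re ≤ ‖berezin T z‖ := (le_abs_self _).trans (abs_re_le_norm _)
    have h5 : ∀ n, ‖qinner (normalizedKernel α i (slicePt i z)) (T (e n))‖ =
        ‖qinner (e n) (T (normalizedKernel α i (slicePt i z)))‖ := fun n => by
      rw [← hT.symm, norm_qinner_comm]
    simp only [h5]
    exact h2.trans (h3.trans (mul_le_mul_of_nonneg_left h4 hM0))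
  have h2 : ∑ n ∈ F, ENNReal.ofReal (‖T (e n)‖ ^ 2 / (α + 1)) ≤ ENNReal.ofReal M * B := by
    simp only [← lintegral_berezinWeight]
    rw [← lintegral_finsetSum' _ fun n _ => aemeasurable_berezinWeight (T (e n)), hB,
      ← lintegral_const_mul' _ _ ENNReal.ofReal_ne_top]
    refine lintegral_mono_ae ?_
    filter_upwards [ae_moebiusMeasure_mem] with z hz
    exact h1 z hz
  rw [← ENNReal.ofReal_sum_of_nonneg fun n _ => by positivity, ← Finset.sum_div,
    ← ENNReal.ofReal_toReal hint, ← ENNReal.ofReal_mul hM0,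
    ENNReal.ofReal_le_ofReal_iff (by positivity), div_le_iff₀ hα1] at h2
  exact h2

/-- A positive operator with a Berezin transform in `L^p`, `p ≤ 1`, is in the Schatten class. -/
theorem IsPositive.mem_schatten {T : Bergman α i →L[ℍᵐᵒᵖ] Bergman α i}
    (hT : IsPositive T) (hTJ : T ∘L J α i = J α i ∘L T) {p : ℝ≥0∞} (hp0 : 0 < p) (hp1 : p ≤ 1)
    (hb : MemLp (berezin T) p moebiusMeasure) : T ∈ Schatten (J α i) p := by
  have hα1 : 0 < α + 1 := by linarith [hα.out]
  have hp : p ≠ ∞ := (hp1.trans_lt ENNReal.one_lt_top).ne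
  have hpr : 0 < p.toReal := ENNReal.toReal_pos hp0.ne' hp
  have hpr1 : p.toReal ≤ 1 := by
    rw [← ENNReal.toReal_one]
    exact (ENNReal.toReal_le_toReal hp ENNReal.one_ne_top).2 hp1
  have hbp := (eLpNorm_lt_top_iff_lintegral_rpow_enorm_lt_top hp0.ne' hp).1 hb.2
  -- Boundedness `|T~| ≤ M` gives `|T~| ≤ M^(1-p) |T~|^p`, so `L^p` is enough for `L^1`.
  have hint : ∫⁻ z, ‖berezin T z‖ₑ ∂moebiusMeasure ≠ ∞ := by
    obtain ⟨M, hM0, hM⟩ := exists_bound T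
    refine ne_top_of_le_ne_top (ENNReal.mul_ne_top
      (ENNReal.rpow_ne_top_of_nonneg (y := 1 - p.toReal) (by linarith)
        (ENNReal.ofReal_ne_top (r := M))) hbp.ne) ?_
    rw [← lintegral_const_mul' _ _ (ENNReal.rpow_ne_top_of_nonneg (by linarith)
      ENNReal.ofReal_ne_top)]
    refine lintegral_mono_ae ?_
    filter_upwards [ae_moebiusMeasure_mem] with z hz
    have h1 : ‖berezin T z‖ₑ ≤ ENNReal.ofReal M := by
      rw [← ofReal_norm]
      refine ENNReal.ofReal_le_ofReal ((norm_qinner_le _ _).trans ?_)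
      have h2 := hM (normalizedKernel α i (slicePt i z))
      rw [norm_normalizedKernel hz, mul_one] at h2
      rw [norm_normalizedKernel hz, one_mul]
      exact h2
    calc ‖berezin T z‖ₑ = ‖berezin T z‖ₑ ^ (1 - p.toReal) * ‖berezin T z‖ₑ ^ p.toReal := by
          rw [← ENNReal.rpow_add_of_nonneg _ _ (by linarith) hpr.le, sub_add_cancel,
            ENNReal.rpow_one]
      _ ≤ _ := by
          gcongr
  obtain ⟨C, hC⟩ := hT.exists_sum_norm_sq_le hint
  have hK := isCompact_closure_image_ball T hC
  obtain ⟨e, s, he, hanti, hs0, hs1, hsum⟩ := hT.exists_eigenbasis hC hK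
  -- A positive `T` is its own adjoint and its own absolute value, so its eigenvalues are its
  -- singular values.
  refine ⟨⟨_, hK, mem_of_superset (Metric.closedBall_mem_nhds 0 one_pos) fun x hx =>
    subset_closure (Set.mem_image_of_mem T hx)⟩, hTJ, s, ⟨hanti, hs0, T, ⟨hT, T, hT.symm, rfl⟩, e,
      fun m n hm hn => ?_, hsum⟩, ?_⟩
  · split_ifs with h
    · rw [h, inner_self, hs1 n hn, one_pow, Quaternion.coe_one]
    · exact he.1 m n h
  have hbound : ∀ z ∈ Metric.ball (0 : ℂ) 1,
      ∑' n, berezinWeight (e n) z * ENNReal.ofReal (s n) ^ p.toReal ≤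
        ‖berezin T z‖ₑ ^ p.toReal := fun z hz => by
    have h1 : HasSum (fun n => ‖qinner (normalizedKernel α i (slicePt i z)) (e n)‖ ^ 2 * s n)
        (berezin T z).re := by
      have h2 := reL.hasSum (hasSum_berezin hsum z)
      convert h2 using 2 with n
      · change _ = (_ : ℍ).re
        rw [Quaternion.coe_commutes, ← mul_assoc, Quaternion.self_mul_star,
          Quaternion.normSq_eq_norm_mul_self, ← Quaternion.coe_mul, Quaternion.re_coe, sq]
      · rfl
    have h3 : ∑' n, berezinWeight (e n) z * ENNReal.ofReal (s n) ≤ ‖berezin T z‖ₑ := by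
      have h4 : ∀ n, berezinWeight (e n) z * ENNReal.ofReal (s n) = ENNReal.ofReal
          (‖qinner (normalizedKernel α i (slicePt i z)) (e n)‖ ^ 2 * s n) := fun n => by
        rw [berezinWeight, ENNReal.ofReal_mul (by positivity)]
      simp only [h4]
      rw [← ENNReal.ofReal_tsum_of_nonneg (fun n => mul_nonneg (by positivity) (hs0 n))
        h1.summable, h1.tsum_eq, ← ofReal_norm]
      exact ENNReal.ofReal_le_ofReal ((le_abs_self _).trans (abs_re_le_norm _))
    -- Jensen with exponent `1/p ≥ 1` applied to `s_n^p`: this reverses the roles compared with the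
    -- case `p ≥ 1`.
    have h5 := tsum_mul_le_rpow_tsum (w := fun n => berezinWeight (e n) z)
      (f := fun n => ENNReal.ofReal (s n) ^ p.toReal) (p := p.toReal⁻¹)
      ((one_le_inv₀ hpr).2 hpr1) (tsum_berezinWeight_le he hz)
    simp only [ENNReal.rpow_rpow_inv hpr.ne', inv_inv] at h5
    exact h5.trans (ENNReal.rpow_le_rpow h3 hpr.le)
  have hterm : ∀ n, ∫⁻ z, berezinWeight (e n) z * ENNReal.ofReal (s n) ^ p.toReal ∂moebiusMeasure =
      ENNReal.ofReal (1 / (α + 1)) * ENNReal.ofReal (‖s n‖ ^ p.toReal) := fun n => by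
    rw [lintegral_mul_const'' _ (aemeasurable_berezinWeight (e n)), lintegral_berezinWeight,
      Real.norm_of_nonneg (hs0 n), ENNReal.ofReal_rpow_of_nonneg (hs0 n) hpr.le]
    -- The vector `e n` is only known to be a unit vector when `s n ≠ 0`; otherwise both sides
    -- vanish since `p > 0`.
    by_cases hn : s n = 0
    · rw [hn, Real.zero_rpow hpr.ne']; simp
    · rw [hs1 n hn, one_pow]
  have hfin : ENNReal.ofReal (1 / (α + 1)) * ∑' n, ENNReal.ofReal (‖s n‖ ^ p.toReal) < ∞ := by
    rw [← ENNReal.tsum_mul_left]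
    simp only [← hterm]
    rw [← lintegral_tsum fun n => (aemeasurable_berezinWeight (e n)).mul_const _]
    refine lt_of_le_of_lt (lintegral_mono_ae ?_) hbp
    filter_upwards [ae_moebiusMeasure_mem] with z hz
    exact hbound z hz
  refine (memℓp_gen_iff hpr).2 ?_
  have hne : ∑' n, ENNReal.ofReal (‖s n‖ ^ p.toReal) ≠ ∞ := fun h => by
    rw [h, ENNReal.mul_top (by simpa using hα1)] at hfin
    exact hfin.ne rfl
  refine (ENNReal.summable_toReal hne).congr fun n => ?_
  rw [ENNReal.toReal_ofReal (by positivity)]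

end BerezinTransform

end SliceBergman

end

/-! ### The theorem for the Berezin transform and the Schatten classes -/

theorem mainTheorem5 (α : ℝ) [Fact (-1 < α)] (i : SliceBergman.ImUnit) :
    (∀ T : SliceBergman.Bergman α i →L[ℍᵐᵒᵖ] SliceBergman.Bergman α i,
      SliceBergman.IsPositive T →
      T ∘L SliceBergman.Bergman.J α i = SliceBergman.Bergman.J α i ∘L T →
      (∀ p : ℝ≥0∞, 1 ≤ p → p ≠ ∞ →
        T ∈ SliceBergman.Schatten (SliceBergman.Bergman.J α i) p →
        MemLp (SliceBergman.Bergman.berezin T) p SliceBergman.moebiusMeasure) ∧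
      (∀ p : ℝ≥0∞, 0 < p → p ≤ 1 →
        MemLp (SliceBergman.Bergman.berezin T) p SliceBergman.moebiusMeasure →
        T ∈ SliceBergman.Schatten (SliceBergman.Bergman.J α i) p)) ∧
    (∀ T : SliceBergman.Bergman α i →L[ℍᵐᵒᵖ] SliceBergman.Bergman α i,
      ∀ p : ℝ≥0∞, 1 ≤ p → p ≠ ∞ →
        T ∈ SliceBergman.Schatten (SliceBergman.Bergman.J α i) p →
        MemLp (SliceBergman.Bergman.berezin T) p SliceBergman.moebiusMeasure) := by
  have key : ∀ T : SliceBergman.Bergman α i →L[ℍᵐᵒᵖ] SliceBergman.Bergman α i,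
      ∀ p : ℝ≥0∞, 1 ≤ p → p ≠ ∞ →
        T ∈ SliceBergman.Schatten (SliceBergman.Bergman.J α i) p →
        MemLp (SliceBergman.Bergman.berezin T) p SliceBergman.moebiusMeasure :=
    fun _ _ hp1 hp hT => SliceBergman.memLp_berezin hp1 hp hT
  exact ⟨fun T hT hTJ => ⟨key T, fun _ hp0 hp1 hb => hT.mem_schatten hTJ hp0 hp1 hb⟩, key⟩
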